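/- Let $\lambda\in\mathbb{R}$, $\langle x\rangle=(1+|x|^2)^{1/2}$, $\square=\partial_t^2-\partial_x^2$, $N(u)=\lambda|u|^2u$, and $\|f\|_{H^{2,5/2}}=\sum_{j=0}^{2}\|\langle x\rangle^{5/2}\partial_x^jf\|_{L^2(\mathbb{R})}$ (weak derivatives); $H^{2,5/2}(\mathbb{R})$ is the space of complex-valued $f\in L^2(\mathbb{R})$ for which this is finite. For $A_1,B_1\in H^{2,5/2}(\mathbb{R})$ put $$S_A=\tfrac{\lambda}{2}\langle z\rangle^{-1}(|A_1|^2+2|B_1|^2),\quad S_B=-\tfrac{\lambda}{2}\langle z\rangle^{-1}(2|A_1|^2+|B_1|^2),\quad A_2=-\tfrac{\lambda}{8}A_1^2\overline{B_1},\quad B_2=-\tfrac{\lambda}{8}\overline{A_1}B_1^2$$ as functions of $z\in\mathbb{R}$, and, with $\theta=-\sqrt{t^2-x^2}$ and $\mu=x/\sqrt{t^2-x^2}$ for $|x|<t$, let $\tilde u=u_{\mathrm{ap}}+v_{\mathrm{ap}}$, where $$u_{\mathrm{ap}}(t,x)=t^{-1/2}\mathbf 1_{\{|x|<t\}}\big[A_1(\mu)e^{i\theta+iS_A(\mu)\log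 t}+B_1(\mu)e^{-i\theta+iS_B(\mu)\log t}\big],$$ $$v_{\mathrm{ap}}(t,x)=t^{-3/2}\mathbf 1_{\{|x|<t\}}\big[A_2(\mu)e^{3i\theta+i(2S_A(\mu)-S_B(\mu))\log t}+B_2(\mu)e^{-3i\theta+i(2S_B(\mu)-S_A(\mu))\log t}\big].$$ (1) There is a constant $C$ depending only on $\lambda$ such that, for all $A_1,B_1\in H^{2,5/2}(\mathbb{R})$ and all $t\ge3$, with $m=\|A_1\|_{L^\infty}+\|B_1\|_{L^\infty}$ and $M=\|A_1\|_{H^{2,5/2}}+\|B_1\|_{H^{2,5/2}}$, $$\|\tilde u(t)\|_{L^\infty_x}\le C\,t^{-1/2}\,m\,\langle m\rangle^2,\qquad \|(\square+1)\tilde u(t)-N(\tilde u(t))\|_{L^2_x}\le C\,t^{-2}(\log t)^2\,M\,\langle M\rangle^8,$$ where $(\square+1)\tilde u(t)$ is taken in the sense of distributions in $x$ for each $t>1$. (2) In particular, for every $\varepsilon_0>0$ there is $\eta>0$, depending only on $\varepsilon_0$ and $\lambda$, such that if $A_1,B_1\in H^{2,5/2}(\mathbb{R})$ and $\|A_1\|_{L^\infty}+\|B_1\|_{L^\infty}\le\eta$,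 then for every $\delta_0<1$ there is $T\ge1$ with $$\|\tilde u(t)\|_{L^\infty_x}\le\varepsilon_0t^{-1/2},\qquad \|(\square+1)\tilde u(t)-N(\tilde u(t))\|_{L^2_x}\le\varepsilon_0t^{-1-\delta_0}\qquad(t\ge T).$$ (3) If $A_1,B_1\in H^{2,5/2}(\mathbb{R})$ and the set $\{\xi\in\mathbb{R}: |A_1(\xi)|\ne|B_1(\xi)|\}$ has positive measure, then $\liminf_{t\to\infty}\|\mathrm{Im}\,\tilde u(t)\|_{L^2_x(\mathbb{R})}>0$. -/

import Mathlib

open MeasureTheory Filter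
open scoped ENNReal ContDiff

noncomputable section

namespace KG

/-- The Japanese bracket `⟨x⟩ = (1 + x²)^{1/2}`. -/
def jbr (x : ℝ) : ℝ := Real.sqrt (1 + x ^ 2)

/-- `g` is the `j`-th derivative of `f` in the sense of distributions on `ℝ`. -/
def IsWeakDeriv (j : ℕ) (f g : ℝ → ℂ) : Prop :=
  LocallyIntegrable g volume ∧
    ∀ φ : ℝ → ℝ, ContDiff ℝ ∞ φ → HasCompactSupport φ →
      ∫ x, iteratedDeriv j φ x • f x = (-1 : ℂ) ^ j * ∫ x, φ x • g x

open Classical in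
/-- The `j`-th weak derivative of `f` (unique up to null sets), and `0` if there is none. -/
def weakDeriv (j : ℕ) (f : ℝ → ℂ) : ℝ → ℂ :=
  if h : ∃ g, IsWeakDeriv j f g then h.choose else 0

/-- Membership in the weighted Sobolev space `H^{k,s}(ℝ)`. -/
def MemWSobolev (k : ℕ) (s : ℝ) (f : ℝ → ℂ) : Prop :=
  MemLp f 2 volume ∧
    ∀ j ≤ k, (∃ g, IsWeakDeriv j f g) ∧
      MemLp (fun x => (jbr x ^ s) • weakDeriv j f x) 2 volume

/-- The norm `‖f‖_{H^{k,s}} = ∑_{j ≤ k} ‖⟨x⟩^s ∂^j f‖_{L²}`. -/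
def wSobolevNorm (k : ℕ) (s : ℝ) (f : ℝ → ℂ) : ℝ :=
  ∑ j ∈ Finset.range (k + 1),
    (eLpNorm (fun x => (jbr x ^ s) • weakDeriv j f x) 2 volume).toReal

/-- The `L^∞` norm as a real number. -/
def linftyNorm (f : ℝ → ℂ) : ℝ := (eLpNorm f ∞ volume).toReal

/-- The cubic nonlinearity `N(u) = λ |u|² u`. -/
def cubic (lam : ℝ) (u : ℂ) : ℂ := (lam : ℂ) * ((‖u‖ ^ 2 : ℝ) : ℂ) * u

/-- `θ(t,x) = -(t² - x²)^{1/2}`. -/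
def theta (t x : ℝ) : ℝ := -Real.sqrt (t ^ 2 - x ^ 2)

/-- `μ(t,x) = x (t² - x²)^{-1/2}`. -/
def mu (t x : ℝ) : ℝ := x / Real.sqrt (t ^ 2 - x ^ 2)

/-- The phase modulation accompanying `e^{iθ}`. -/
def phaseA (lam : ℝ) (A B : ℝ → ℂ) (z : ℝ) : ℝ :=
  lam / 2 * (jbr z)⁻¹ * (‖A z‖ ^ 2 + 2 * ‖B z‖ ^ 2)

/-- The phase modulation accompanying `e^{-iθ}`. -/
def phaseB (lam : ℝ) (A B : ℝ → ℂ) (z : ℝ) : ℝ :=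
  -(lam / 2) * (jbr z)⁻¹ * (2 * ‖A z‖ ^ 2 + ‖B z‖ ^ 2)

/-- `A₂ = -(λ/8) A₁² \bar B₁`. -/
def ampA2 (lam : ℝ) (A B : ℝ → ℂ) (z : ℝ) : ℂ :=
  -((lam : ℂ) / 8) * A z ^ 2 * (starRingEnd ℂ) (B z)

/-- `B₂ = -(λ/8) \bar A₁ B₁²`. -/
def ampB2 (lam : ℝ) (A B : ℝ → ℂ) (z : ℝ) : ℂ :=
  -((lam : ℂ) / 8) * (starRingEnd ℂ) (A z) * B z ^ 2

/-- `e^{ip}` for a real phase `p`. -/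
def cis (p : ℝ) : ℂ := Complex.exp (Complex.I * (p : ℂ))

/-- The leading profile `u_ap`. -/
def uap (lam : ℝ) (A B : ℝ → ℂ) (t x : ℝ) : ℂ :=
  if |x| < t then
    ((t ^ (-(1 / 2) : ℝ) : ℝ) : ℂ) *
      (A (mu t x) * cis (theta t x + phaseA lam A B (mu t x) * Real.log t) +
        B (mu t x) * cis (-theta t x + phaseB lam A B (mu t x) * Real.log t))
  else 0

/-- The third-harmonic correction `v_ap`. -/
def vap (lam : ℝ) (A B : ℝ → ℂ) (t x : ℝ) : ℂ :=
  if |x| < t then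
    ((t ^ (-(3 / 2) : ℝ) : ℝ) : ℂ) *
      (ampA2 lam A B (mu t x) *
          cis (3 * theta t x + 2 * phaseA lam A B (mu t x) * Real.log t
            - phaseB lam A B (mu t x) * Real.log t) +
        ampB2 lam A B (mu t x) *
          cis (-3 * theta t x - phaseA lam A B (mu t x) * Real.log t
            + 2 * phaseB lam A B (mu t x) * Real.log t))
  else 0

/-- The profile `ũ = u_ap + v_ap`. -/
def profile (lam : ℝ) (A B : ℝ → ℂ) (t x : ℝ) : ℂ :=
  uap lam A B t x + vap lam A B t x

/-- `(□ + 1) u(t) = G(t)` in `D'(ℝ)` for every `t > T`, where `□ = ∂_t² - ∂_x²`: for each test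
function `φ` of `x`, the pairing `⟨u(t), φ⟩` is twice differentiable in `t > T`, and its second
derivative is `⟨u(t), φ''⟩ - ⟨u(t), φ⟩ + ⟨G(t), φ⟩`. This determines `G(t)` up to null sets
for every `t > T`. -/
def IsBoxPlusOne (T : ℝ) (u G : ℝ → ℝ → ℂ) : Prop :=
  (∀ t, T < t → LocallyIntegrable (u t) volume ∧ LocallyIntegrable (G t) volume) ∧
    ∀ φ : ℝ → ℝ, ContDiff ℝ ∞ φ → HasCompactSupport φ →
      ∃ p : ℝ → ℂ, ∀ t, T < t →
        HasDerivAt (fun s => ∫ x, φ x • u s x) (p t) t ∧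
        HasDerivAt p
          ((∫ x, iteratedDeriv 2 φ x • u t x) - (∫ x, φ x • u t x) + ∫ x, φ x • G t x) t

end KG

end

/-
Inside the cone put `x = t z / ⟨z⟩`, so that `z = μ(t, x)` and `θ = -t / ⟨z⟩`. The approximate
solution becomes a sum of four modes `t^(r-1) f(z) exp (i κ t / ⟨z⟩ + i S(z) log t)` with `κ = ∓1,
∓3`, and a weak form of `□ + 1` in these coordinates needs only two derivatives of `f` and `S`, the
second one in a weighted `L²`. On a mode `□ + 1` acts as `1 - κ²`, plus a transport term of
relative size `t⁻¹`, plus a remainder of relative size `t⁻² (log t)²`. For `κ = ∓1` the choice of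
`S_A`, `S_B` makes the transport term cancel the resonant part of the cubic nonlinearity; for `κ =
∓3` the factor `1 - 9 = -8` and the choice of `A₂`, `B₂` cancel the third harmonics. The pointwise
decay `⟨z⟩² (|f| + |f′|) ≲ ‖f‖` in `H^{2,5/2}` makes all remainders square integrable.

For the imaginary part, `Im (α + β) = Im (α - β̄)` turns the two leading waves into a single
carrier times a slow amplitude of modulus at least `||A₁| - |B₁||`. In `(Im w)² = (|w|² - Re w²) /
2` the last term oscillates like `exp (-2 i t / ⟨z⟩)`, and its integral tends to zero by
nonstationary phase against a weight that vanishes at the stationary point `z = 0`.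
-/

noncomputable section

namespace KG

section LocAC

variable {E : Type*} [NormedAddCommGroup E]

/-- Local absolute continuity on the line: absolute continuity on every compact interval. -/
def LocAC (f : ℝ → E) : Prop := ∀ a b : ℝ, AbsolutelyContinuousOnInterval f a b

namespace LocAC

theorem of_dist_le {X : Type*} [PseudoMetricSpace X] {g : ℝ → X} {f : ℝ → E}
    (hg : ∀ a b, AbsolutelyContinuousOnInterval g a b)
    (h : ∀ x y, dist (f x) (f y) ≤ dist (g x) (g y)) : LocAC f := by
  intro a b
  rw [absolutelyContinuousOnInterval_iff]
  intro ε hε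
  obtain ⟨δ, hδ, H⟩ := (absolutelyContinuousOnInterval_iff g a b).1 (hg a b) ε hε
  exact ⟨δ, hδ, fun I hI hI' => (Finset.sum_le_sum fun i _ => h _ _).trans_lt (H I hI hI')⟩

theorem const (c : E) : LocAC fun _ : ℝ => c :=
  of_dist_le (g := fun _ : ℝ => (0 : ℝ))
    (fun _ _ => contDiffOn_const.absolutelyContinuousOnInterval) (by simp)

theorem add {f g : ℝ → E} (hf : LocAC f) (hg : LocAC g) : LocAC fun x => f x + g x :=
  fun a b => (hf a b).add (hg a b)

theorem sub {f g : ℝ → E} (hf : LocAC f) (hg : LocAC g) : LocAC fun x => f x - g x :=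
  fun a b => (hf a b).sub (hg a b)

theorem smul {R : Type*} [NormedRing R] [Module R E] [NormSMulClass R E] {f : ℝ → R} {g : ℝ → E}
    (hf : LocAC f) (hg : LocAC g) : LocAC fun x => f x • g x :=
  fun a b => (hf a b).smul (hg a b)

theorem mul {f g : ℝ → ℂ} (hf : LocAC f) (hg : LocAC g) : LocAC fun x => f x * g x := hf.smul hg

theorem conj {f : ℝ → ℂ} (hf : LocAC f) : LocAC fun x => (starRingEnd ℂ) (f x) :=
  of_dist_le hf fun _ _ => (Complex.dist_conj_conj _ _).le

theorem continuous {f : ℝ → E} (hf : LocAC f) : Continuous f := by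
  refine continuous_iff_continuousAt.2 fun x =>
    (hf (x - 1) (x + 1)).continuousOn.continuousAt ?_
  rw [Set.uIcc_of_le (by linarith)]
  exact Icc_mem_nhds (by linarith) (by linarith)

variable [NormedSpace ℝ E]

theorem of_hasDerivAt {f f' : ℝ → E} (h : ∀ x, HasDerivAt f (f' x) x) (hc : Continuous f') :
    LocAC f := by
  have hf : ContDiff ℝ 1 f := contDiff_one_iff_deriv.2
    ⟨fun x => (h x).differentiableAt, by rwa [funext fun x => (h x).deriv]⟩
  exact fun _ _ => hf.contDiffOn.absolutelyContinuousOnInterval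

theorem intervalIntegral {g : ℝ → E} (hg : LocallyIntegrable g volume) (c : ℝ) :
    LocAC fun x => ∫ v in c..x, g v := by
  have hI : ∀ a b, IntervalIntegrable g volume a b := fun a b =>
    (hg.integrableOn_isCompact isCompact_uIcc).intervalIntegrable
  refine of_dist_le (g := fun x => ∫ v in c..x, ‖g v‖) (fun a b => ?_) fun x y => ?_
  · have h : AbsolutelyContinuousOnInterval (fun x => ∫ v in c..x, ‖g v‖)
        (min a (min b c)) (max a (max b c)) :=
      (hI _ _).norm.absolutelyContinuousOnInterval_intervalIntegral (by
        rw [Set.mem_uIcc]; left; simp)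
    refine h.mono ?_
    rw [Set.uIcc_of_le (a := min a (min b c)) (by simp), Set.uIcc]
    exact Set.Icc_subset_Icc (by simp [← min_assoc]) (by simp [← max_assoc])
  · rw [dist_comm, dist_comm (∫ v in c..x, ‖g v‖), dist_eq_norm, dist_eq_norm,
      intervalIntegral.integral_interval_sub_left (hI _ _) (hI _ _),
      intervalIntegral.integral_interval_sub_left (hI _ _).norm (hI _ _).norm, Real.norm_eq_abs]
    exact intervalIntegral.norm_integral_le_abs_integral_norm

variable [CompleteSpace E]

theorem integral_eq_sub {f f' : ℝ → E} (hf : LocAC f) (hd : ∀ᵐ x, HasDerivAt f (f' x) x)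
    (hi : LocallyIntegrable f' volume) (a b : ℝ) : ∫ x in a..b, f' x = f b - f a := by
  have hg : LocAC fun x => f x - ∫ v in a..x, f' v := hf.sub (intervalIntegral hi a)
  obtain ⟨C, hC⟩ := (hg a b).const_of_ae_hasDerivAt_zero (by
    filter_upwards [hd, _root_.LocallyIntegrable.ae_hasDerivAt_integral hi] with x h1 h2 _
    simpa using h1.fun_sub (h2 a))
  have ha : f a = C := by simpa using hC a Set.left_mem_uIcc
  rw [ha, ← hC b Set.right_mem_uIcc]
  abel

theorem integral_deriv_eq_zero {f f' : ℝ → E} (hf : LocAC f) (hd : ∀ᵐ x, HasDerivAt f (f' x) x)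
    (hi : Integrable f' volume) (h0 : Tendsto f (cocompact ℝ) (nhds 0)) : ∫ x, f' x = 0 := by
  rw [cocompact_eq_atBot_atTop, tendsto_sup] at h0
  have h : Tendsto (fun x : ℝ => ∫ y in (-x)..x, f' y) atTop (nhds 0) := by
    simp only [hf.integral_eq_sub hd hi.locallyIntegrable]
    simpa using h0.2.sub (h0.1.comp tendsto_neg_atTop_atBot)
  exact tendsto_nhds_unique
    (intervalIntegral_tendsto_integral hi tendsto_neg_atTop_atBot tendsto_id) h

end LocAC

end LocAC

section WeakDerivative

theorem exists_testFunction_primitive {χ : ℝ → ℝ} (hχ : ContDiff ℝ ∞ χ) (hc : HasCompactSupport χ)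
    (h0 : ∫ x, χ x = 0) :
    ∃ Φ : ℝ → ℝ, ContDiff ℝ ∞ Φ ∧ HasCompactSupport Φ ∧ deriv Φ = χ := by
  obtain ⟨R, hR⟩ := hc.isCompact.isBounded.subset_closedBall 0
  rw [Real.closedBall_eq_Icc, zero_sub, zero_add] at hR
  have hz : ∀ x, x ∉ Set.Icc (-R) R → χ x = 0 := fun x hx =>
    image_eq_zero_of_notMem_tsupport fun h => hx (hR h)
  have hI : Integrable χ volume := hχ.continuous.integrable_of_hasCompactSupport hc
  have hd : ∀ x, HasDerivAt (fun x => ∫ v in Set.Iic x, χ v) (χ x) x := by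
    intro x
    have h := (intervalIntegral.integral_hasDerivAt_right
      (hχ.continuous.intervalIntegrable 0 x) (hχ.continuous.stronglyMeasurableAtFilter _ _)
      hχ.continuous.continuousAt).const_add (∫ v in Set.Iic 0, χ v)
    convert! h using 2
    rw [← intervalIntegral.integral_Iic_sub_Iic hI.integrableOn hI.integrableOn, add_sub_cancel]
  have hderiv : deriv (fun x => ∫ v in Set.Iic x, χ v) = χ := funext fun x => (hd x).deriv
  refine ⟨_, contDiff_infty_iff_deriv.2 ⟨fun x => (hd x).differentiableAt, by rwa [hderiv]⟩,
    HasCompactSupport.of_support_subset_isCompact (isCompact_Icc (a := -R) (b := R)) ?_, hderiv⟩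
  refine Function.support_subset_iff'.2 fun x hx => ?_
  rw [Set.mem_Icc, not_and_or, not_le, not_le] at hx
  rcases hx with h | h
  · exact setIntegral_eq_zero_of_forall_eq_zero fun v hv =>
      hz v fun h' => (h'.1.trans (Set.mem_Iic.1 hv)).not_gt h
  · rw [← h0]
    exact setIntegral_eq_integral_of_forall_compl_eq_zero fun v hv =>
      hz v fun h' => hv (h'.2.trans h.le)

variable {E : Type*} [NormedAddCommGroup E] [NormedSpace ℝ E] [CompleteSpace E]

theorem ae_eq_const_of_weakDeriv_eq_zero {h : ℝ → E} (hh : LocallyIntegrable h volume)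
    (H : ∀ φ : ℝ → ℝ, ContDiff ℝ ∞ φ → HasCompactSupport φ → ∫ x, deriv φ x • h x = 0) :
    ∃ c : E, ∀ᵐ x, h x = c := by
  let b : ContDiffBump (0 : ℝ) := ⟨1, 2, one_pos, one_lt_two⟩
  let ψ := b.normed volume
  have hψ : ContDiff ℝ ∞ ψ := b.contDiff_normed
  have hψc : HasCompactSupport ψ := b.hasCompactSupport_normed
  refine ⟨∫ x, ψ x • h x, ?_⟩
  refine ae_eq_of_integral_contDiff_smul_eq hh (locallyIntegrable_const _) fun φ hφ hφc => ?_
  have hi : ∀ g : ℝ → ℝ, ContDiff ℝ ∞ g → HasCompactSupport g →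
      Integrable (fun x => g x • h x) volume := fun g hg hgc =>
    hh.integrable_smul_left_of_hasCompactSupport hg.continuous hgc
  -- `φ` differs from a multiple of the unit-mass bump `ψ` by the derivative of a test function.
  obtain ⟨Φ, hΦ, hΦc, hΦ'⟩ := exists_testFunction_primitive
    (χ := fun x => φ x - (∫ y, φ y) * ψ x) (hφ.sub (contDiff_const.mul hψ))
    (hφc.sub (HasCompactSupport.mul_left hψc)) (by
      rw [integral_sub (hφ.continuous.integrable_of_hasCompactSupport hφc)
        ((hψ.continuous.integrable_of_hasCompactSupport hψc).const_mul _), integral_const_mul,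
        b.integral_normed, mul_one, sub_self])
  have h0 := H Φ hΦ hΦc
  simp only [hΦ', sub_smul, mul_smul] at h0
  rw [integral_sub (hi φ hφ hφc) ((hi ψ hψ hψc).fun_smul (∫ y, φ y)), integral_smul] at h0
  rw [integral_smul_const]
  exact sub_eq_zero.1 h0

theorem integral_deriv_smul_intervalIntegral {g : ℝ → E} (hg : LocallyIntegrable g volume)
    {φ : ℝ → ℝ} (hφ : ContDiff ℝ ∞ φ) (hφc : HasCompactSupport φ) (a : ℝ) :
    ∫ x, deriv φ x • (∫ v in a..x, g v) = -∫ x, φ x • g x := by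
  have hG := LocAC.intervalIntegral hg a
  have hφ' : ContDiff ℝ ∞ (deriv φ) := (contDiff_infty_iff_deriv.1 hφ).2
  have hd : ∀ x, HasDerivAt φ (deriv φ x) x := fun x => (hφ.differentiable (by simp) x).hasDerivAt
  have hGl := hG.continuous.locallyIntegrable (μ := volume)
  have i1 := hGl.integrable_smul_left_of_hasCompactSupport hφ'.continuous hφc.deriv
  have i2 := hg.integrable_smul_left_of_hasCompactSupport hφ.continuous hφc
  have h := ((LocAC.of_hasDerivAt hd hφ'.continuous).smul hG).integral_deriv_eq_zero
    (f' := fun x => φ x • g x + deriv φ x • ∫ v in a..x, g v)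
    (by
      filter_upwards [_root_.LocallyIntegrable.ae_hasDerivAt_integral hg] with x hx
      exact (hd x).fun_smul (hx a))
    (i2.add i1) (hφc.smul_right (f' := fun x => ∫ v in a..x, g v)).is_zero_at_infty
  rw [integral_add i2 i1] at h
  exact eq_neg_of_add_eq_zero_right h

theorem exists_ae_eq_const_add_integral_of_weakDeriv {f g : ℝ → E}
    (hf : LocallyIntegrable f volume) (hg : LocallyIntegrable g volume)
    (H : ∀ φ : ℝ → ℝ, ContDiff ℝ ∞ φ → HasCompactSupport φ →
      ∫ x, deriv φ x • f x = -∫ x, φ x • g x) :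
    ∃ c : E, ∀ᵐ x, f x = c + ∫ v in (0 : ℝ)..x, g v := by
  have hG := (LocAC.intervalIntegral hg 0).continuous.locallyIntegrable (μ := volume)
  obtain ⟨c, hc⟩ := ae_eq_const_of_weakDeriv_eq_zero (hf.sub hG) (fun φ hφ hφc => by
    have hφ' : Continuous (deriv φ) := (contDiff_infty_iff_deriv.1 hφ).2.continuous
    simp only [Pi.sub_apply, smul_sub]
    rw [integral_sub (hf.integrable_smul_left_of_hasCompactSupport hφ' hφc.deriv)
      (hG.integrable_smul_left_of_hasCompactSupport hφ' hφc.deriv), H φ hφ hφc,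
      integral_deriv_smul_intervalIntegral hg hφ hφc, sub_self])
  exact ⟨c, hc.mono fun x hx => sub_eq_iff_eq_add.1 hx⟩

end WeakDerivative

section HyperbolicCoordinates

theorem jbr_sq (z : ℝ) : jbr z ^ 2 = 1 + z ^ 2 := Real.sq_sqrt (by positivity)

theorem jbr_pos (z : ℝ) : 0 < jbr z := Real.sqrt_pos.2 (by positivity)

theorem jbr_ne_zero (z : ℝ) : jbr z ≠ 0 := (jbr_pos z).ne'

theorem ofReal_jbr_ne_zero (z : ℝ) : (jbr z : ℂ) ≠ 0 := Complex.ofReal_ne_zero.2 (jbr_ne_zero z)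

theorem one_le_jbr (z : ℝ) : 1 ≤ jbr z :=
  Real.one_le_sqrt.2 (le_add_of_nonneg_right (sq_nonneg z))

theorem abs_le_jbr (z : ℝ) : |z| ≤ jbr z := Real.abs_le_sqrt (by linarith)

theorem inv_jbr_cube_pos (z : ℝ) : 0 < (jbr z ^ 3)⁻¹ := inv_pos.2 (pow_pos (jbr_pos z) 3)

theorem hasDerivAt_jbr (z : ℝ) : HasDerivAt jbr (z / jbr z) z := by
  have h : HasDerivAt (fun z : ℝ => 1 + z ^ 2) (2 * z) z := by
    simpa using (hasDerivAt_pow 2 z).const_add 1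
  exact (h.sqrt (by positivity)).congr_deriv (mul_div_mul_left _ _ two_ne_zero)

@[fun_prop]
theorem continuous_jbr : Continuous jbr := by unfold jbr; fun_prop

theorem continuous_inv_jbr_cube : Continuous fun z => (jbr z ^ 3)⁻¹ :=
  (continuous_jbr.pow 3).inv₀ fun z => pow_ne_zero 3 (jbr_ne_zero z)

theorem integrable_inv_jbr_sq : Integrable (fun z => (jbr z ^ 2)⁻¹) volume := by
  simp only [jbr_sq]
  exact integrable_inv_one_add_sq

theorem integrable_inv_jbr_cube : Integrable (fun z => (jbr z ^ 3)⁻¹) volume := by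
  refine integrable_inv_jbr_sq.mono' continuous_inv_jbr_cube.aestronglyMeasurable
    (Eventually.of_forall fun z => ?_)
  rw [Real.norm_of_nonneg (inv_jbr_cube_pos z).le]
  exact inv_anti₀ (pow_pos (jbr_pos z) 2) (pow_le_pow_right₀ (one_le_jbr z) (by norm_num))

/-- The velocity `z / ⟨z⟩` of the ray `x = t v` on which `μ(t,x) = z`. -/
def vel (z : ℝ) : ℝ := z / jbr z

theorem hasDerivAt_vel (z : ℝ) : HasDerivAt vel (jbr z ^ 3)⁻¹ z := by
  refine ((hasDerivAt_id' z).fun_div (hasDerivAt_jbr z) (jbr_ne_zero z)).congr_deriv ?_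
  have := jbr_ne_zero z
  have := jbr_sq z
  field_simp
  linarith

@[fun_prop]
theorem continuous_vel : Continuous vel :=
  continuous_iff_continuousAt.2 fun z => (hasDerivAt_vel z).continuousAt

theorem vel_sq (z : ℝ) : vel z ^ 2 = 1 - (jbr z ^ 2)⁻¹ := by
  have := jbr_ne_zero z
  have := jbr_sq z
  unfold vel
  field_simp
  linarith

theorem abs_vel_lt_one (z : ℝ) : |vel z| < 1 := by
  rw [← sq_lt_one_iff_abs_lt_one, vel_sq]
  exact sub_lt_self 1 (inv_pos.2 (pow_pos (jbr_pos z) 2))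

theorem abs_mul_vel_lt {t : ℝ} (ht : 0 < t) (z : ℝ) : |t * vel z| < t := by
  rw [abs_mul, abs_of_pos ht]
  exact mul_lt_of_lt_one_right ht (abs_vel_lt_one z)

theorem sqrt_sq_sub_mul_vel_sq {t : ℝ} (ht : 0 < t) (z : ℝ) :
    Real.sqrt (t ^ 2 - (t * vel z) ^ 2) = t / jbr z := by
  rw [mul_pow, vel_sq, show t ^ 2 - t ^ 2 * (1 - (jbr z ^ 2)⁻¹) = (t / jbr z) ^ 2 by
    rw [div_pow]; ring]
  exact Real.sqrt_sq (div_pos ht (jbr_pos z)).le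

theorem mu_mul_vel {t : ℝ} (ht : 0 < t) (z : ℝ) : mu t (t * vel z) = z := by
  have := jbr_ne_zero z
  rw [mu, sqrt_sq_sub_mul_vel_sq ht, vel]
  field_simp

theorem sq_sub_sq_pos {t x : ℝ} (hx : |x| < t) : 0 < t ^ 2 - x ^ 2 :=
  sub_pos.2 (sq_lt_sq' (abs_lt.1 hx).1 (abs_lt.1 hx).2)

theorem jbr_mu {t x : ℝ} (hx : |x| < t) : jbr (mu t x) = t / Real.sqrt (t ^ 2 - x ^ 2) := by
  have ht : 0 < t := (abs_nonneg x).trans_lt hx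
  have h := sq_sub_sq_pos hx
  have hsq : 1 + mu t x ^ 2 = (t / Real.sqrt (t ^ 2 - x ^ 2)) ^ 2 := by
    rw [mu, div_pow, div_pow, Real.sq_sqrt h.le]
    field_simp
    ring
  rw [jbr, hsq, Real.sqrt_sq (by positivity)]

theorem theta_eq {t x : ℝ} (hx : |x| < t) : theta t x = -(t / jbr (mu t x)) := by
  rw [jbr_mu hx, theta, div_div_cancel₀ ((abs_nonneg x).trans_lt hx).ne']

theorem mul_vel_mu {t x : ℝ} (hx : |x| < t) : t * vel (mu t x) = x := by
  have ht : 0 < t := (abs_nonneg x).trans_lt hx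
  have h := Real.sqrt_pos.2 (sq_sub_sq_pos hx)
  rw [vel, jbr_mu hx, mu]
  field_simp

theorem image_mul_vel {t : ℝ} (ht : 0 < t) :
    (fun z => t * vel z) '' Set.univ = {x | |x| < t} :=
  Set.Subset.antisymm (Set.image_subset_iff.2 fun z _ => abs_mul_vel_lt ht z)
    fun x hx => ⟨mu t x, trivial, mul_vel_mu hx⟩

theorem injective_mul_vel {t : ℝ} (ht : 0 < t) : Function.Injective fun z => t * vel z :=
  Function.LeftInverse.injective (g := mu t) (mu_mul_vel ht)

theorem hasDerivAt_mul_vel (t z : ℝ) :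
    HasDerivAt (fun z => t * vel z) (t * (jbr z ^ 3)⁻¹) z :=
  (hasDerivAt_vel z).const_mul t

theorem mul_inv_jbr_cube_pos {t : ℝ} (ht : 0 < t) (z : ℝ) : 0 < t * (jbr z ^ 3)⁻¹ :=
  mul_pos ht (inv_jbr_cube_pos z)

theorem ae_mu_of_ae (t : ℝ) {P : ℝ → Prop} (h : ∀ᵐ z, P z) : ∀ᵐ x, |x| < t → P (mu t x) := by
  have h0 : volume ((fun z => t * vel z) '' {z | ¬ P z}) = 0 :=
    addHaar_image_eq_zero_of_differentiableOn_of_addHaar_eq_zero volume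
      (fun z _ => (hasDerivAt_mul_vel t z).differentiableAt.differentiableWithinAt) h
  refine measure_mono_null (fun x hx => ?_) h0
  obtain ⟨hxt, hP⟩ := Classical.not_imp.1 hx
  exact ⟨mu t x, hP, mul_vel_mu hxt⟩

/-- The function of `x` equal to `g (μ(t,x))` inside the light cone and to `0` outside. -/
def coneLift {E : Type*} [Zero E] (t : ℝ) (g : ℝ → E) (x : ℝ) : E :=
  if |x| < t then g (mu t x) else 0

theorem coneLift_of_not_lt {E : Type*} [Zero E] {t x : ℝ} (g : ℝ → E) (hx : ¬ |x| < t) :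
    coneLift t g x = 0 := if_neg hx

theorem coneLift_mul_vel {E : Type*} [Zero E] {t : ℝ} (ht : 0 < t) (g : ℝ → E) (z : ℝ) :
    coneLift t g (t * vel z) = g z := by
  rw [coneLift, if_pos (abs_mul_vel_lt ht z), mu_mul_vel ht]

theorem coneLift_add {E : Type*} [AddZeroClass E] (t : ℝ) (g g' : ℝ → E) :
    coneLift t (fun z => g z + g' z) = fun x => coneLift t g x + coneLift t g' x := by
  funext x
  by_cases h : |x| < t <;> simp [coneLift, h]

theorem measurable_coneLift {E : Type*} [Zero E] [MeasurableSpace E] (t : ℝ) {g : ℝ → E}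
    (hg : Measurable g) : Measurable (coneLift t g) := by
  refine Measurable.ite (measurableSet_lt measurable_norm measurable_const) (hg.comp ?_)
    measurable_const
  unfold mu
  fun_prop

theorem lintegral_eq_of_eq_zero_outside_cone {t : ℝ} (ht : 0 < t) {F : ℝ → ℝ≥0∞}
    (hF : ∀ x, ¬ |x| < t → F x = 0) :
    ∫⁻ x, F x = ∫⁻ z, ENNReal.ofReal (t * (jbr z ^ 3)⁻¹) * F (t * vel z) := by
  have h := lintegral_image_eq_lintegral_abs_deriv_mul MeasurableSet.univ
    (fun z _ => (hasDerivAt_mul_vel t z).hasDerivWithinAt) (injective_mul_vel ht).injOn F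
  rw [image_mul_vel ht, setLIntegral_univ] at h
  rw [← setLIntegral_eq_of_support_subset (s := {x | |x| < t})
    (Function.support_subset_iff'.2 hF), h]
  simp only [abs_of_pos (mul_inv_jbr_cube_pos ht _)]

variable {E : Type*} [NormedAddCommGroup E]

theorem eLpNorm_two_eq_lintegral {α : Type*} [MeasurableSpace α] {ν : Measure α} (g : α → E) :
    eLpNorm g 2 ν = (∫⁻ x, ‖g x‖ₑ ^ 2 ∂ν) ^ (1 / 2 : ℝ) := by
  rw [eLpNorm_eq_lintegral_rpow_enorm_toReal (by norm_num) (by norm_num)]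
  simp

variable [NormedSpace ℝ E]

theorem eLpNorm_two_eq_of_eq_zero_outside_cone {t : ℝ} (ht : 0 < t) {F : ℝ → E}
    (hF : ∀ x, ¬ |x| < t → F x = 0) :
    eLpNorm F 2 volume =
      eLpNorm (fun z => Real.sqrt (t * (jbr z ^ 3)⁻¹) • F (t * vel z)) 2 volume := by
  rw [eLpNorm_two_eq_lintegral, eLpNorm_two_eq_lintegral,
    lintegral_eq_of_eq_zero_outside_cone ht (F := fun x => ‖F x‖ₑ ^ 2) fun x hx => by
      simp [hF x hx]]
  congr 1
  refine lintegral_congr fun z => ?_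
  rw [enorm_smul, mul_pow, Real.enorm_eq_ofReal (Real.sqrt_nonneg _),
    ← ENNReal.ofReal_pow (Real.sqrt_nonneg _), Real.sq_sqrt (mul_inv_jbr_cube_pos ht z).le]

theorem integral_smul_coneLift {t : ℝ} (ht : 0 < t) (φ : ℝ → ℝ) (g : ℝ → E) :
    ∫ x, φ x • coneLift t g x = ∫ z, (t * (jbr z ^ 3)⁻¹) • φ (t * vel z) • g z := by
  have h := integral_image_eq_integral_abs_deriv_smul MeasurableSet.univ
    (fun z _ => (hasDerivAt_mul_vel t z).hasDerivWithinAt) (injective_mul_vel ht).injOn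
    (fun x => φ x • coneLift t g x)
  rw [image_mul_vel ht, setIntegral_univ] at h
  rw [← setIntegral_eq_integral_of_forall_compl_eq_zero (s := {x | |x| < t}) fun x hx => by
    rw [coneLift_of_not_lt g hx, smul_zero], h]
  simp only [coneLift_mul_vel ht, abs_of_pos (mul_inv_jbr_cube_pos ht _)]

theorem integrable_coneLift_iff {t : ℝ} (ht : 0 < t) (g : ℝ → E) :
    Integrable (coneLift t g) volume ↔ Integrable (fun z => (jbr z ^ 3)⁻¹ • g z) volume := by
  have h := integrableOn_image_iff_integrableOn_abs_deriv_smul MeasurableSet.univ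
    (fun z _ => (hasDerivAt_mul_vel t z).hasDerivWithinAt) (injective_mul_vel ht).injOn
    (coneLift t g)
  have hs : (coneLift t g).support ⊆ {x | |x| < t} :=
    Function.support_subset_iff'.2 fun x hx => coneLift_of_not_lt g hx
  rw [image_mul_vel ht, integrableOn_univ, integrableOn_iff_integrable_of_support_subset hs] at h
  simp only [h, coneLift_mul_vel ht, abs_of_pos (mul_inv_jbr_cube_pos ht _), mul_smul]
  exact integrable_fun_smul_iff ht.ne' _

end HyperbolicCoordinates

section Jets

/-- The 2-jet of a function that is differentiable with locally absolutely continuous derivative: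
`f₁` is its derivative, and `f₂` its second derivative, which need only exist almost everywhere. -/
structure Jet where
  f : ℝ → ℂ
  f₁ : ℝ → ℂ
  f₂ : ℝ → ℂ
  hasDerivAt : ∀ z, HasDerivAt f (f₁ z) z
  locAC : LocAC f₁
  ae_hasDerivAt : ∀ᵐ z, HasDerivAt f₁ (f₂ z) z
  measurable : Measurable f₂

theorem hasDerivAt_inv_jbr (z : ℝ) :
    HasDerivAt (fun z => (jbr z)⁻¹) (-(z / jbr z ^ 3)) z := by
  refine ((hasDerivAt_jbr z).fun_inv (jbr_ne_zero z)).congr_deriv ?_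
  have := jbr_ne_zero z
  field_simp

theorem hasDerivAt_neg_div_jbr_cube (z : ℝ) :
    HasDerivAt (fun z => -(z / jbr z ^ 3)) (3 * z ^ 2 / jbr z ^ 5 - (jbr z ^ 3)⁻¹) z := by
  refine ((hasDerivAt_id' z).fun_div ((hasDerivAt_jbr z).fun_pow 3)
    (pow_ne_zero 3 (jbr_ne_zero z))).fun_neg.congr_deriv ?_
  have := jbr_ne_zero z
  field_simp
  ring

theorem continuous_second_deriv_inv_jbr :
    Continuous fun z => 3 * z ^ 2 / jbr z ^ 5 - (jbr z ^ 3)⁻¹ :=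
  (((continuous_pow 2).const_mul 3).div (continuous_jbr.pow 5)
    fun z => pow_ne_zero 5 (jbr_ne_zero z)).sub continuous_inv_jbr_cube

namespace Jet

@[fun_prop]
theorem continuous (J : Jet) : Continuous J.f :=
  continuous_iff_continuousAt.2 fun z => (J.hasDerivAt z).continuousAt

@[fun_prop]
theorem continuous₁ (J : Jet) : Continuous J.f₁ := J.locAC.continuous

theorem locAC₀ (J : Jet) : LocAC J.f := LocAC.of_hasDerivAt J.hasDerivAt J.continuous₁

/-- The jet of a constant. -/
@[simps]
def const (c : ℂ) : Jet where
  f _ := c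
  f₁ _ := 0
  f₂ _ := 0
  hasDerivAt z := hasDerivAt_const z c
  locAC := LocAC.const 0
  ae_hasDerivAt := Eventually.of_forall fun z => hasDerivAt_const z 0
  measurable := measurable_const

/-- The jet of a sum. -/
@[simps]
def add (J L : Jet) : Jet where
  f z := J.f z + L.f z
  f₁ z := J.f₁ z + L.f₁ z
  f₂ z := J.f₂ z + L.f₂ z
  hasDerivAt z := (J.hasDerivAt z).fun_add (L.hasDerivAt z)
  locAC := J.locAC.add L.locAC
  ae_hasDerivAt := by
    filter_upwards [J.ae_hasDerivAt, L.ae_hasDerivAt] with z h h' using h.fun_add h'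
  measurable := J.measurable.add L.measurable

/-- The jet of a product. -/
@[simps]
def mul (J L : Jet) : Jet where
  f z := J.f z * L.f z
  f₁ z := J.f₁ z * L.f z + J.f z * L.f₁ z
  f₂ z := J.f₂ z * L.f z + 2 * (J.f₁ z * L.f₁ z) + J.f z * L.f₂ z
  hasDerivAt z := (J.hasDerivAt z).fun_mul (L.hasDerivAt z)
  locAC := (J.locAC.mul L.locAC₀).add (J.locAC₀.mul L.locAC)
  ae_hasDerivAt := by
    filter_upwards [J.ae_hasDerivAt, L.ae_hasDerivAt] with z h h'
    exact ((h.fun_mul (L.hasDerivAt z)).fun_add ((J.hasDerivAt z).fun_mul h')).congr_deriv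
      (by ring)
  measurable := by
    have := J.measurable
    have := L.measurable
    have := J.continuous.measurable
    have := L.continuous.measurable
    have := J.continuous₁.measurable
    have := L.continuous₁.measurable
    fun_prop

/-- The jet of the complex conjugate. -/
@[simps]
def conj (J : Jet) : Jet where
  f z := (starRingEnd ℂ) (J.f z)
  f₁ z := (starRingEnd ℂ) (J.f₁ z)
  f₂ z := (starRingEnd ℂ) (J.f₂ z)
  hasDerivAt z := (J.hasDerivAt z).star
  locAC := J.locAC.conj
  ae_hasDerivAt := J.ae_hasDerivAt.mono fun _ h => h.star
  measurable := Complex.continuous_conj.measurable.comp J.measurable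

/-- The jet of a constant multiple. -/
@[simps]
def smul (c : ℂ) (J : Jet) : Jet where
  f z := c * J.f z
  f₁ z := c * J.f₁ z
  f₂ z := c * J.f₂ z
  hasDerivAt z := (J.hasDerivAt z).const_mul c
  locAC := (LocAC.const c).mul J.locAC
  ae_hasDerivAt := J.ae_hasDerivAt.mono fun _ h => h.const_mul c
  measurable := J.measurable.const_mul c

/-- The jet of `e^f`. -/
@[simps]
def cexp (J : Jet) : Jet where
  f z := Complex.exp (J.f z)
  f₁ z := Complex.exp (J.f z) * J.f₁ z
  f₂ z := Complex.exp (J.f z) * (J.f₂ z + J.f₁ z ^ 2)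
  hasDerivAt z := (J.hasDerivAt z).cexp
  locAC := (LocAC.of_hasDerivAt (fun z => (J.hasDerivAt z).cexp) (by fun_prop)).mul J.locAC
  ae_hasDerivAt := by
    filter_upwards [J.ae_hasDerivAt] with z h
    exact ((J.hasDerivAt z).cexp.fun_mul h).congr_deriv (by ring)
  measurable := by
    have := J.measurable
    have := J.continuous.measurable
    have := J.continuous₁.measurable
    fun_prop

/-- The jet of `⟨z⟩⁻¹`. -/
@[simps]
def invJbr : Jet where
  f z := ((jbr z)⁻¹ : ℝ)
  f₁ z := (-(z / jbr z ^ 3) : ℝ)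
  f₂ z := (3 * z ^ 2 / jbr z ^ 5 - (jbr z ^ 3)⁻¹ : ℝ)
  hasDerivAt z := (hasDerivAt_inv_jbr z).ofReal_comp
  locAC := LocAC.of_hasDerivAt (fun z => (hasDerivAt_neg_div_jbr_cube z).ofReal_comp)
    (Complex.continuous_ofReal.comp continuous_second_deriv_inv_jbr)
  ae_hasDerivAt := Eventually.of_forall fun z => (hasDerivAt_neg_div_jbr_cube z).ofReal_comp
  measurable := by
    have := continuous_jbr.measurable
    fun_prop

end Jet

theorem isWeakDeriv_weakDeriv {j : ℕ} {f : ℝ → ℂ} (h : ∃ g, IsWeakDeriv j f g) :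
    IsWeakDeriv j f (weakDeriv j f) := by
  rw [weakDeriv, dif_pos h]
  exact h.choose_spec

namespace IsWeakDeriv

variable {j : ℕ} {f g h : ℝ → ℂ}

theorem ae_eq (hf : LocallyIntegrable f volume) (hg : IsWeakDeriv 0 f g) : f =ᵐ[volume] g :=
  ae_eq_of_integral_contDiff_smul_eq hf hg.1 fun φ hφ hφc => by simpa using hg.2 φ hφ hφc

theorem one_of_succ (hg : IsWeakDeriv j f g) (hh : IsWeakDeriv (j + 1) f h) :
    IsWeakDeriv 1 g h := by
  refine ⟨hh.1, fun φ hφ hφc => ?_⟩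
  have hφ' : ContDiff ℝ ∞ (deriv φ) := (contDiff_infty_iff_deriv.1 hφ).2
  have e : ∫ x, deriv φ x • g x = (-1) ^ j * ∫ x, iteratedDeriv (j + 1) φ x • f x := by
    rw [iteratedDeriv_succ', hg.2 _ hφ' hφc.deriv, ← mul_assoc, ← mul_pow]
    simp
  rw [iteratedDeriv_one, e, hh.2 φ hφ hφc, ← mul_assoc, pow_succ, ← mul_assoc, ← mul_pow]
  simp

theorem exists_ae_eq_const_add_integral (hf : LocallyIntegrable f volume)
    (hg : IsWeakDeriv 1 f g) : ∃ c, f =ᵐ[volume] fun x => c + ∫ v in (0 : ℝ)..x, g v :=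
  exists_ae_eq_const_add_integral_of_weakDeriv hf hg.1 fun φ hφ hφc => by
    simpa [iteratedDeriv_one] using hg.2 φ hφ hφc

end IsWeakDeriv

theorem Jet.exists_of_locallyIntegrable {g : ℝ → ℂ} (hg : LocallyIntegrable g volume) (c c₁ : ℂ) :
    ∃ J : Jet, (∀ x, J.f x = c + ∫ v in (0 : ℝ)..x, J.f₁ v) ∧
      (∀ x, J.f₁ x = c₁ + ∫ v in (0 : ℝ)..x, g v) ∧ J.f₂ =ᵐ[volume] g := by
  have hm := hg.aestronglyMeasurable
  have ac : LocAC fun x => c₁ + ∫ v in (0 : ℝ)..x, g v :=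
    (LocAC.const c₁).add (LocAC.intervalIntegral hg 0)
  refine ⟨⟨fun x => c + ∫ v in (0 : ℝ)..x, (c₁ + ∫ w in (0 : ℝ)..v, g w),
    fun x => c₁ + ∫ v in (0 : ℝ)..x, g v, hm.mk _, fun z => ?_, ac, ?_,
    hm.stronglyMeasurable_mk.measurable⟩, fun x => rfl, fun x => rfl, hm.ae_eq_mk.symm⟩
  · exact (intervalIntegral.integral_hasDerivAt_right (ac.continuous.intervalIntegrable _ _)
      (ac.continuous.stronglyMeasurableAtFilter _ _) ac.continuous.continuousAt).const_add _
  · filter_upwards [_root_.LocallyIntegrable.ae_hasDerivAt_integral hg, hm.ae_eq_mk] with x hx hx'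
    rw [← hx']
    exact (hx 0).const_add _

theorem MemWSobolev.exists_jet {s : ℝ} {A : ℝ → ℂ} (hA : MemWSobolev 2 s A) :
    ∃ J : Jet, J.f =ᵐ[volume] A ∧ J.f =ᵐ[volume] weakDeriv 0 A ∧
      J.f₁ =ᵐ[volume] weakDeriv 1 A ∧ J.f₂ =ᵐ[volume] weakDeriv 2 A := by
  have hAl : LocallyIntegrable A volume := hA.1.locallyIntegrable (by norm_num)
  have w0 := isWeakDeriv_weakDeriv (hA.2 0 (by norm_num)).1
  have w1 := isWeakDeriv_weakDeriv (hA.2 1 (by norm_num)).1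
  have w2 := isWeakDeriv_weakDeriv (hA.2 2 (by norm_num)).1
  have e0 := w0.ae_eq hAl
  obtain ⟨c, hc⟩ := (w0.one_of_succ w1).exists_ae_eq_const_add_integral w0.1
  obtain ⟨c₁, hc₁⟩ := (w1.one_of_succ w2).exists_ae_eq_const_add_integral w1.1
  obtain ⟨J, h0, h1, h2⟩ := Jet.exists_of_locallyIntegrable w2.1 c c₁
  have e1 : J.f₁ =ᵐ[volume] weakDeriv 1 A := hc₁.mono fun x hx => (h1 x).trans hx.symm
  have e : J.f =ᵐ[volume] weakDeriv 0 A := hc.mono fun x hx => by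
    rw [h0, hx, intervalIntegral.integral_congr_ae (e1.mono fun x hx _ => hx)]
  exact ⟨J, e.trans e0.symm, e, e1, h2⟩

end Jets

section BoxPlusOne

theorem IsBoxPlusOne.add {T : ℝ} {u u' G G' : ℝ → ℝ → ℂ} (h : IsBoxPlusOne T u G)
    (h' : IsBoxPlusOne T u' G') :
    IsBoxPlusOne T (fun t x => u t x + u' t x) (fun t x => G t x + G' t x) := by
  refine ⟨fun t ht => ⟨(h.1 t ht).1.add (h'.1 t ht).1, (h.1 t ht).2.add (h'.1 t ht).2⟩,
    fun φ hφ hc => ?_⟩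
  obtain ⟨p, hp⟩ := h.2 φ hφ hc
  obtain ⟨p', hp'⟩ := h'.2 φ hφ hc
  have hφ'' : Continuous (iteratedDeriv 2 φ) :=
    hφ.continuous_iteratedDeriv 2 (WithTop.coe_le_coe.2 le_top)
  have hc'' : HasCompactSupport (iteratedDeriv 2 φ) := by
    rw [iteratedDeriv_succ, iteratedDeriv_one]
    exact hc.deriv.deriv
  have hs : ∀ {ψ : ℝ → ℝ} {v w : ℝ → ℂ}, Continuous ψ → HasCompactSupport ψ →
      LocallyIntegrable v volume → LocallyIntegrable w volume →
      ∫ x, ψ x • (v x + w x) = (∫ x, ψ x • v x) + ∫ x, ψ x • w x := by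
    intro ψ v w h1 h2 h3 h4
    simp only [smul_add]
    exact integral_add (h3.integrable_smul_left_of_hasCompactSupport h1 h2)
      (h4.integrable_smul_left_of_hasCompactSupport h1 h2)
  refine ⟨fun t => p t + p' t, fun t ht => ⟨?_, ?_⟩⟩
  · refine ((hp t ht).1.fun_add (hp' t ht).1).congr_of_eventuallyEq ?_
    filter_upwards [lt_mem_nhds ht] with s hts
    exact hs hφ.continuous hc (h.1 s hts).1 (h'.1 s hts).1
  · refine ((hp t ht).2.fun_add (hp' t ht).2).congr_deriv ?_
    rw [hs hφ'' hc'' (h.1 t ht).1 (h'.1 t ht).1, hs hφ.continuous hc (h.1 t ht).1 (h'.1 t ht).1,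
      hs hφ.continuous hc (h.1 t ht).2 (h'.1 t ht).2]
    ring

theorem IsBoxPlusOne.congr {T : ℝ} {u u' G : ℝ → ℝ → ℂ} (h : IsBoxPlusOne T u G)
    (hu : ∀ t, T < t → u t =ᵐ[volume] u' t) : IsBoxPlusOne T u' G := by
  refine ⟨fun t ht => ⟨(locallyIntegrable_congr (hu t ht)).1 (h.1 t ht).1, (h.1 t ht).2⟩,
    fun φ hφ hc => ?_⟩
  obtain ⟨p, hp⟩ := h.2 φ hφ hc
  have hs : ∀ (ψ : ℝ → ℝ) t, T < t → ∫ x, ψ x • u' t x = ∫ x, ψ x • u t x := fun ψ t ht =>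
    integral_congr_ae ((hu t ht).mono fun x hx => by simp only [hx])
  refine ⟨p, fun t ht => ⟨?_, ?_⟩⟩
  · refine (hp t ht).1.congr_of_eventuallyEq ?_
    filter_upwards [lt_mem_nhds ht] with s hts using hs φ s hts
  · rw [hs _ t ht, hs _ t ht]
    exact (hp t ht).2

theorem hasDerivAt_integral_of_locally_dominated {F F' : ℝ → ℝ → ℂ} {w : ℝ → ℝ}
    (hw : Integrable w volume) (hF : ∀ s, 0 < s → Continuous (F s))
    (hF' : ∀ s, 0 < s → Continuous (F' s))
    (hd : ∀ s, 0 < s → ∀ z, HasDerivAt (fun s => F s z) (F' s z) s)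
    (hb : ∀ t, 0 < t → ∃ C, ∀ s ∈ Set.Ioo (t / 2) (2 * t), ∀ z, ‖F s z‖ ≤ C * w z)
    (hb' : ∀ t, 0 < t → ∃ C, ∀ s ∈ Set.Ioo (t / 2) (2 * t), ∀ z, ‖F' s z‖ ≤ C * w z)
    {t : ℝ} (ht : 0 < t) :
    Integrable (F' t) volume ∧ HasDerivAt (fun s => ∫ z, F s z) (∫ z, F' t z) t := by
  have hn : Set.Ioo (t / 2) (2 * t) ∈ nhds t := Ioo_mem_nhds (by linarith) (by linarith)
  have hpos : ∀ s ∈ Set.Ioo (t / 2) (2 * t), 0 < s := fun s hs => by linarith [hs.1]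
  obtain ⟨C, hC⟩ := hb t ht
  obtain ⟨C', hC'⟩ := hb' t ht
  refine hasDerivAt_integral_of_dominated_loc_of_deriv_le hn ?_ ?_
    (hF' t ht).aestronglyMeasurable
    (Eventually.of_forall fun z s hs => hC' s hs z) (hw.const_mul C')
    (Eventually.of_forall fun z s hs => hd s (hpos s hs) z)
  · filter_upwards [hn] with s hs using (hF s (hpos s hs)).aestronglyMeasurable
  · exact (hw.const_mul C).mono' (hF t ht).aestronglyMeasurable
      (Eventually.of_forall fun z => hC t (mem_of_mem_nhds hn) z)

/-- `V t` is a curve of jets with `t`-derivatives `V₁`, `V₂` for `t > 0`, all locally uniformly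
bounded in `t`, with enough decay at each time for integrations by parts in `z` to leave no
boundary terms. The corresponding function of `(t, x)` is `t⁻¹ V(t, μ)` inside the light cone. -/
structure IsConeAmplitude (V V₁ : ℝ → Jet) (V₂ : ℝ → ℝ → ℂ) : Prop where
  hasDerivAt : ∀ t, 0 < t → ∀ z, HasDerivAt (fun s => (V s).f z) ((V₁ t).f z) t
  hasDerivAt₁ : ∀ t, 0 < t → ∀ z, HasDerivAt (fun s => (V₁ s).f z) (V₂ t z) t
  continuous₂ : ∀ t, 0 < t → Continuous (V₂ t)
  bounded : ∀ t, 0 < t → ∃ C, ∀ s ∈ Set.Ioo (t / 2) (2 * t), ∀ z,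
    ‖(V s).f z‖ ≤ C ∧ ‖(V₁ s).f z‖ ≤ C ∧ ‖V₂ s z‖ ≤ C
  tendsto : ∀ t, 0 < t → Tendsto (V t).f (cocompact ℝ) (nhds 0)
  tendsto₁ : ∀ t, 0 < t → Tendsto (V₁ t).f (cocompact ℝ) (nhds 0)
  tendsto_space : ∀ t, 0 < t → Tendsto (fun z => jbr z * (V t).f₁ z) (cocompact ℝ) (nhds 0)

/-- The function `(□ + 1)(t⁻¹ V(t, μ))` in the coordinates `(t, z)`, `z = μ`. -/
def boxPlusOne (V V₁ : ℝ → Jet) (V₂ : ℝ → ℝ → ℂ) (t z : ℝ) : ℂ :=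
  (V₂ t z + (V t).f z) / t - (2 * (V₁ t).f z + 2 * z * jbr z ^ 2 * (V₁ t).f₁ z) / t ^ 2
    - (jbr z ^ 4 * (V t).f₂ z - z * jbr z ^ 2 * (V t).f₁ z - 2 * (V t).f z) / t ^ 3

/-- The test function `φ` pulled back to the coordinates `(t, z)`, times the Jacobian
`dx/dz = t ⟨z⟩⁻³` divided by `t`. -/
def pullback (φ : ℝ → ℝ) (t z : ℝ) : ℝ := (jbr z ^ 3)⁻¹ * φ (t * vel z)

variable {φ φ₁ φ₂ : ℝ → ℝ}

theorem hasDerivAt_pullback (h : ∀ x, HasDerivAt φ (φ₁ x) x) (t z : ℝ) :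
    HasDerivAt (fun s => pullback φ s z) (vel z * pullback φ₁ t z) t := by
  have h1 : HasDerivAt (fun s : ℝ => s * vel z) (vel z) t := by
    simpa using (hasDerivAt_id' t).mul_const (vel z)
  refine (((h _).comp t h1).const_mul (jbr z ^ 3)⁻¹).congr_deriv ?_
  rw [pullback]
  ring

theorem continuous_pullback (h : Continuous φ) (t : ℝ) : Continuous (pullback φ t) :=
  continuous_inv_jbr_cube.mul (h.comp (by fun_prop))

theorem norm_pullback_le {C : ℝ} (h : ∀ x, |φ x| ≤ C) (t z : ℝ) :
    ‖pullback φ t z‖ ≤ C * (jbr z ^ 3)⁻¹ := by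
  rw [pullback, norm_mul, Real.norm_of_nonneg (inv_jbr_cube_pos z).le, mul_comm]
  exact mul_le_mul_of_nonneg_right (h _) (inv_jbr_cube_pos z).le

theorem integrable_pullback_smul (hc : Continuous φ) {C D : ℝ} (hC : ∀ x, |φ x| ≤ C) (t : ℝ)
    {g : ℝ → ℂ} (hg : Continuous g) (hD : ∀ z, ‖g z‖ ≤ D) :
    Integrable (fun z => pullback φ t z • g z) volume :=
  ((integrable_inv_jbr_cube.const_mul C).mono' (continuous_pullback hc t).aestronglyMeasurable
    (Eventually.of_forall fun z => norm_pullback_le hC t z)).smul_bdd D hg.aestronglyMeasurable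
    (Eventually.of_forall hD)

theorem integral_smul_coneLift_eq_pullback (φ : ℝ → ℝ) {t : ℝ} (ht : 0 < t) (g : ℝ → ℂ) :
    ∫ x, φ x • coneLift t g x = ∫ z, pullback φ t z • (t * g z) := by
  rw [integral_smul_coneLift ht]
  refine integral_congr_ae (Eventually.of_forall fun z => ?_)
  simp only [pullback, Complex.real_smul]
  push_cast
  ring

/-- The integrand of the first `t`-derivative of the pairing with `φ`, where `φ₁ = φ'`. -/
def pairing₁ (V V₁ : ℝ → Jet) (φ φ₁ : ℝ → ℝ) (t z : ℝ) : ℂ :=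
  (vel z * pullback φ₁ t z) • (V t).f z + pullback φ t z • (V₁ t).f z

/-- The integrand of the second `t`-derivative of the pairing with `φ`, where `φ₁ = φ'` and
`φ₂ = φ''`. -/
def pairing₂ (V V₁ : ℝ → Jet) (V₂ : ℝ → ℝ → ℂ) (φ φ₁ φ₂ : ℝ → ℝ) (t z : ℝ) : ℂ :=
  (vel z ^ 2 * pullback φ₂ t z) • (V t).f z + (2 * (vel z * pullback φ₁ t z)) • (V₁ t).f z
    + pullback φ t z • V₂ t z

theorem norm_mul_pullback_smul_le {C D t z c : ℝ} (hφ : ∀ x, |φ x| ≤ C) (hc : |c| ≤ 1)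
    {x : ℂ} (hx : ‖x‖ ≤ D) : ‖(c * pullback φ t z) • x‖ ≤ C * D * (jbr z ^ 3)⁻¹ := by
  have hp := norm_pullback_le hφ t z
  rw [norm_smul, norm_mul, Real.norm_eq_abs]
  calc |c| * ‖pullback φ t z‖ * ‖x‖ ≤ 1 * (C * (jbr z ^ 3)⁻¹) * D := by
        have := (norm_nonneg _).trans hp
        gcongr
    _ = C * D * (jbr z ^ 3)⁻¹ := by ring

/-- The `z`-flux absorbing the integrations by parts against the test function `φ`, with
`φ₁ = φ'`. -/
def flux (V V₁ : ℝ → Jet) (φ φ₁ : ℝ → ℝ) (t z : ℝ) : ℂ :=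
  φ (t * vel z) * ((t : ℂ)⁻¹ * (2 * vel z * (V₁ t).f z)
      + ((t : ℂ) ^ 2)⁻¹ * (jbr z * (V t).f₁ z - 2 * vel z * (V t).f z))
    - φ₁ (t * vel z) * ((t : ℂ)⁻¹ * (((jbr z)⁻¹ : ℝ) * ((jbr z)⁻¹ : ℝ) * (V t).f z))

theorem hasDerivAt_comp_mul_vel (h : ∀ x, HasDerivAt φ (φ₁ x) x) (t z : ℝ) :
    HasDerivAt (fun z => (φ (t * vel z) : ℂ)) ((φ₁ (t * vel z) * (t * (jbr z ^ 3)⁻¹) : ℝ) : ℂ) z :=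
  ((h _).comp z (hasDerivAt_mul_vel t z)).ofReal_comp

theorem locAC_comp_mul_vel (h : ∀ x, HasDerivAt φ (φ₁ x) x) (hc : Continuous φ₁) (t : ℝ) :
    LocAC fun z => (φ (t * vel z) : ℂ) := by
  have := continuous_inv_jbr_cube
  exact LocAC.of_hasDerivAt (hasDerivAt_comp_mul_vel h t) (by fun_prop)

theorem locAC_ofReal_vel : LocAC fun z => (vel z : ℂ) :=
  LocAC.of_hasDerivAt (fun z => (hasDerivAt_vel z).ofReal_comp)
    (Complex.continuous_ofReal.comp continuous_inv_jbr_cube)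

theorem locAC_ofReal_jbr : LocAC fun z => (jbr z : ℂ) :=
  LocAC.of_hasDerivAt (fun z => (hasDerivAt_jbr z).ofReal_comp)
    (Complex.continuous_ofReal.comp continuous_vel)

theorem locAC_flux (V V₁ : ℝ → Jet) (h : ∀ x, HasDerivAt φ (φ₁ x) x)
    (h₁ : ∀ x, HasDerivAt φ₁ (φ₂ x) x) (hc : Continuous φ₂) (t : ℝ) : LocAC (flux V V₁ φ φ₁ t) :=
  have hc₁ : Continuous φ₁ := continuous_iff_continuousAt.2 fun x => (h₁ x).continuousAt
  have locAC_two_vel := (LocAC.const 2).mul locAC_ofReal_vel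
  ((locAC_comp_mul_vel h hc₁ t).mul (((LocAC.const _).mul (locAC_two_vel.mul (V₁ t).locAC₀)).add
    ((LocAC.const _).mul ((locAC_ofReal_jbr.mul (V t).locAC).sub
      (locAC_two_vel.mul (V t).locAC₀))))).sub
    ((locAC_comp_mul_vel h₁ hc t).mul ((LocAC.const _).mul
      ((Jet.invJbr.locAC₀.mul Jet.invJbr.locAC₀).mul (V t).locAC₀)))

theorem hasDerivAt_flux (V V₁ : ℝ → Jet) (V₂ : ℝ → ℝ → ℂ) (h : ∀ x, HasDerivAt φ (φ₁ x) x)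
    (h₁ : ∀ x, HasDerivAt φ₁ (φ₂ x) x) {t : ℝ} (ht : 0 < t) {z : ℝ}
    (hV : HasDerivAt (V t).f₁ ((V t).f₂ z) z) :
    HasDerivAt (flux V V₁ φ φ₁ t)
      (pairing₂ V V₁ V₂ φ φ₁ φ₂ t z - pullback φ₂ t z • (V t).f z + pullback φ t z • (V t).f z
        - pullback φ t z • (t * boxPlusOne V V₁ V₂ t z)) z := by
  have hj := ofReal_jbr_ne_zero z
  have ht' : (t : ℂ) ≠ 0 := by exact_mod_cast ht.ne'
  have hvel := (hasDerivAt_vel z).ofReal_comp.const_mul (2 : ℂ)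
  have hY := ((hvel.fun_mul ((V₁ t).hasDerivAt z)).const_mul (t : ℂ)⁻¹).fun_add
    ((((hasDerivAt_jbr z).ofReal_comp.fun_mul hV).fun_sub
      (hvel.fun_mul ((V t).hasDerivAt z))).const_mul ((t : ℂ) ^ 2)⁻¹)
  have hX := (((Jet.invJbr.hasDerivAt z).fun_mul (Jet.invJbr.hasDerivAt z)).fun_mul
    ((V t).hasDerivAt z)).const_mul (t : ℂ)⁻¹
  refine (((hasDerivAt_comp_mul_vel h t z).fun_mul hY).fun_sub
    ((hasDerivAt_comp_mul_vel h₁ t z).fun_mul hX)).congr_deriv ?_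
  have hv : (vel z : ℂ) = z / jbr z := by simp [vel]
  have hz : (z : ℂ) ^ 2 = jbr z ^ 2 - 1 := by
    rw [eq_sub_iff_add_eq, add_comm]
    exact_mod_cast (jbr_sq z).symm
  simp only [pairing₂, pullback, boxPlusOne, Complex.real_smul, Jet.invJbr_f, Jet.invJbr_f₁]
  push_cast
  rw [hv]
  field_simp
  ring_nf
  simp only [hz]
  ring

theorem continuous_pairing₁ (V V₁ : ℝ → Jet) (hφ : Continuous φ) (hφ₁ : Continuous φ₁)
    (t : ℝ) :
    Continuous (pairing₁ V V₁ φ φ₁ t) := by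
  have := continuous_pullback hφ t
  have := continuous_pullback hφ₁ t
  unfold pairing₁
  fun_prop

theorem integral_smul_coneLift_div (V : ℝ → Jet) (φ : ℝ → ℝ) {t : ℝ} (ht : 0 < t) :
    ∫ x, φ x • coneLift t (fun z => (V t).f z / t) x = ∫ z, pullback φ t z • (V t).f z := by
  have ht' : (t : ℂ) ≠ 0 := by exact_mod_cast ht.ne'
  simp only [integral_smul_coneLift_eq_pullback φ ht, mul_div_cancel₀ _ ht']

theorem exists_test_function_bounds (hφ : ContDiff ℝ ∞ φ) (hc : HasCompactSupport φ) :
    ∃ C, ∀ x, |φ x| ≤ C ∧ |deriv φ x| ≤ C ∧ |deriv (deriv φ) x| ≤ C := by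
  have hφ' : ContDiff ℝ ∞ (deriv φ) := (contDiff_infty_iff_deriv.1 hφ).2
  obtain ⟨C₀, h₀⟩ := hφ.continuous.bounded_above_of_compact_support hc
  obtain ⟨C₁, h₁⟩ := hφ'.continuous.bounded_above_of_compact_support hc.deriv
  obtain ⟨C₂, h₂⟩ :=
    (contDiff_infty_iff_deriv.1 hφ').2.continuous.bounded_above_of_compact_support hc.deriv.deriv
  exact ⟨max C₀ (max C₁ C₂), fun x => ⟨(h₀ x).trans (by simp), (h₁ x).trans (by simp),
    (h₂ x).trans (by simp)⟩⟩

theorem tendsto_mul_zero_of_norm_le {α : Type*} {l : Filter α} {f g : α → ℂ} {C : ℝ}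
    (hf : ∀ x, ‖f x‖ ≤ C) (hg : Tendsto g l (nhds 0)) : Tendsto (fun x => f x * g x) l (nhds 0) :=
  isBoundedUnder_le_mul_tendsto_zero (isBoundedUnder_of ⟨C, hf⟩) hg

namespace IsConeAmplitude

variable {V V₁ : ℝ → Jet} {V₂ : ℝ → ℝ → ℂ} {C t : ℝ} (hV : IsConeAmplitude V V₁ V₂)
include hV

theorem tendsto_flux (hC : ∀ x, |φ x| ≤ C) (hC₁ : ∀ x, |φ₁ x| ≤ C) (ht : 0 < t) :
    Tendsto (flux V V₁ φ φ₁ t) (cocompact ℝ) (nhds 0) := by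
  have hvel : ∀ z, ‖(2 * vel z : ℂ)‖ ≤ 2 := fun z => by simpa using (abs_vel_lt_one z).le
  have hinv : ∀ z, ‖((jbr z)⁻¹ : ℝ) * (((jbr z)⁻¹ : ℝ) : ℂ)‖ ≤ 1 := fun z => by
    rw [norm_mul, Complex.norm_real, Real.norm_of_nonneg (inv_nonneg.2 (jbr_pos z).le)]
    exact mul_le_one₀ (inv_le_one_of_one_le₀ (one_le_jbr z)) (inv_nonneg.2 (jbr_pos z).le)
      (inv_le_one_of_one_le₀ (one_le_jbr z))
  have hY := ((tendsto_mul_zero_of_norm_le hvel (hV.tendsto₁ t ht)).const_mul (t : ℂ)⁻¹).add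
    (((hV.tendsto_space t ht).sub
      (tendsto_mul_zero_of_norm_le hvel (hV.tendsto t ht))).const_mul ((t : ℂ) ^ 2)⁻¹)
  have hX := (tendsto_mul_zero_of_norm_le hinv (hV.tendsto t ht)).const_mul (t : ℂ)⁻¹
  simp only [mul_zero, sub_zero, add_zero] at hY hX
  have h := (tendsto_mul_zero_of_norm_le (f := fun z => (φ (t * vel z) : ℂ))
    (fun z => (Complex.norm_real _).trans_le (hC _)) hY).sub
    (tendsto_mul_zero_of_norm_le (f := fun z => (φ₁ (t * vel z) : ℂ))
      (fun z => (Complex.norm_real _).trans_le (hC₁ _)) hX)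
  rwa [sub_zero] at h

theorem integrable_pullback (hφ : Continuous φ) (hC : ∀ x, |φ x| ≤ C) (ht : 0 < t) :
    Integrable (fun z => pullback φ t z • (V t).f z) volume := by
  obtain ⟨D, hD⟩ := hV.bounded t ht
  exact integrable_pullback_smul hφ hC t (V t).continuous fun z =>
    (hD t ⟨by linarith, by linarith⟩ z).1

theorem hasDerivAt_pairing (hφ : ∀ x, HasDerivAt φ (φ₁ x) x) (ht : 0 < t) (z : ℝ) :
    HasDerivAt (fun s => pullback φ s z • (V s).f z) (pairing₁ V V₁ φ φ₁ t z) t := by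
  refine ((hasDerivAt_pullback hφ t z).fun_smul (hV.hasDerivAt t ht z)).congr_deriv ?_
  rw [pairing₁, add_comm]

theorem hasDerivAt_pairing₁ (hφ : ∀ x, HasDerivAt φ (φ₁ x) x)
    (hφ₁ : ∀ x, HasDerivAt φ₁ (φ₂ x) x) (ht : 0 < t) (z : ℝ) :
    HasDerivAt (fun s => pairing₁ V V₁ φ φ₁ s z) (pairing₂ V V₁ V₂ φ φ₁ φ₂ t z) t := by
  refine ((((hasDerivAt_pullback hφ₁ t z).const_mul (vel z)).fun_smul
    (hV.hasDerivAt t ht z)).fun_add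
    ((hasDerivAt_pullback hφ t z).fun_smul (hV.hasDerivAt₁ t ht z))).congr_deriv ?_
  simp only [pairing₂, Complex.real_smul]
  push_cast
  ring

theorem exists_pairing_le (hC : ∀ x, |φ x| ≤ C ∧ |φ₁ x| ≤ C ∧ |φ₂ x| ≤ C) (ht : 0 < t) :
    ∃ K, ∀ s ∈ Set.Ioo (t / 2) (2 * t), ∀ z,
      ‖pullback φ s z • (V s).f z‖ ≤ K * (jbr z ^ 3)⁻¹ ∧
      ‖pairing₁ V V₁ φ φ₁ s z‖ ≤ K * (jbr z ^ 3)⁻¹ ∧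
      ‖pairing₂ V V₁ V₂ φ φ₁ φ₂ s z‖ ≤ K * (jbr z ^ 3)⁻¹ := by
  obtain ⟨D, hD⟩ := hV.bounded t ht
  refine ⟨4 * (C * D), fun s hs z => ?_⟩
  obtain ⟨h₀, h₁, h₂⟩ := hD s hs z
  have hv : |vel z| ≤ 1 := (abs_vel_lt_one z).le
  have a₀ := norm_mul_pullback_smul_le (t := s) (z := z) (fun x => (hC x).1) abs_one.le h₀
  have a₁ := norm_mul_pullback_smul_le (t := s) (z := z) (fun x => (hC x).1) abs_one.le h₁
  have a₂ := norm_mul_pullback_smul_le (t := s) (z := z) (fun x => (hC x).1) abs_one.le h₂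
  have b₀ := norm_mul_pullback_smul_le (t := s) (z := z) (fun x => (hC x).2.1) hv h₀
  have b₁ := norm_mul_pullback_smul_le (t := s) (z := z) (fun x => (hC x).2.1) hv h₁
  have c₀ := norm_mul_pullback_smul_le (t := s) (z := z) (fun x => (hC x).2.2)
    (c := vel z ^ 2) (by rw [abs_pow]; exact pow_le_one₀ (abs_nonneg _) hv) h₀
  rw [one_mul] at a₀ a₁ a₂
  have := (norm_nonneg _).trans a₀
  refine ⟨by linarith, (norm_add_le _ _).trans (by linarith), (norm_add₃_le).trans ?_⟩
  rw [mul_smul (2 : ℝ), norm_smul (2 : ℝ), Real.norm_two]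
  linarith

theorem continuous_pairing₂ (hφ : Continuous φ) (hφ₁ : Continuous φ₁) (hφ₂ : Continuous φ₂)
    (ht : 0 < t) : Continuous (pairing₂ V V₁ V₂ φ φ₁ φ₂ t) := by
  have := continuous_pullback hφ t
  have := continuous_pullback hφ₁ t
  have := continuous_pullback hφ₂ t
  have := hV.continuous₂ t ht
  unfold pairing₂
  fun_prop

theorem integral_pairing₂ (hφ : ∀ x, HasDerivAt φ (φ₁ x) x) (hφ₁ : ∀ x, HasDerivAt φ₁ (φ₂ x) x)
    (hφ₂ : Continuous φ₂) (hC : ∀ x, |φ x| ≤ C ∧ |φ₁ x| ≤ C ∧ |φ₂ x| ≤ C) (ht : 0 < t)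
    (hp : Integrable (pairing₂ V V₁ V₂ φ φ₁ φ₂ t) volume)
    (hG : Integrable (fun z => (jbr z ^ 3)⁻¹ • boxPlusOne V V₁ V₂ t z) volume) :
    ∫ z, pairing₂ V V₁ V₂ φ φ₁ φ₂ t z = (∫ z, pullback φ₂ t z • (V t).f z)
      - (∫ z, pullback φ t z • (V t).f z)
      + ∫ z, pullback φ t z • (t * boxPlusOne V V₁ V₂ t z) := by
  have hc : Continuous φ := continuous_iff_continuousAt.2 fun x => (hφ x).continuousAt
  have i₀ := hV.integrable_pullback hc (fun x => (hC x).1) ht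
  have i₂ := hV.integrable_pullback hφ₂ (fun x => (hC x).2.2) ht
  have iG : Integrable (fun z => pullback φ t z • (t * boxPlusOne V V₁ V₂ t z)) volume := by
    refine ((hG.bdd_smul C (hc.comp (f := fun z => t * vel z) (by fun_prop)).aestronglyMeasurable
      (Eventually.of_forall fun z => (hC _).1)).const_mul (t : ℂ)).congr
      (Eventually.of_forall fun z => ?_)
    simp only [pullback, Complex.real_smul, Pi.smul_apply', Function.comp_apply]
    push_cast
    ring
  have i₁ : Integrable (fun z => pairing₂ V V₁ V₂ φ φ₁ φ₂ t z - pullback φ₂ t z • (V t).f z)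
    volume := hp.sub i₂
  have i : Integrable (fun z => pairing₂ V V₁ V₂ φ φ₁ φ₂ t z - pullback φ₂ t z • (V t).f z
    + pullback φ t z • (V t).f z) volume := i₁.add i₀
  have h := (locAC_flux V V₁ hφ hφ₁ hφ₂ t).integral_deriv_eq_zero
    ((V t).ae_hasDerivAt.mono fun z hz => hasDerivAt_flux V V₁ V₂ hφ hφ₁ ht hz)
    (i.sub iG) (hV.tendsto_flux (fun x => (hC x).1) (fun x => (hC x).2.1) ht)
  rw [integral_sub i iG, integral_add i₁ i₀, integral_sub hp i₂] at h
  linear_combination h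

theorem integrable_coneLift_div (ht : 0 < t) :
    Integrable (coneLift t fun z => (V t).f z / t) volume := by
  have h := hV.integrable_pullback (φ := fun _ => 1) continuous_const (C := 1) (by simp) ht
  refine (integrable_coneLift_iff ht _).2 ((h.div_const (t : ℂ)).congr
    (Eventually.of_forall fun z => ?_))
  simp only [pullback, mul_one, smul_div_assoc]

theorem isBoxPlusOne {T : ℝ} (hT : 0 ≤ T) (hG : ∀ t, T < t →
      Integrable (fun z => (jbr z ^ 3)⁻¹ • boxPlusOne V V₁ V₂ t z) volume) :
    IsBoxPlusOne T (fun t => coneLift t fun z => (V t).f z / t)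
      fun t => coneLift t (boxPlusOne V V₁ V₂ t) := by
  refine ⟨fun t ht => ⟨(hV.integrable_coneLift_div (hT.trans_lt ht)).locallyIntegrable,
    ((integrable_coneLift_iff (hT.trans_lt ht) _).2 (hG t ht)).locallyIntegrable⟩,
    fun φ hφ hφc => ⟨fun t => ∫ z, pairing₁ V V₁ φ (deriv φ) t z, fun t hTt => ?_⟩⟩
  have ht := hT.trans_lt hTt
  obtain ⟨C, hC⟩ := exists_test_function_bounds hφ hφc
  have hφ₁ : ContDiff ℝ ∞ (deriv φ) := (contDiff_infty_iff_deriv.1 hφ).2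
  have d₀ : ∀ x, HasDerivAt φ (deriv φ x) x := fun x =>
    (hφ.differentiable (by simp) x).hasDerivAt
  have d₁ : ∀ x, HasDerivAt (deriv φ) (deriv (deriv φ) x) x := fun x =>
    (hφ₁.differentiable (by simp) x).hasDerivAt
  have c₂ : Continuous (deriv (deriv φ)) := (contDiff_infty_iff_deriv.1 hφ₁).2.continuous
  have cp := fun s => continuous_pairing₁ V V₁ hφ.continuous hφ₁.continuous s
  have bound := fun s hs => hV.exists_pairing_le hC (t := s) hs
  have D₁ := hasDerivAt_integral_of_locally_dominated integrable_inv_jbr_cube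
    (F := fun s z => pullback φ s z • (V s).f z)
    (fun s _ => (continuous_pullback hφ.continuous s).smul (V s).continuous) (fun s _ => cp s)
    (fun s hs z => hV.hasDerivAt_pairing d₀ hs z)
    (fun s hs => (bound s hs).imp fun K h r hr z => (h r hr z).1)
    (fun s hs => (bound s hs).imp fun K h r hr z => (h r hr z).2.1) ht
  have D₂ := hasDerivAt_integral_of_locally_dominated integrable_inv_jbr_cube
    (fun s _ => cp s)
    (fun s hs => hV.continuous_pairing₂ hφ.continuous hφ₁.continuous c₂ hs)
    (fun s hs z => hV.hasDerivAt_pairing₁ d₀ d₁ hs z)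
    (fun s hs => (bound s hs).imp fun K h r hr z => (h r hr z).2.1)
    (fun s hs => (bound s hs).imp fun K h r hr z => (h r hr z).2.2) ht
  refine ⟨D₁.2.congr_of_eventuallyEq ?_, D₂.2.congr_deriv ?_⟩
  · filter_upwards [lt_mem_nhds ht] with s hs using integral_smul_coneLift_div V φ hs
  · rw [iteratedDeriv_succ, iteratedDeriv_one, integral_smul_coneLift_div V _ ht,
      integral_smul_coneLift_div V _ ht, integral_smul_coneLift_eq_pullback _ ht]
    exact hV.integral_pairing₂ d₀ d₁ c₂ hC ht D₂.1 (hG t hTt)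

end IsConeAmplitude

end BoxPlusOne

section JetBounds

/-- Admissible control functions: `k` will bound a function and its first derivative, `h` also its
second derivative, which is only known to be of finite weighted `L²` norm. -/
structure Controls (K : ℝ) (k h : ℝ → ℝ) : Prop where
  nonneg : ∀ z, 0 ≤ k z
  le_h : ∀ z, k z ≤ h z
  decay : ∀ z, jbr z ^ 2 * k z ≤ K

namespace Controls

variable {K : ℝ} {k h : ℝ → ℝ}

theorem K_nonneg (H : Controls K k h) : 0 ≤ K :=
  (mul_nonneg (sq_nonneg _) (H.nonneg 0)).trans (H.decay 0)

theorem le_K (H : Controls K k h) (z : ℝ) : k z ≤ K :=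
  (le_mul_of_one_le_left (H.nonneg z) (one_le_pow₀ (one_le_jbr z))).trans (H.decay z)

theorem h_nonneg (H : Controls K k h) (z : ℝ) : 0 ≤ h z := (H.nonneg z).trans (H.le_h z)

theorem k_mul_k_le (H : Controls K k h) (z : ℝ) : k z * k z ≤ K * k z :=
  mul_le_mul_of_nonneg_right (H.le_K z) (H.nonneg z)

theorem k_mul_h_le (H : Controls K k h) (z : ℝ) : k z * h z ≤ K * h z :=
  mul_le_mul_of_nonneg_right (H.le_K z) (H.h_nonneg z)

theorem k_mul_k_le_h (H : Controls K k h) (z : ℝ) : k z * k z ≤ K * h z :=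
  (H.k_mul_k_le z).trans (mul_le_mul_of_nonneg_left (H.le_h z) H.K_nonneg)

theorem k_mul_k_le_inv_jbr_sq (H : Controls K k h) (z : ℝ) :
    k z * k z ≤ K ^ 2 * (jbr z ^ 2)⁻¹ := by
  have hdecay := (le_mul_inv_iff₀' (pow_pos (jbr_pos z) 2)).2 (H.decay z)
  calc k z * k z ≤ K * (K * (jbr z ^ 2)⁻¹) :=
        mul_le_mul (H.le_K z) hdecay (H.nonneg z) H.K_nonneg
    _ = K ^ 2 * (jbr z ^ 2)⁻¹ := by ring

end Controls

/-- The jet is bounded by `c` times the control functions `k`, `h` of `Controls`. -/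
structure JetBound (k h : ℝ → ℝ) (c : ℝ) (J : Jet) : Prop where
  b₀ : ∀ z, ‖J.f z‖ ≤ c * k z
  b₁ : ∀ z, ‖J.f₁ z‖ ≤ c * k z
  b₂ : ∀ z, ‖J.f₂ z‖ ≤ c * h z

theorem norm_mul_le_of_mul_le {X Y : ℂ} {c d x y K w : ℝ} (hX : ‖X‖ ≤ c * x) (hY : ‖Y‖ ≤ d * y)
    (hc : 0 ≤ c) (hd : 0 ≤ d) (h : x * y ≤ K * w) : ‖X * Y‖ ≤ c * d * K * w :=
  calc ‖X * Y‖ ≤ c * x * (d * y) := norm_mul_le_of_le hX hY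
    _ = c * d * (x * y) := by ring
    _ ≤ c * d * (K * w) := by gcongr
    _ = c * d * K * w := by ring

theorem norm_invJbr_f_le (z : ℝ) : ‖Jet.invJbr.f z‖ ≤ 1 := by
  rw [Jet.invJbr_f, Complex.norm_of_nonneg (inv_pos.2 (jbr_pos z)).le]
  exact inv_le_one_of_one_le₀ (one_le_jbr z)

theorem norm_invJbr_f₁_le (z : ℝ) : ‖Jet.invJbr.f₁ z‖ ≤ 1 := by
  have h := pow_pos (jbr_pos z) 3
  rw [Jet.invJbr_f₁, Complex.norm_real, norm_neg, Real.norm_eq_abs, abs_div, abs_of_pos h,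
    div_le_one h]
  exact (abs_le_jbr z).trans (le_self_pow₀ (one_le_jbr z) (by norm_num))

theorem norm_invJbr_f₂_le (z : ℝ) : ‖Jet.invJbr.f₂ z‖ ≤ 4 := by
  have hj := jbr_pos z
  have h3 : (jbr z ^ 3)⁻¹ ≤ 1 := inv_le_one_of_one_le₀ (one_le_pow₀ (one_le_jbr z))
  have h5 : z ^ 2 / jbr z ^ 5 ≤ 1 := (div_le_one (pow_pos hj 5)).2
    ((by linarith [jbr_sq z] : z ^ 2 ≤ jbr z ^ 2).trans
      (pow_le_pow_right₀ (one_le_jbr z) (by norm_num)))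
  have h3' : 0 ≤ (jbr z ^ 3)⁻¹ := by positivity
  have h5' : 0 ≤ z ^ 2 / jbr z ^ 5 := by positivity
  rw [Jet.invJbr_f₂, Complex.norm_real, Real.norm_eq_abs, mul_div_assoc, abs_le]
  constructor <;> linarith

theorem Jet.norm_cexp_f {J : Jet} {z : ℝ} (h : (J.f z).re = 0) : ‖J.cexp.f z‖ = 1 := by
  rw [cexp_f, Complex.norm_exp, h, Real.exp_zero]

namespace JetBound

variable {K c c' : ℝ} {k h : ℝ → ℝ} {J J' : Jet}

theorem add (hJ : JetBound k h c J) (hJ' : JetBound k h c' J') :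
    JetBound k h (c + c') (J.add J') where
  b₀ z := (norm_add_le_of_le (hJ.b₀ z) (hJ'.b₀ z)).trans_eq (add_mul ..).symm
  b₁ z := (norm_add_le_of_le (hJ.b₁ z) (hJ'.b₁ z)).trans_eq (add_mul ..).symm
  b₂ z := (norm_add_le_of_le (hJ.b₂ z) (hJ'.b₂ z)).trans_eq (add_mul ..).symm

theorem conj (hJ : JetBound k h c J) : JetBound k h c J.conj where
  b₀ z := (RCLike.norm_conj _).trans_le (hJ.b₀ z)
  b₁ z := (RCLike.norm_conj _).trans_le (hJ.b₁ z)
  b₂ z := (RCLike.norm_conj _).trans_le (hJ.b₂ z)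

theorem smul (a : ℂ) (hJ : JetBound k h c J) : JetBound k h (‖a‖ * c) (J.smul a) where
  b₀ z := (norm_mul_le_of_le le_rfl (hJ.b₀ z)).trans_eq (mul_assoc ..).symm
  b₁ z := (norm_mul_le_of_le le_rfl (hJ.b₁ z)).trans_eq (mul_assoc ..).symm
  b₂ z := (norm_mul_le_of_le le_rfl (hJ.b₂ z)).trans_eq (mul_assoc ..).symm

theorem mono (H : Controls K k h) (hc : c ≤ c') (hJ : JetBound k h c J) : JetBound k h c' J where
  b₀ z := (hJ.b₀ z).trans (mul_le_mul_of_nonneg_right hc (H.nonneg z))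
  b₁ z := (hJ.b₁ z).trans (mul_le_mul_of_nonneg_right hc (H.nonneg z))
  b₂ z := (hJ.b₂ z).trans (mul_le_mul_of_nonneg_right hc (H.h_nonneg z))

theorem mul (H : Controls K k h) (hc : 0 ≤ c) (hc' : 0 ≤ c') (hJ : JetBound k h c J)
    (hJ' : JetBound k h c' J') : JetBound k h (4 * (c * c' * K)) (J.mul J') := by
  have hK := mul_nonneg (mul_nonneg hc hc') H.K_nonneg
  have kk := H.k_mul_k_le
  refine ⟨fun z => ?_, fun z => ?_, fun z => ?_⟩
  · have h0 := norm_mul_le_of_mul_le (hJ.b₀ z) (hJ'.b₀ z) hc hc' (kk z)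
    exact h0.trans (by linarith [mul_nonneg hK (H.nonneg z)])
  · have h1 := norm_mul_le_of_mul_le (hJ.b₁ z) (hJ'.b₀ z) hc hc' (kk z)
    have h2 := norm_mul_le_of_mul_le (hJ.b₀ z) (hJ'.b₁ z) hc hc' (kk z)
    exact (norm_add_le_of_le h1 h2).trans (by linarith [mul_nonneg hK (H.nonneg z)])
  · have h1 := norm_mul_le_of_mul_le (hJ.b₂ z) (hJ'.b₀ z) hc hc'
      ((mul_comm _ _).trans_le (H.k_mul_h_le z))
    have h2 := norm_mul_le_of_mul_le (hJ.b₁ z) (hJ'.b₁ z) hc hc' (H.k_mul_k_le_h z)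
    have h3 := norm_mul_le_of_mul_le (hJ.b₀ z) (hJ'.b₂ z) hc hc' (H.k_mul_h_le z)
    refine norm_add₃_le.trans ?_
    rw [norm_mul (2 : ℂ), Complex.norm_ofNat]
    linarith

theorem invJbr_mul (H : Controls K k h) (hc : 0 ≤ c) (hJ : JetBound k h c J) :
    JetBound k h (7 * c) (Jet.invJbr.mul J) := by
  have hk := fun z => mul_nonneg hc (H.nonneg z)
  refine ⟨fun z => ?_, fun z => ?_, fun z => ?_⟩
  · exact (norm_mul_le_of_le (norm_invJbr_f_le z) (hJ.b₀ z)).trans (by linarith [hk z])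
  · have h1 := norm_mul_le_of_le (norm_invJbr_f₁_le z) (hJ.b₀ z)
    have h2 := norm_mul_le_of_le (norm_invJbr_f_le z) (hJ.b₁ z)
    exact (norm_add_le_of_le h1 h2).trans (by linarith [hk z])
  · have h1 := norm_mul_le_of_le (norm_invJbr_f₂_le z) (hJ.b₀ z)
    have h2 := norm_mul_le_of_le (norm_invJbr_f₁_le z) (hJ.b₁ z)
    have h3 := norm_mul_le_of_le (norm_invJbr_f_le z) (hJ.b₂ z)
    refine norm_add₃_le.trans ?_
    rw [norm_mul (2 : ℂ), Complex.norm_ofNat]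
    linarith [mul_le_mul_of_nonneg_left (H.le_h z) hc]

section Exp

variable {z : ℝ} (H : Controls K k h) (hc : 0 ≤ c) (hc' : 0 ≤ c') (hJ : JetBound k h c J)
  (hJ' : JetBound k h c' J') (hre : (J'.f z).re = 0)

include H hc hc' hJ hJ' hre

theorem norm_mul_cexp_f₁_le : ‖(J.mul J'.cexp).f₁ z‖ ≤ (1 + c' * K) * (c * k z) := by
  have hE := Jet.norm_cexp_f hre
  have h1 := norm_mul_le_of_mul_le (hJ.b₀ z) (hJ'.b₁ z) hc hc' (H.k_mul_k_le z)
  calc ‖J.f₁ z * J'.cexp.f z + J.f z * (J'.cexp.f z * J'.f₁ z)‖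
      = ‖J'.cexp.f z * (J.f₁ z + J.f z * J'.f₁ z)‖ := by congr 1; ring
    _ ≤ c * k z + c * c' * K * k z := by
        rw [norm_mul, hE, one_mul]
        exact norm_add_le_of_le (hJ.b₁ z) h1
    _ = (1 + c' * K) * (c * k z) := by ring

theorem norm_mul_cexp_f₂_le : ‖(J.mul J'.cexp).f₂ z‖ ≤ 2 * (1 + c' * K) ^ 2 * (c * h z) := by
  have hE := Jet.norm_cexp_f hre
  have hch := mul_nonneg hc (H.h_nonneg z)
  have hc'K := mul_nonneg hc' H.K_nonneg
  have h1 := norm_mul_le_of_mul_le (hJ.b₁ z) (hJ'.b₁ z) hc hc' (H.k_mul_k_le_h z)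
  have h2 := norm_mul_le_of_mul_le (hJ.b₀ z) (hJ'.b₂ z) hc hc' (H.k_mul_h_le z)
  have h3 : ‖J.f z * J'.f₁ z * J'.f₁ z‖ ≤ c * h z * (c' * K) ^ 2 := by
    have h4 := norm_mul_le_of_mul_le (hJ.b₀ z) (hJ'.b₁ z) hc hc' (H.k_mul_k_le_h z)
    have h5 := (hJ'.b₁ z).trans (mul_le_mul_of_nonneg_left (H.le_K z) hc')
    exact (norm_mul_le_of_le h4 h5).trans_eq (by ring)
  calc ‖J.f₂ z * J'.cexp.f z + 2 * (J.f₁ z * (J'.cexp.f z * J'.f₁ z))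
        + J.f z * (J'.cexp.f z * (J'.f₂ z + J'.f₁ z ^ 2))‖
      = ‖J'.cexp.f z * (J.f₂ z + 2 * (J.f₁ z * J'.f₁ z)
          + (J.f z * J'.f₂ z + J.f z * J'.f₁ z * J'.f₁ z))‖ := by congr 1; ring
    _ ≤ c * h z + 2 * (c * c' * K * h z) + (c * c' * K * h z + c * h z * (c' * K) ^ 2) := by
        rw [norm_mul, hE, one_mul]
        refine norm_add_le_of_le (norm_add_le_of_le (hJ.b₂ z) ?_) (norm_add_le_of_le h2 h3)
        exact norm_mul_le_of_le (Complex.norm_ofNat 2).le h1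
    _ = (1 + 3 * (c' * K) + (c' * K) ^ 2) * (c * h z) := by ring
    _ ≤ 2 * (1 + c' * K) ^ 2 * (c * h z) := by
        gcongr
        nlinarith

end Exp

end JetBound

end JetBounds

section Modes

/-- A wave `t^{r-1} f(μ) e^{iκt/⟨μ⟩ + i S(μ) log t}` in the light cone: an amplitude `f` carried by
the frequency `κ`, with a logarithmic phase correction `S`. -/
structure Mode where
  r : ℝ
  κ : ℝ
  f : Jet
  S : Jet
  real : ∀ z, (S.f z).im = 0

/-- The non-stationary factor `e^{iκt/⟨z⟩}`. -/
def carrier (κ t : ℝ) : Jet := (Jet.invJbr.smul (Complex.I * κ * t)).cexp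

theorem norm_carrier (κ t z : ℝ) : ‖(carrier κ t).f z‖ = 1 :=
  Jet.norm_cexp_f (by simp [-Complex.ofReal_inv])

theorem norm_carrier_f₁_le (κ t z : ℝ) : ‖(carrier κ t).f₁ z‖ ≤ |κ| * |t| := by
  have h : (carrier κ t).f₁ z = (carrier κ t).f z * (Complex.I * κ * t * Jet.invJbr.f₁ z) := rfl
  rw [h, norm_mul, norm_carrier, one_mul, norm_mul, norm_mul, norm_mul, Complex.norm_I, one_mul,
    Complex.norm_real, Complex.norm_real]
  exact mul_le_of_le_one_right (by positivity) (norm_invJbr_f₁_le z)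

namespace Mode

variable (m : Mode)

/-- The slowly varying factor `f e^{iS log t}`. -/
def slow (t : ℝ) : Jet := m.f.mul (m.S.smul (Complex.I * Real.log t)).cexp

/-- The mode without its power of `t`. -/
def wave (t : ℝ) : Jet := (m.slow t).mul (carrier m.κ t)

/-- `t` times the mode, as a curve of jets. -/
def curve (t : ℝ) : Jet := (m.wave t).smul (t ^ m.r : ℝ)

/-- The exponent of `t` in the slowly varying factor: `t^ρ = t^r e^{iS log t}`. -/
def exponent : Jet := (Jet.const m.r).add (m.S.smul Complex.I)

/-- The logarithmic `t`-derivative of `curve`. -/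
def rate (t : ℝ) : Jet := (m.exponent.smul (t : ℂ)⁻¹).add (Jet.invJbr.smul (Complex.I * m.κ))

/-- The `t`-derivative of `curve`. -/
def curve₁ (t : ℝ) : Jet := (m.rate t).mul (m.curve t)

/-- The second `t`-derivative of `curve`. -/
def curve₂ (t z : ℝ) : ℂ :=
  ((m.rate t).f z ^ 2 - m.exponent.f z / t ^ 2) * (m.curve t).f z

theorem norm_slow (t z : ℝ) : ‖(m.slow t).f z‖ = ‖m.f.f z‖ := by
  rw [slow, Jet.mul_f, norm_mul, Jet.norm_cexp_f (by simp [m.real z]), mul_one]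

theorem norm_wave (t z : ℝ) : ‖(m.wave t).f z‖ = ‖m.f.f z‖ := by
  rw [wave, Jet.mul_f, norm_mul, norm_carrier, mul_one, norm_slow]

theorem norm_curve {t : ℝ} (ht : 0 < t) (z : ℝ) :
    ‖(m.curve t).f z‖ = t ^ m.r * ‖m.f.f z‖ := by
  rw [curve, Jet.smul_f, norm_mul, norm_wave,
    Complex.norm_of_nonneg (Real.rpow_nonneg ht.le _)]

theorem curve_f (t z : ℝ) : (m.curve t).f z = (t ^ m.r : ℝ) * (m.f.f z *
    Complex.exp (Complex.I * Real.log t * m.S.f z) *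
    Complex.exp (Complex.I * m.κ * t * Jet.invJbr.f z)) := rfl

theorem hasDerivAt_curve {t : ℝ} (ht : 0 < t) (z : ℝ) :
    HasDerivAt (fun s => (m.curve s).f z) ((m.curve₁ t).f z) t := by
  have ht' : (t : ℂ) ≠ 0 := Complex.ofReal_ne_zero.2 ht.ne'
  have hr : HasDerivAt (fun s : ℝ => ((s ^ m.r : ℝ) : ℂ)) ((m.r * (t ^ m.r / t) : ℝ) : ℂ) t := by
    have := (Real.hasDerivAt_rpow_const (x := t) (p := m.r) (Or.inl ht.ne')).ofReal_comp
    rwa [Real.rpow_sub_one ht.ne'] at this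
  have hS := (((Real.hasDerivAt_log ht.ne').ofReal_comp.const_mul Complex.I).mul_const
    (m.S.f z)).cexp
  have hκ := (((hasDerivAt_id' t).ofReal_comp.const_mul (Complex.I * m.κ)).mul_const
    (Jet.invJbr.f z)).cexp
  simp only [curve_f]
  refine (hr.fun_mul ((hS.const_mul (m.f.f z)).fun_mul hκ)).congr_deriv ?_
  simp only [curve₁, rate, exponent, Jet.mul_f, Jet.add_f, Jet.smul_f, Jet.const_f, curve_f]
  push_cast
  field_simp
  ring

theorem hasDerivAt_curve₁ {t : ℝ} (ht : 0 < t) (z : ℝ) :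
    HasDerivAt (fun s => (m.curve₁ s).f z) (m.curve₂ t z) t := by
  have hr : HasDerivAt (fun s : ℝ => (m.rate s).f z) (-(m.exponent.f z / t ^ 2)) t := by
    have h := ((hasDerivAt_inv ht.ne').ofReal_comp.mul_const (m.exponent.f z)).add_const
      (Complex.I * m.κ * Jet.invJbr.f z)
    refine (h.congr_deriv ?_).congr_of_eventuallyEq (Eventually.of_forall fun s => ?_)
    · push_cast
      ring
    · simp [rate]
  refine (hr.fun_mul (m.hasDerivAt_curve ht z)).congr_deriv ?_
  rw [curve₂, curve₁, Jet.mul_f]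
  ring

theorem continuous_curve₂ (t : ℝ) : Continuous (m.curve₂ t) :=
  (((m.rate t).continuous.pow 2).sub (m.exponent.continuous.div_const _)).mul
    (m.curve t).continuous

/-- The part of `□ + 1` of the mode two orders of `t` below its leading part. -/
def remainder (t z : ℝ) : ℂ :=
  m.exponent.f z ^ 2 * (m.slow t).f z - 3 * (m.exponent.f z * (m.slow t).f z)
    + 2 * (m.slow t).f z
    - 2 * (z * jbr z ^ 2 * (m.exponent.f₁ z * (m.slow t).f z + m.exponent.f z * (m.slow t).f₁ z))
    + z * jbr z ^ 2 * (m.slow t).f₁ z - jbr z ^ 4 * (m.slow t).f₂ z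

/-- `□ + 1` of the mode in the coordinates `(t, z)`. -/
def source (t z : ℝ) : ℂ := boxPlusOne m.curve m.curve₁ m.curve₂ t z

theorem source_eq {t : ℝ} (ht : 0 < t) (z : ℝ) :
    m.source t z = (t ^ m.r / t : ℝ) * (carrier m.κ t).f z *
      ((1 - m.κ ^ 2) * (m.slow t).f z
        + Complex.I * m.κ * jbr z * (2 * m.exponent.f z - 1) * (m.slow t).f z / t
        + m.remainder t z / t ^ 2) := by
  have ht' : (t : ℂ) ≠ 0 := Complex.ofReal_ne_zero.2 ht.ne'
  have hj := ofReal_jbr_ne_zero z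
  have hz : (jbr z : ℂ) ^ 2 = 1 + z ^ 2 := mod_cast jbr_sq z
  simp only [source, boxPlusOne, curve₁, curve₂, curve, wave, rate, Jet.mul_f, Jet.mul_f₁,
    Jet.mul_f₂, Jet.smul_f, Jet.smul_f₁, Jet.smul_f₂, Jet.add_f, Jet.add_f₁, remainder]
  have c₁ : (carrier m.κ t).f₁ z = (carrier m.κ t).f z *
    (Complex.I * m.κ * t * Jet.invJbr.f₁ z) := rfl
  have c₂ : (carrier m.κ t).f₂ z = (carrier m.κ t).f z * (Complex.I * m.κ * t * Jet.invJbr.f₂ z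
    + (Complex.I * m.κ * t * Jet.invJbr.f₁ z) ^ 2) := rfl
  rw [c₁, c₂]
  simp only [Jet.invJbr_f, Jet.invJbr_f₁, Jet.invJbr_f₂]
  have hI := Complex.I_sq
  push_cast
  field_simp
  grind

/-- The amplitude and the phase of the mode are bounded by `c` and `d` times the control
functions. -/
structure Controlled (K : ℝ) (k h : ℝ → ℝ) (c d : ℝ) : Prop where
  controls : Controls K k h
  amp_nonneg : 0 ≤ c
  phase_nonneg : 0 ≤ d
  amp : JetBound k h c m.f
  phase : JetBound k h d m.S

/-- The loss per `z`-derivative of the slowly varying factor, also bounding `exponent`. -/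
def growth (K d t : ℝ) : ℝ := (1 + |m.r| + d * K) * (1 + |Real.log t|)

variable {m}

theorem norm_remainder_le_of_norm_le {t z Q Y : ℝ} (hQ : 1 ≤ Q)
    (hρ : ‖m.exponent.f z‖ ≤ Q) (hρ₁ : ‖m.exponent.f₁ z‖ ≤ Q) (hg : ‖(m.slow t).f z‖ ≤ Y)
    (hg₁ : ‖(m.slow t).f₁ z‖ ≤ Q * Y) (hg₂ : ‖(m.slow t).f₂ z‖ ≤ 2 * Q ^ 2 * Y) :
    ‖m.remainder t z‖ ≤ 13 * (jbr z ^ 4 * (Q ^ 2 * Y)) := by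
  have hj := one_le_jbr z
  have hY := (norm_nonneg _).trans hg
  have hz : ‖(z : ℂ) * (jbr z : ℂ) ^ 2‖ ≤ jbr z * jbr z ^ 2 := by
    rw [norm_mul, norm_pow, Complex.norm_real, Complex.norm_of_nonneg (jbr_pos z).le]
    exact mul_le_mul_of_nonneg_right (abs_le_jbr z) (sq_nonneg _)
  have hj4 : ‖(jbr z : ℂ) ^ 4‖ ≤ jbr z ^ 4 := by
    rw [norm_pow, Complex.norm_of_nonneg (jbr_pos z).le]
  have h2 : ‖(2 : ℂ)‖ ≤ 2 := (Complex.norm_ofNat 2).le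
  have hmix : ‖m.exponent.f₁ z * (m.slow t).f z + m.exponent.f z * (m.slow t).f₁ z‖
      ≤ Q * Y + Q * (Q * Y) :=
    norm_add_le_of_le (norm_mul_le_of_le hρ₁ hg) (norm_mul_le_of_le hρ hg₁)
  have hsq : ‖m.exponent.f z ^ 2‖ ≤ Q ^ 2 := by rw [norm_pow]; gcongr
  have key : ‖m.remainder t z‖ ≤ Q ^ 2 * Y + 3 * (Q * Y) + 2 * Y
      + 2 * (jbr z * jbr z ^ 2 * (Q * Y + Q * (Q * Y))) + jbr z * jbr z ^ 2 * (Q * Y)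
      + jbr z ^ 4 * (2 * Q ^ 2 * Y) :=
    norm_sub_le_of_le (norm_add_le_of_le (norm_sub_le_of_le (norm_add_le_of_le
      (norm_sub_le_of_le (norm_mul_le_of_le hsq hg)
        (norm_mul_le_of_le (Complex.norm_ofNat 3).le (norm_mul_le_of_le hρ hg)))
      (norm_mul_le_of_le h2 hg)) (norm_mul_le_of_le h2 (norm_mul_le_of_le hz hmix)))
      (norm_mul_le_of_le hz hg₁)) (norm_mul_le_of_le hj4 hg₂)
  have a1 : Y ≤ Q * Y := le_mul_of_one_le_left hY hQ
  have a2 : Q * Y ≤ Q ^ 2 * Y := by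
    gcongr
    exact le_self_pow₀ hQ two_ne_zero
  have a3 : jbr z * jbr z ^ 2 * (Q * Y) ≤ jbr z * jbr z ^ 2 * (Q ^ 2 * Y) := by gcongr
  have a4 : Q ^ 2 * Y ≤ jbr z ^ 4 * (Q ^ 2 * Y) :=
    le_mul_of_one_le_left (by positivity) (one_le_pow₀ hj)
  have a5 : jbr z * jbr z ^ 2 * (Q ^ 2 * Y) ≤ jbr z ^ 4 * (Q ^ 2 * Y) := by
    gcongr
    rw [← pow_succ']
    exact pow_le_pow_right₀ hj (by norm_num)
  refine key.trans ?_
  linarith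

namespace Controlled

variable {K c d t : ℝ} {k h : ℝ → ℝ} (hm : m.Controlled K k h c d)
include hm

theorem one_le_growth (t : ℝ) : 1 ≤ m.growth K d t :=
  one_le_mul_of_one_le_of_one_le
    (by linarith [abs_nonneg m.r, mul_nonneg hm.phase_nonneg hm.controls.K_nonneg])
    (by linarith [abs_nonneg (Real.log t)])

theorem norm_S_le (z : ℝ) : ‖m.S.f z‖ ≤ d * K :=
  (hm.phase.b₀ z).trans (mul_le_mul_of_nonneg_left (hm.controls.le_K z) hm.phase_nonneg)

theorem norm_exponent_le (z : ℝ) : ‖m.exponent.f z‖ ≤ |m.r| + d * K := by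
  refine norm_add_le_of_le (Complex.norm_real _).le ?_
  rw [Jet.smul_f, norm_mul, Complex.norm_I, one_mul]
  exact hm.norm_S_le z

theorem norm_exponent_f₁_le (z : ℝ) : ‖m.exponent.f₁ z‖ ≤ d * K := by
  have h : m.exponent.f₁ z = 0 + Complex.I * m.S.f₁ z := rfl
  rw [h, zero_add, norm_mul, Complex.norm_I, one_mul]
  exact (hm.phase.b₁ z).trans (mul_le_mul_of_nonneg_left (hm.controls.le_K z) hm.phase_nonneg)

theorem le_growth (t : ℝ) : |m.r| + d * K ≤ m.growth K d t := by
  have h := mul_nonneg hm.phase_nonneg hm.controls.K_nonneg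
  exact (le_mul_of_one_le_right (by positivity) (by linarith [abs_nonneg (Real.log t)])).trans
    (mul_le_mul_of_nonneg_right (by linarith) (by positivity))

theorem log_mul_le_growth (t : ℝ) : 1 + |Real.log t| * d * K ≤ m.growth K d t := by
  have h := mul_nonneg hm.phase_nonneg hm.controls.K_nonneg
  have h' : 0 ≤ |m.r| * (1 + |Real.log t|) := by positivity
  rw [growth]
  linarith [abs_nonneg (Real.log t)]

theorem phase_log (t : ℝ) :
    JetBound k h (|Real.log t| * d) (m.S.smul (Complex.I * Real.log t)) := by
  have := hm.phase.smul (Complex.I * Real.log t)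
  rwa [norm_mul, Complex.norm_I, one_mul, Complex.norm_real] at this

theorem norm_slow_f₁_le (t z : ℝ) : ‖(m.slow t).f₁ z‖ ≤ m.growth K d t * (c * k z) :=
  (hm.amp.norm_mul_cexp_f₁_le hm.controls hm.amp_nonneg
    (mul_nonneg (abs_nonneg _) hm.phase_nonneg) (hm.phase_log t) (by simp [m.real z])).trans
    (mul_le_mul_of_nonneg_right (hm.log_mul_le_growth t)
      (mul_nonneg hm.amp_nonneg (hm.controls.nonneg z)))

theorem norm_slow_f₂_le (t z : ℝ) : ‖(m.slow t).f₂ z‖ ≤ 2 * m.growth K d t ^ 2 * (c * h z) := by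
  have hd := mul_nonneg (mul_nonneg (abs_nonneg (Real.log t)) hm.phase_nonneg) hm.controls.K_nonneg
  refine (hm.amp.norm_mul_cexp_f₂_le hm.controls hm.amp_nonneg
    (mul_nonneg (abs_nonneg _) hm.phase_nonneg) (hm.phase_log t) (by simp [m.real z])).trans
    (mul_le_mul_of_nonneg_right ?_ (mul_nonneg hm.amp_nonneg (hm.controls.h_nonneg z)))
  gcongr
  exact hm.log_mul_le_growth t

theorem norm_remainder_le (t z : ℝ) :
    ‖m.remainder t z‖ ≤ 13 * (jbr z ^ 4 * (m.growth K d t ^ 2 * (c * h z))) := by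
  have hkh := mul_le_mul_of_nonneg_left (hm.controls.le_h z) hm.amp_nonneg
  have hQ := hm.one_le_growth t
  have hdK : d * K ≤ m.growth K d t := by linarith [hm.le_growth t, abs_nonneg m.r]
  refine norm_remainder_le_of_norm_le hQ ((hm.norm_exponent_le z).trans (hm.le_growth t))
    ((hm.norm_exponent_f₁_le z).trans hdK)
    (((m.norm_slow t z).trans_le (hm.amp.b₀ z)).trans hkh) ?_ (hm.norm_slow_f₂_le t z)
  exact (hm.norm_slow_f₁_le t z).trans (mul_le_mul_of_nonneg_left hkh (by linarith))

theorem norm_wave_f₁_le (t z : ℝ) :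
    ‖(m.wave t).f₁ z‖ ≤ (m.growth K d t + |m.κ| * |t|) * (c * k z) := by
  have h1 := norm_mul_le_of_le (hm.norm_slow_f₁_le t z) (norm_carrier m.κ t z).le
  have h2 := norm_mul_le_of_le ((m.norm_slow t z).trans_le (hm.amp.b₀ z))
    (norm_carrier_f₁_le m.κ t z)
  exact (norm_add_le_of_le h1 h2).trans_eq (by ring)

theorem norm_rate_le (ht : 0 < t) (z : ℝ) :
    ‖(m.rate t).f z‖ ≤ t⁻¹ * (|m.r| + d * K) + |m.κ| := by
  refine norm_add_le_of_le (norm_mul_le_of_le ?_ (hm.norm_exponent_le z)) ?_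
  · rw [norm_inv, Complex.norm_of_nonneg ht.le]
  · rw [Jet.smul_f, norm_mul, norm_mul, Complex.norm_I, one_mul, Complex.norm_real]
    exact mul_le_of_le_one_right (norm_nonneg _) (norm_invJbr_f_le z)

end Controlled

end Mode

end Modes

section ModeEquation

theorem exists_rpow_le (r : ℝ) {t : ℝ} (ht : 0 < t) :
    ∃ C, 0 ≤ C ∧ ∀ s ∈ Set.Ioo (t / 2) (2 * t), s ^ r ≤ C := by
  obtain ⟨C, hC⟩ := (isCompact_Icc (a := t / 2) (b := 2 * t)).exists_bound_of_continuousOn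
    (f := fun s : ℝ => s ^ r) fun s hs =>
      (Real.continuousAt_rpow_const _ _ (Or.inl (by linarith [hs.1]))).continuousWithinAt
  exact ⟨|C|, abs_nonneg C, fun s hs => (Real.le_norm_self _).trans
    ((hC s ⟨hs.1.le, hs.2.le⟩).trans (le_abs_self C))⟩

theorem tendsto_zero_of_norm_le_inv_jbr {F : ℝ → ℂ} {C : ℝ} (h : ∀ z, ‖F z‖ ≤ C * (jbr z)⁻¹) :
    Tendsto F (cocompact ℝ) (nhds 0) := by
  refine squeeze_zero_norm h ?_
  have := (tendsto_atTop_mono (fun z => abs_le_jbr z)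
    (tendsto_norm_cocompact_atTop (E := ℝ))).inv_tendsto_atTop
  simpa using this.const_mul C

namespace Mode.Controlled

variable {m : Mode} {K c d t : ℝ} {k h : ℝ → ℝ} (hm : m.Controlled K k h c d)
include hm

theorem jbr_mul_le (z : ℝ) : jbr z * (c * k z) ≤ c * K * (jbr z)⁻¹ := by
  rw [← div_eq_mul_inv, le_div_iff₀ (jbr_pos z)]
  calc jbr z * (c * k z) * jbr z = c * (jbr z ^ 2 * k z) := by ring
    _ ≤ c * K := mul_le_mul_of_nonneg_left (hm.controls.decay z) hm.amp_nonneg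

theorem mul_le_inv_jbr (z : ℝ) : c * k z ≤ c * K * (jbr z)⁻¹ :=
  (le_mul_of_one_le_left (mul_nonneg hm.amp_nonneg (hm.controls.nonneg z)) (one_le_jbr z)).trans
    (hm.jbr_mul_le z)

theorem norm_curve_le (ht : 0 < t) (z : ℝ) : ‖(m.curve t).f z‖ ≤ t ^ m.r * (c * k z) := by
  rw [norm_curve m ht]
  exact mul_le_mul_of_nonneg_left (hm.amp.b₀ z) (Real.rpow_nonneg ht.le _)

theorem exists_curve_bound (ht : 0 < t) : ∃ C, ∀ s ∈ Set.Ioo (t / 2) (2 * t), ∀ z,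
    ‖(m.curve s).f z‖ ≤ C ∧ ‖(m.curve₁ s).f z‖ ≤ C ∧ ‖m.curve₂ s z‖ ≤ C := by
  obtain ⟨q, hq0, hq⟩ := exists_rpow_le m.r ht
  set ρ := |m.r| + d * K
  set B := c * K
  set R := 2 / t * ρ + |m.κ|
  have hρ0 : 0 ≤ ρ := add_nonneg (abs_nonneg _) (mul_nonneg hm.phase_nonneg hm.controls.K_nonneg)
  have hB0 : 0 ≤ B := mul_nonneg hm.amp_nonneg hm.controls.K_nonneg
  have hR0 : 0 ≤ R := by positivity
  refine ⟨q * B + R * (q * B) + (R ^ 2 + ρ * (2 / t) ^ 2) * (q * B), fun s hs z => ?_⟩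
  have hs0 : 0 < s := by linarith [hs.1]
  have hinv : s⁻¹ ≤ 2 / t := by
    rw [inv_le_comm₀ hs0 (by positivity), inv_div]
    exact hs.1.le
  have h0 : ‖(m.curve s).f z‖ ≤ q * B := (hm.norm_curve_le hs0 z).trans
    (mul_le_mul (hq s hs) (mul_le_mul_of_nonneg_left (hm.controls.le_K z) hm.amp_nonneg)
      (mul_nonneg hm.amp_nonneg (hm.controls.nonneg z)) hq0)
  have hrate : ‖(m.rate s).f z‖ ≤ R := (hm.norm_rate_le hs0 z).trans
    (add_le_add (mul_le_mul_of_nonneg_right hinv hρ0) le_rfl)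
  have hsq : ‖(m.rate s).f z ^ 2‖ ≤ R ^ 2 := by
    rw [norm_pow]
    gcongr
  have hexp : ‖m.exponent.f z / (s : ℂ) ^ 2‖ ≤ ρ * (2 / t) ^ 2 := by
    rw [norm_div, norm_pow, Complex.norm_of_nonneg hs0.le, div_eq_mul_inv, ← inv_pow]
    exact mul_le_mul (hm.norm_exponent_le z) (pow_le_pow_left₀ (inv_nonneg.2 hs0.le) hinv 2)
      (by positivity) hρ0
  have h1 : ‖(m.curve₁ s).f z‖ ≤ R * (q * B) := norm_mul_le_of_le hrate h0
  have h2 : ‖m.curve₂ s z‖ ≤ (R ^ 2 + ρ * (2 / t) ^ 2) * (q * B) :=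
    norm_mul_le_of_le (norm_sub_le_of_le hsq hexp) h0
  have p0 : 0 ≤ q * B := by positivity
  have p1 : 0 ≤ R * (q * B) := by positivity
  have p2 : 0 ≤ (R ^ 2 + ρ * (2 / t) ^ 2) * (q * B) := by positivity
  exact ⟨by linarith, by linarith, by linarith⟩

theorem isConeAmplitude : IsConeAmplitude m.curve m.curve₁ m.curve₂ where
  hasDerivAt t ht := m.hasDerivAt_curve ht
  hasDerivAt₁ t ht := m.hasDerivAt_curve₁ ht
  continuous₂ t _ := m.continuous_curve₂ t
  bounded t ht := hm.exists_curve_bound ht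
  tendsto t ht := tendsto_zero_of_norm_le_inv_jbr (C := t ^ m.r * (c * K)) fun z => by
    rw [mul_assoc]
    exact (hm.norm_curve_le ht z).trans
      (mul_le_mul_of_nonneg_left (hm.mul_le_inv_jbr z) (Real.rpow_nonneg ht.le _))
  tendsto₁ t ht := tendsto_zero_of_norm_le_inv_jbr
    (C := (t⁻¹ * (|m.r| + d * K) + |m.κ|) * (t ^ m.r * (c * K))) fun z => by
    rw [mul_assoc, mul_assoc]
    exact norm_mul_le_of_le (hm.norm_rate_le ht z) ((hm.norm_curve_le ht z).trans
      (mul_le_mul_of_nonneg_left (hm.mul_le_inv_jbr z) (Real.rpow_nonneg ht.le _)))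
  tendsto_space t ht := tendsto_zero_of_norm_le_inv_jbr
    (C := t ^ m.r * (m.growth K d t + |m.κ| * |t|) * (c * K)) fun z => by
    have hr := Real.rpow_nonneg ht.le m.r
    have hg : 0 ≤ m.growth K d t := zero_le_one.trans (hm.one_le_growth t)
    rw [curve, Jet.smul_f₁, norm_mul, norm_mul, Complex.norm_of_nonneg (jbr_pos z).le,
      Complex.norm_of_nonneg hr]
    calc jbr z * (t ^ m.r * ‖(m.wave t).f₁ z‖)
        ≤ jbr z * (t ^ m.r * ((m.growth K d t + |m.κ| * |t|) * (c * k z))) := by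
          have := (jbr_pos z).le
          gcongr
          exact hm.norm_wave_f₁_le t z
      _ = t ^ m.r * (m.growth K d t + |m.κ| * |t|) * (jbr z * (c * k z)) := by ring
      _ ≤ t ^ m.r * (m.growth K d t + |m.κ| * |t|) * (c * K) * (jbr z)⁻¹ := by
          rw [mul_assoc _ (c * K)]
          exact mul_le_mul_of_nonneg_left (hm.jbr_mul_le z) (by positivity)

theorem norm_source_le (ht : 0 < t) (z : ℝ) : ‖m.source t z‖ ≤ t ^ m.r / t *
    (|1 - m.κ ^ 2| + |m.κ| * (2 * (|m.r| + d * K) + 1) / t + 13 * m.growth K d t ^ 2 / t ^ 2)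
      * (c * (jbr z ^ 4 * h z)) := by
  have hj := one_le_jbr z
  have hc := hm.amp_nonneg
  have hK := hm.controls.K_nonneg
  have hd := hm.phase_nonneg
  have hh := hm.controls.h_nonneg z
  have hg : ‖(m.slow t).f z‖ ≤ c * h z := ((m.norm_slow t z).trans_le (hm.amp.b₀ z)).trans
    (mul_le_mul_of_nonneg_left (hm.controls.le_h z) hc)
  have hk : ‖Complex.I * m.κ * jbr z‖ ≤ |m.κ| * jbr z := by
    rw [norm_mul, norm_mul, Complex.norm_I, one_mul, Complex.norm_real,
      Complex.norm_of_nonneg (jbr_pos z).le, Real.norm_eq_abs]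
  have hρ : ‖2 * m.exponent.f z - 1‖ ≤ 2 * (|m.r| + d * K) + 1 :=
    norm_sub_le_of_le (norm_mul_le_of_le (Complex.norm_ofNat 2).le (hm.norm_exponent_le z))
      norm_one.le
  have hκ : ‖(1 - m.κ ^ 2 : ℂ)‖ ≤ |1 - m.κ ^ 2| := by
    rw [← Real.norm_eq_abs, ← Complex.norm_real]
    norm_cast
  rw [source_eq m ht, norm_mul, norm_mul, norm_carrier, mul_one,
    Complex.norm_of_nonneg (div_nonneg (Real.rpow_nonneg ht.le _) ht.le), mul_assoc (t ^ m.r / t)]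
  have a1 : c * h z ≤ c * (jbr z ^ 4 * h z) :=
    mul_le_mul_of_nonneg_left (le_mul_of_one_le_left hh (one_le_pow₀ hj)) hc
  have a2 : jbr z * (c * h z) ≤ c * (jbr z ^ 4 * h z) := by
    rw [mul_left_comm]
    gcongr
    exact le_self_pow₀ hj (by norm_num)
  have b1 : ‖Complex.I * m.κ * jbr z * (2 * m.exponent.f z - 1) * (m.slow t).f z / t‖
      ≤ |m.κ| * (2 * (|m.r| + d * K) + 1) / t * (jbr z * (c * h z)) := by
    rw [norm_div, Complex.norm_of_nonneg ht.le]
    exact (div_le_div_of_nonneg_right (norm_mul_le_of_le (norm_mul_le_of_le hk hρ) hg)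
      ht.le).trans_eq (by ring)
  have b2 : ‖m.remainder t z / t ^ 2‖
      ≤ 13 * m.growth K d t ^ 2 / t ^ 2 * (c * (jbr z ^ 4 * h z)) := by
    rw [norm_div, norm_pow, Complex.norm_of_nonneg ht.le]
    exact (div_le_div_of_nonneg_right (hm.norm_remainder_le t z) (by positivity)).trans_eq (by ring)
  refine mul_le_mul_of_nonneg_left ?_ (div_nonneg (Real.rpow_nonneg ht.le _) ht.le)
  rw [add_mul, add_mul]
  refine norm_add₃_le.trans (add_le_add_three ((norm_mul_le_of_le hκ hg).trans ?_)
    (b1.trans ?_) b2) <;> gcongr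

end Mode.Controlled

theorem Mode.measurable_source (m : Mode) (t : ℝ) : Measurable (m.source t) := by
  have h := (m.continuous_curve₂ t).measurable
  have h₀ := (m.curve t).continuous.measurable
  have h₁ := (m.curve₁ t).continuous.measurable
  have h₂ := (m.curve₁ t).continuous₁.measurable
  have h₃ := (m.curve t).continuous₁.measurable
  have h₄ := (m.curve t).measurable
  have h₅ := continuous_jbr.measurable
  unfold Mode.source boxPlusOne
  fun_prop

theorem Mode.Controlled.isBoxPlusOne {m : Mode} {K c d T : ℝ} {k h : ℝ → ℝ}
    (hm : m.Controlled K k h c d) (hh : Integrable (fun z => jbr z * h z) volume) (hT : 0 ≤ T) :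
    IsBoxPlusOne T (fun t => coneLift t fun z => (m.curve t).f z / t)
      fun t => coneLift t (m.source t) := by
  refine hm.isConeAmplitude.isBoxPlusOne hT fun t ht => ?_
  have ht0 := hT.trans_lt ht
  refine (hh.const_mul (t ^ m.r / t * (|1 - m.κ ^ 2| + |m.κ| * (2 * (|m.r| + d * K) + 1) / t
    + 13 * m.growth K d t ^ 2 / t ^ 2) * c)).mono'
    (continuous_inv_jbr_cube.measurable.smul (m.measurable_source t)).aestronglyMeasurable
    (Eventually.of_forall fun z => ?_)
  have hj := jbr_ne_zero z
  rw [norm_smul, Real.norm_of_nonneg (inv_jbr_cube_pos z).le]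
  refine (mul_le_mul_of_nonneg_left (hm.norm_source_le ht0 z) (inv_jbr_cube_pos z).le).trans_eq ?_
  field_simp

end ModeEquation

section Profile

theorem cis_add (p q : ℝ) : cis (p + q) = cis p * cis q := by
  rw [cis, cis, cis, ← Complex.exp_add, Complex.ofReal_add, mul_add]

theorem conj_cis (p : ℝ) : (starRingEnd ℂ) (cis p) = cis (-p) := by
  rw [cis, cis, ← Complex.exp_conj, map_mul, Complex.conj_I, Complex.conj_ofReal,
    Complex.ofReal_neg, mul_neg, neg_mul]

theorem phaseB_eq_phaseA (lam : ℝ) (A B : ℝ → ℂ) : phaseB lam A B = phaseA (-lam) B A := by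
  funext z
  rw [phaseA, phaseB]
  ring

theorem ampB2_eq_ampA2 (lam : ℝ) (A B : ℝ → ℂ) : ampB2 lam A B = ampA2 lam B A := by
  funext z
  rw [ampA2, ampB2]
  ring

theorem mul_conj_eq_norm_sq (w : ℂ) : w * (starRingEnd ℂ) w = (‖w‖ : ℂ) ^ 2 := by
  rw [Complex.mul_conj, Complex.normSq_eq_norm_sq, Complex.ofReal_pow]

/-- The jet of `|f|²`. -/
def Jet.normSq (a : Jet) : Jet := a.mul a.conj

/-- The jet of `phaseA`. -/
def jetPhase (lam : ℝ) (a b : Jet) : Jet :=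
  (Jet.invJbr.mul (a.normSq.add (b.normSq.smul 2))).smul (lam / 2)

/-- The jet of `ampA2`. -/
def jetThird (lam : ℝ) (a b : Jet) : Jet := ((a.mul a).mul b.conj).smul (-(lam / 8))

theorem jetPhase_f (lam : ℝ) (a b : Jet) (z : ℝ) :
    (jetPhase lam a b).f z = (phaseA lam a.f b.f z : ℂ) := by
  simp only [jetPhase, Jet.normSq, Jet.smul_f, Jet.mul_f, Jet.add_f, Jet.conj_f, Jet.invJbr_f,
    mul_conj_eq_norm_sq, phaseA]
  push_cast
  ring

theorem jetThird_f (lam : ℝ) (a b : Jet) (z : ℝ) :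
    (jetThird lam a b).f z = ampA2 lam a.f b.f z := by
  simp only [jetThird, Jet.smul_f, Jet.mul_f, Jet.conj_f, ampA2]
  ring

/-- The mode carried by `A₁` for `σ = 1`, and the one carried by `B₁` for `σ = -1` and with the two
amplitudes exchanged. -/
def leadingMode (σ lam : ℝ) (a b : Jet) : Mode where
  r := 1 / 2
  κ := -σ
  f := a
  S := jetPhase (σ * lam) a b
  real z := by rw [jetPhase_f, Complex.ofReal_im]

/-- The third harmonic carried by `A₂` for `σ = 1`, and the one carried by `B₂` for `σ = -1` and
with the two amplitudes exchanged. -/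
def harmonicMode (σ lam : ℝ) (a b : Jet) : Mode where
  r := -(1 / 2)
  κ := -(3 * σ)
  f := jetThird lam a b
  S := ((jetPhase (σ * lam) a b).smul 2).add ((jetPhase (-σ * lam) b a).smul (-1))
  real z := by simp [jetPhase_f]

variable (σ lam : ℝ) (a b : Jet)

theorem leadingMode_wave (t z : ℝ) : ((leadingMode σ lam a b).wave t).f z =
    a.f z * cis (-(σ * (t / jbr z)) + phaseA (σ * lam) a.f b.f z * Real.log t) := by
  simp only [Mode.wave, Mode.slow, carrier, leadingMode, Jet.mul_f, Jet.cexp_f, Jet.smul_f,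
    Jet.invJbr_f, jetPhase_f, cis, mul_assoc, ← Complex.exp_add]
  congr 2
  push_cast
  ring

theorem harmonicMode_wave (t z : ℝ) : ((harmonicMode σ lam a b).wave t).f z =
    ampA2 lam a.f b.f z * cis (-(3 * (σ * (t / jbr z)))
      + (2 * phaseA (σ * lam) a.f b.f z - phaseA (-σ * lam) b.f a.f z) * Real.log t) := by
  simp only [Mode.wave, Mode.slow, carrier, harmonicMode, Jet.mul_f, Jet.cexp_f, Jet.smul_f,
    Jet.add_f, Jet.invJbr_f, jetPhase_f, jetThird_f, cis, mul_assoc, ← Complex.exp_add]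
  congr 2
  push_cast
  ring

theorem harmonicMode_wave_eq_leadingMode_wave (t z : ℝ) :
    ((harmonicMode σ lam a b).wave t).f z = -(lam / 8) *
      (((leadingMode σ lam a b).wave t).f z ^ 2 *
        (starRingEnd ℂ) (((leadingMode (-σ) lam b a).wave t).f z)) := by
  have h : ∀ p q : ℝ, cis (2 * p - q) = cis p ^ 2 * (starRingEnd ℂ) (cis q) := fun p q => by
    rw [conj_cis, sq, ← cis_add, ← cis_add]
    ring_nf
  rw [harmonicMode_wave, leadingMode_wave, leadingMode_wave, map_mul, ampA2]
  have e : -(3 * (σ * (t / jbr z)))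
      + (2 * phaseA (σ * lam) a.f b.f z - phaseA (-σ * lam) b.f a.f z) * Real.log t
      = 2 * (-(σ * (t / jbr z)) + phaseA (σ * lam) a.f b.f z * Real.log t)
        - (-(-σ * (t / jbr z)) + phaseA (-σ * lam) b.f a.f z * Real.log t) := by ring
  rw [e, h]
  ring

/-- The waves of frequency `-σ` and `-3σ` of the profile, in the coordinates `(t, z)`. -/
def halfProfile (t z : ℝ) : ℂ :=
  ((leadingMode σ lam a b).curve t).f z / t + ((harmonicMode σ lam a b).curve t).f z / t

/-- `□ + 1` of `halfProfile`. -/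
def halfSource (t z : ℝ) : ℂ :=
  (leadingMode σ lam a b).source t z + (harmonicMode σ lam a b).source t z

/-- The profile in the coordinates `(t, z)`. -/
def profileZ (t z : ℝ) : ℂ := halfProfile 1 lam a b t z + halfProfile (-1) lam b a t z

/-- `□ + 1` of `profileZ`. -/
def sourceZ (t z : ℝ) : ℂ := halfSource 1 lam a b t z + halfSource (-1) lam b a t z

theorem rpow_half_div {t : ℝ} (ht : 0 < t) : t ^ (1 / 2 : ℝ) / t = t ^ (-(1 / 2) : ℝ) := by
  rw [← Real.rpow_sub_one ht.ne']
  norm_num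

theorem rpow_neg_half_div {t : ℝ} (ht : 0 < t) :
    t ^ (-(1 / 2) : ℝ) / t = t ^ (-(3 / 2) : ℝ) := by
  rw [← Real.rpow_sub_one ht.ne']
  norm_num

theorem halfProfile_eq {t : ℝ} (ht : 0 < t) (z : ℝ) : halfProfile σ lam a b t z =
    (t ^ (-(1 / 2) : ℝ) : ℝ) * ((leadingMode σ lam a b).wave t).f z
      + (t ^ (-(3 / 2) : ℝ) : ℝ) * ((harmonicMode σ lam a b).wave t).f z := by
  have hc : ∀ m : Mode, (m.curve t).f z / t = (t ^ m.r / t : ℝ) * (m.wave t).f z := fun m => by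
    rw [Mode.curve, Jet.smul_f, mul_div_right_comm, Complex.ofReal_div]
  rw [halfProfile, hc, hc, ← rpow_half_div ht, ← rpow_neg_half_div ht]
  rfl

theorem profile_eq_coneLift_profileZ (t : ℝ) :
    profile lam a.f b.f t = coneLift t (profileZ lam a b t) := by
  funext x
  by_cases h : |x| < t
  · have ht : 0 < t := (abs_nonneg x).trans_lt h
    rw [profile, uap, vap, coneLift, if_pos h, if_pos h, if_pos h, profileZ,
      halfProfile_eq _ _ _ _ ht, halfProfile_eq _ _ _ _ ht, leadingMode_wave, leadingMode_wave,
      harmonicMode_wave, harmonicMode_wave, theta_eq h, phaseB_eq_phaseA, ampB2_eq_ampA2]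
    ring_nf
  · simp only [profile, uap, vap, coneLift, if_neg h, add_zero]

theorem profile_congr_ae {A B A' B' : ℝ → ℂ} (hA : A =ᵐ[volume] A') (hB : B =ᵐ[volume] B')
    (t : ℝ) : profile lam A B t =ᵐ[volume] profile lam A' B' t := by
  filter_upwards [ae_mu_of_ae t hA, ae_mu_of_ae t hB] with x hAx hBx
  by_cases h : |x| < t
  · simp only [profile, uap, vap, phaseA, phaseB, ampA2, ampB2, hAx h, hBx h]
  · simp only [profile, uap, vap, if_neg h]

end Profile

section Residual

theorem norm_cubic_sub_le (lam : ℝ) {x y : ℂ} {R : ℝ} (hx : ‖x‖ ≤ R) (hy : ‖y‖ ≤ R) :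
    ‖cubic lam x - cubic lam y‖ ≤ 3 * |lam| * R ^ 2 * ‖x - y‖ := by
  have e : cubic lam x - cubic lam y = lam * ((‖x‖ ^ 2 : ℝ) * (x - y)
      + (((‖x‖ - ‖y‖) * (‖x‖ + ‖y‖) : ℝ) : ℂ) * y) := by
    rw [cubic, cubic]
    push_cast
    ring
  have h1 : ‖((‖x‖ ^ 2 : ℝ) : ℂ)‖ ≤ R ^ 2 := by
    rw [Complex.norm_of_nonneg (sq_nonneg _)]
    gcongr
  have h2 : ‖(((‖x‖ - ‖y‖) * (‖x‖ + ‖y‖) : ℝ) : ℂ)‖ ≤ ‖x - y‖ * (R + R) := by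
    rw [Complex.norm_real, norm_mul, Real.norm_of_nonneg (by positivity : 0 ≤ ‖x‖ + ‖y‖)]
    exact mul_le_mul (abs_norm_sub_norm_le x y) (add_le_add hx hy) (by positivity) (norm_nonneg _)
  rw [e, norm_mul, Complex.norm_real, Real.norm_eq_abs]
  calc |lam| * _ ≤ |lam| * (R ^ 2 * ‖x - y‖ + ‖x - y‖ * (R + R) * R) :=
        mul_le_mul_of_nonneg_left (norm_add_le_of_le (norm_mul_le_of_le h1 le_rfl)
          (norm_mul_le_of_le h2 hy)) (abs_nonneg _)
    _ = 3 * |lam| * R ^ 2 * ‖x - y‖ := by ring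

/-- The terms of `N(x + y)` that have the frequency of `x` or that of `x²ȳ`, when `x` and `y` have
opposite frequencies. -/
def cubicHalf (lam : ℝ) (x y : ℂ) : ℂ :=
  lam * ((‖x‖ ^ 2 + 2 * ‖y‖ ^ 2) * x + x ^ 2 * (starRingEnd ℂ) y)

theorem cubic_add (lam : ℝ) (x y : ℂ) :
    cubic lam (x + y) = cubicHalf lam x y + cubicHalf lam y x := by
  rw [cubic, cubicHalf, cubicHalf, Complex.ofReal_pow, ← mul_conj_eq_norm_sq,
    ← mul_conj_eq_norm_sq, ← mul_conj_eq_norm_sq, map_add]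
  ring

theorem cubic_ofReal_mul (lam ρ : ℝ) (x : ℂ) : cubic lam (ρ * x) = ρ ^ 3 * cubic lam x := by
  rw [cubic, cubic, norm_mul, Complex.norm_real, mul_pow, Real.norm_eq_abs, sq_abs]
  push_cast
  ring

theorem rpow_neg_half_sq {t : ℝ} (ht : 0 < t) : (t ^ (-(1 / 2) : ℝ)) ^ 2 = t⁻¹ := by
  rw [← Real.rpow_natCast, ← Real.rpow_mul ht.le, ← Real.rpow_neg_one]
  norm_num

theorem Mode.source_eq_wave (m : Mode) {t : ℝ} (ht : 0 < t) (z : ℝ) :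
    m.source t z = (t ^ m.r / t : ℝ) * ((1 - m.κ ^ 2) * (m.wave t).f z
      + Complex.I * m.κ * jbr z * (2 * m.exponent.f z - 1) * (m.wave t).f z / t
      + (carrier m.κ t).f z * m.remainder t z / t ^ 2) := by
  rw [m.source_eq ht, wave, Jet.mul_f]
  ring

variable {σ lam : ℝ} {a b : Jet}

theorem leadingMode_source (hσ : σ ^ 2 = 1) {t : ℝ} (ht : 0 < t) (z : ℝ) :
    (leadingMode σ lam a b).source t z = (t ^ (-(1 / 2) : ℝ) : ℝ) *
      (lam * (‖a.f z‖ ^ 2 + 2 * ‖b.f z‖ ^ 2) * ((leadingMode σ lam a b).wave t).f z / t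
        + (carrier (-σ) t).f z * (leadingMode σ lam a b).remainder t z / t ^ 2) := by
  have hj := ofReal_jbr_ne_zero z
  have hσ' : (σ : ℂ) ^ 2 = 1 := mod_cast hσ
  have hρ : Complex.I * (-σ : ℝ) * jbr z * (2 * (leadingMode σ lam a b).exponent.f z - 1)
      = lam * (‖a.f z‖ ^ 2 + 2 * ‖b.f z‖ ^ 2) := by
    simp only [Mode.exponent, leadingMode, Jet.add_f, Jet.const_f, Jet.smul_f, jetPhase_f, phaseA]
    push_cast
    field_simp
    linear_combination (-σ ^ 2 * lam * (‖a.f z‖ ^ 2 + 2 * ‖b.f z‖ ^ 2)) * Complex.I_sq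
      + lam * (‖a.f z‖ ^ 2 + 2 * ‖b.f z‖ ^ 2) * hσ'
  have hκ : (1 - ((-σ : ℝ) : ℂ) ^ 2) = 0 := by
    rw [Complex.ofReal_neg, neg_sq, hσ', sub_self]
  rw [Mode.source_eq_wave _ ht, ← rpow_half_div ht]
  change _ * ((1 - ((-σ : ℝ) : ℂ) ^ 2) * _ + Complex.I * (-σ : ℝ) * _ * _ * _ / _ + _) = _
  rw [hρ, hκ, zero_mul, zero_add]
  rfl

theorem harmonicMode_source (hσ : σ ^ 2 = 1) {t : ℝ} (ht : 0 < t) (z : ℝ) :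
    (harmonicMode σ lam a b).source t z = (t ^ (-(1 / 2) : ℝ) / t : ℝ) *
      (lam * (((leadingMode σ lam a b).wave t).f z ^ 2
          * (starRingEnd ℂ) (((leadingMode (-σ) lam b a).wave t).f z))
        + Complex.I * (-(3 * σ) : ℝ) * jbr z * (2 * (harmonicMode σ lam a b).exponent.f z - 1)
          * ((harmonicMode σ lam a b).wave t).f z / t
        + (carrier (-(3 * σ)) t).f z * (harmonicMode σ lam a b).remainder t z / t ^ 2) := by
  have hκ : (1 - ((-(3 * σ) : ℝ) : ℂ) ^ 2) = -8 := by
    rw [← Complex.ofReal_pow, neg_sq, mul_pow, hσ]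
    norm_num
  have hres : (1 - ((-(3 * σ) : ℝ) : ℂ) ^ 2) * ((harmonicMode σ lam a b).wave t).f z
      = lam * (((leadingMode σ lam a b).wave t).f z ^ 2
          * (starRingEnd ℂ) (((leadingMode (-σ) lam b a).wave t).f z)) := by
    rw [hκ, harmonicMode_wave_eq_leadingMode_wave]
    ring
  rw [Mode.source_eq_wave _ ht, ← hres]
  rfl

theorem halfSource_sub_cubicHalf (hσ : σ ^ 2 = 1) {t : ℝ} (ht : 0 < t) (z : ℝ) :
    halfSource σ lam a b t z - (t ^ (-(1 / 2) : ℝ) : ℝ) ^ 3 * cubicHalf lam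
        (((leadingMode σ lam a b).wave t).f z) (((leadingMode (-σ) lam b a).wave t).f z)
      = (t ^ (-(1 / 2) : ℝ) / t ^ 2 : ℝ) *
        ((carrier (-σ) t).f z * (leadingMode σ lam a b).remainder t z
          + Complex.I * (-(3 * σ) : ℝ) * jbr z * (2 * (harmonicMode σ lam a b).exponent.f z - 1)
            * ((harmonicMode σ lam a b).wave t).f z
          + (carrier (-(3 * σ)) t).f z * (harmonicMode σ lam a b).remainder t z / t) := by
  have ht' : (t : ℂ) ≠ 0 := Complex.ofReal_ne_zero.2 ht.ne'
  have hq : ((t ^ (-(1 / 2) : ℝ) : ℝ) : ℂ) ^ 3 = (t ^ (-(1 / 2) : ℝ) : ℝ) / t := by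
    rw [pow_succ', ← Complex.ofReal_pow, rpow_neg_half_sq ht, Complex.ofReal_inv,
      ← div_eq_mul_inv]
  rw [halfSource, leadingMode_source hσ ht, harmonicMode_source hσ ht, hq, cubicHalf,
    Mode.norm_wave, Mode.norm_wave]
  simp only [leadingMode]
  push_cast
  field_simp
  ring

/-- A common bound for the constants of all modes of the profile. -/
def modeConst (lam K : ℝ) : ℝ := 126 * ((|lam| + 1) * (1 + K ^ 2))

theorem abs_mul_sq_add_le_modeConst (lam K : ℝ) :
    126 + 126 * (|lam| * K ^ 2) ≤ modeConst lam K := by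
  rw [modeConst]
  nlinarith [abs_nonneg lam, sq_nonneg K]

theorem leadingMode_growth_le (K t : ℝ) :
    (leadingMode σ lam a b).growth K (126 * |lam| * K) t
      ≤ modeConst lam K * (1 + |Real.log t|) := by
  refine mul_le_mul_of_nonneg_right (le_trans ?_ (abs_mul_sq_add_le_modeConst lam K))
    (by positivity)
  rw [leadingMode, abs_of_pos (by norm_num : (0 : ℝ) < 1 / 2)]
  linarith

theorem harmonicMode_growth_le (K t : ℝ) :
    (harmonicMode σ lam a b).growth K (126 * |lam| * K) t
      ≤ modeConst lam K * (1 + |Real.log t|) := by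
  refine mul_le_mul_of_nonneg_right (le_trans ?_ (abs_mul_sq_add_le_modeConst lam K))
    (by positivity)
  rw [harmonicMode, abs_neg, abs_of_pos (by norm_num : (0 : ℝ) < 1 / 2)]
  linarith

variable {K : ℝ} {k h : ℝ → ℝ} (H : Controls K k h) (ha : JetBound k h 1 a)
  (hb : JetBound k h 1 b)

include H in
theorem JetBound.normSq (ha : JetBound k h 1 a) : JetBound k h (4 * K) a.normSq := by
  simpa [Jet.normSq] using ha.mul H zero_le_one zero_le_one ha.conj

include H ha hb

theorem JetBound.jetPhase (lam : ℝ) : JetBound k h (42 * |lam| * K) (jetPhase lam a b) := by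
  have hK := H.K_nonneg
  refine ((((ha.normSq H).add ((hb.normSq H).smul 2)).invJbr_mul H (by positivity)).smul
    (lam / 2)).mono H (le_of_eq ?_)
  rw [Complex.norm_ofNat, norm_div, Complex.norm_real, Real.norm_eq_abs, Complex.norm_ofNat]
  ring

theorem JetBound.jetThird (lam : ℝ) : JetBound k h (2 * |lam| * K ^ 2) (jetThird lam a b) := by
  have hK := H.K_nonneg
  refine (((ha.mul H zero_le_one zero_le_one ha).mul H (by positivity) zero_le_one hb.conj).smul
    (-(lam / 8))).mono H (le_of_eq ?_)
  rw [norm_neg, norm_div, Complex.norm_real, Real.norm_eq_abs, Complex.norm_ofNat]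
  ring

theorem leadingMode_controlled (hσ : |σ| = 1) :
    (leadingMode σ lam a b).Controlled K k h 1 (126 * |lam| * K) where
  controls := H
  amp_nonneg := zero_le_one
  phase_nonneg := mul_nonneg (by positivity) H.K_nonneg
  amp := ha
  phase := by
    refine (ha.jetPhase H hb (σ * lam)).mono H ?_
    rw [abs_mul, hσ, one_mul]
    exact mul_le_mul_of_nonneg_right (by linarith [abs_nonneg lam]) H.K_nonneg

theorem harmonicMode_controlled (hσ : |σ| = 1) :
    (harmonicMode σ lam a b).Controlled K k h (2 * |lam| * K ^ 2) (126 * |lam| * K) where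
  controls := H
  amp_nonneg := by positivity
  phase_nonneg := mul_nonneg (by positivity) H.K_nonneg
  amp := ha.jetThird H hb lam
  phase := by
    refine (((ha.jetPhase H hb (σ * lam)).smul 2).add
      ((hb.jetPhase H ha (-σ * lam)).smul (-1))).mono H (le_of_eq ?_)
    rw [abs_mul, abs_mul, abs_neg, hσ, Complex.norm_ofNat, norm_neg, norm_one]
    ring

end Residual

section ResidualBound

variable {σ lam K : ℝ} {k h : ℝ → ℝ} {a b : Jet}

theorem one_le_modeConst (lam K : ℝ) : 1 ≤ modeConst lam K := by
  linarith [abs_mul_sq_add_le_modeConst lam K, mul_nonneg (abs_nonneg lam) (sq_nonneg K)]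

theorem profileZ_eq (lam : ℝ) (a b : Jet) {t : ℝ} (ht : 0 < t) (z : ℝ) :
    profileZ lam a b t z = (t ^ (-(1 / 2) : ℝ) : ℝ) * (((leadingMode 1 lam a b).wave t).f z
        + ((leadingMode (-1) lam b a).wave t).f z)
      + (t ^ (-(1 / 2) : ℝ) / t : ℝ) * (((harmonicMode 1 lam a b).wave t).f z
        + ((harmonicMode (-1) lam b a).wave t).f z) := by
  rw [profileZ, halfProfile_eq _ _ _ _ ht, halfProfile_eq _ _ _ _ ht, ← rpow_neg_half_div ht]
  ring

theorem norm_cubic_sub_cubic_add_div_le (lam : ℝ) {ρ t R Y e : ℝ} {x y : ℂ} (hρ : 0 ≤ ρ)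
    (ht : 1 ≤ t) (hx : ‖x‖ ≤ R) (hy : ‖y‖ ≤ Y) (hY : Y ≤ R * e) :
    ‖cubic lam (ρ * x) - cubic lam (ρ * x + (ρ / t : ℝ) * y)‖
      ≤ 3 * |lam| * (ρ * (R * (1 + e))) ^ 2 * (ρ / t * Y) := by
  have hY0 := (norm_nonneg y).trans hy
  have hx' : ‖(ρ : ℂ) * x‖ ≤ ρ * R := norm_mul_le_of_le (Complex.norm_of_nonneg hρ).le hx
  have hy' : ‖((ρ / t : ℝ) : ℂ) * y‖ ≤ ρ / t * Y :=
    norm_mul_le_of_le (Complex.norm_of_nonneg (by positivity)).le hy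
  have hyR : ρ / t * Y ≤ ρ * (R * e) := mul_le_mul (div_le_self hρ ht) hY hY0 hρ
  have hsum := (norm_add_le_of_le hx' (hy'.trans hyR)).trans_eq
    (by ring : _ = ρ * (R * (1 + e)))
  have hfirst : ρ * R ≤ ρ * (R * (1 + e)) := by
    linarith [mul_nonneg hρ (hY0.trans hY)]
  refine (norm_cubic_sub_le lam (hx'.trans hfirst) hsum).trans ?_
  rw [sub_add_cancel_left, norm_neg]
  gcongr

variable (H : Controls K k h) (ha : JetBound k h 1 a) (hb : JetBound k h 1 b)

include H ha hb

theorem norm_leadingMode_remainder_le (hσ : |σ| = 1) (t z : ℝ) :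
    ‖(leadingMode σ lam a b).remainder t z‖ ≤
      13 * (modeConst lam K ^ 2 * (1 + |Real.log t|) ^ 2 * (jbr z ^ 4 * h z)) := by
  have hm := leadingMode_controlled (lam := lam) H ha hb hσ
  have hh := H.h_nonneg z
  have hg := zero_le_one.trans (hm.one_le_growth t)
  calc _ ≤ 13 * (jbr z ^ 4 * (_ ^ 2 * (1 * h z))) := hm.norm_remainder_le t z
    _ ≤ 13 * (jbr z ^ 4 * ((modeConst lam K * (1 + |Real.log t|)) ^ 2 * (1 * h z))) := by
        gcongr
        exact leadingMode_growth_le K t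
    _ = _ := by ring

theorem norm_harmonicMode_remainder_le (hσ : |σ| = 1) (t z : ℝ) :
    ‖(harmonicMode σ lam a b).remainder t z‖ ≤
      13 * (modeConst lam K ^ 3 * (1 + |Real.log t|) ^ 2 * (jbr z ^ 4 * h z)) := by
  have hm := harmonicMode_controlled (lam := lam) H ha hb hσ
  have hh := H.h_nonneg z
  have hg := zero_le_one.trans (hm.one_le_growth t)
  have hG := zero_le_one.trans (one_le_modeConst lam K)
  have hc : 2 * |lam| * K ^ 2 ≤ modeConst lam K := by
    linarith [abs_mul_sq_add_le_modeConst lam K, mul_nonneg (abs_nonneg lam) (sq_nonneg K)]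
  calc _ ≤ 13 * (jbr z ^ 4 * (_ ^ 2 * (2 * |lam| * K ^ 2 * h z))) := hm.norm_remainder_le t z
    _ ≤ 13 * (jbr z ^ 4 * ((modeConst lam K * (1 + |Real.log t|)) ^ 2
          * (modeConst lam K * h z))) := by
        gcongr
        exact harmonicMode_growth_le K t
    _ = _ := by ring

theorem norm_harmonicMode_wave_le (hσ : |σ| = 1) (t z : ℝ) :
    ‖((harmonicMode σ lam a b).wave t).f z‖ ≤ 2 * |lam| * K ^ 2 * k z :=
  (Mode.norm_wave _ t z).trans_le ((harmonicMode_controlled H ha hb hσ).amp.b₀ z)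

theorem norm_harmonicMode_transport_le (hσ : |σ| = 1) (t z : ℝ) :
    ‖Complex.I * (-(3 * σ) : ℝ) * jbr z * (2 * (harmonicMode σ lam a b).exponent.f z - 1)
      * ((harmonicMode σ lam a b).wave t).f z‖ ≤ 6 * (modeConst lam K ^ 2 * (jbr z ^ 4 * h z)) := by
  have hm := harmonicMode_controlled (lam := lam) H ha hb hσ
  have hG := zero_le_one.trans (one_le_modeConst lam K)
  have hj := one_le_jbr z
  have hG' := abs_mul_sq_add_le_modeConst lam K
  have hlam := mul_nonneg (abs_nonneg lam) (sq_nonneg K)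
  have hI : ‖Complex.I * (-(3 * σ) : ℝ) * jbr z‖ ≤ 3 * jbr z := by
    rw [norm_mul, norm_mul, Complex.norm_I, Complex.norm_real,
      Complex.norm_of_nonneg (jbr_pos z).le, norm_neg, Real.norm_eq_abs, abs_mul, hσ]
    norm_num
  have hρ : ‖2 * (harmonicMode σ lam a b).exponent.f z - 1‖ ≤ 2 * modeConst lam K := by
    refine (norm_sub_le_of_le (norm_mul_le_of_le (Complex.norm_ofNat 2).le (hm.norm_exponent_le z))
      norm_one.le).trans ?_
    rw [harmonicMode, abs_neg, abs_of_pos (by norm_num : (0 : ℝ) < 1 / 2)]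
    linarith
  have hw : ‖((harmonicMode σ lam a b).wave t).f z‖ ≤ modeConst lam K * h z :=
    (norm_harmonicMode_wave_le H ha hb hσ t z).trans
      (mul_le_mul (by linarith) (H.le_h z) (H.nonneg z) hG)
  calc _ ≤ 3 * jbr z * (2 * modeConst lam K) * (modeConst lam K * h z) :=
        norm_mul_le_of_le (norm_mul_le_of_le hI hρ) hw
    _ = 6 * (modeConst lam K ^ 2 * (jbr z * h z)) := by ring
    _ ≤ 6 * (modeConst lam K ^ 2 * (jbr z ^ 4 * h z)) := by
        have := H.h_nonneg z
        gcongr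
        exact le_self_pow₀ hj (by norm_num)

theorem norm_halfSource_sub_cubicHalf_le (hσ : |σ| = 1) {t : ℝ} (ht : 1 ≤ t) (z : ℝ) :
    ‖halfSource σ lam a b t z - (t ^ (-(1 / 2) : ℝ) : ℝ) ^ 3 * cubicHalf lam
        (((leadingMode σ lam a b).wave t).f z) (((leadingMode (-σ) lam b a).wave t).f z)‖
      ≤ t ^ (-(1 / 2) : ℝ) / t ^ 2 *
        (32 * (modeConst lam K ^ 3 * (1 + |Real.log t|) ^ 2 * (jbr z ^ 4 * h z))) := by
  have ht0 := zero_lt_one.trans_le ht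
  have hG := one_le_modeConst lam K
  have hh := H.h_nonneg z
  have hL : 1 ≤ (1 + |Real.log t|) ^ 2 := one_le_pow₀ (by linarith [abs_nonneg (Real.log t)])
  rw [halfSource_sub_cubicHalf (by rw [← sq_abs, hσ, one_pow]) ht0, norm_mul,
    Complex.norm_of_nonneg (by positivity)]
  refine mul_le_mul_of_nonneg_left ?_ (by positivity)
  have h3 : ‖(carrier (-(3 * σ)) t).f z * (harmonicMode σ lam a b).remainder t z / t‖
      ≤ ‖(harmonicMode σ lam a b).remainder t z‖ := by
    rw [norm_div, norm_mul, norm_carrier, one_mul, Complex.norm_of_nonneg ht0.le]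
    exact div_le_self (norm_nonneg _) ht
  have h1 : ‖(carrier (-σ) t).f z * (leadingMode σ lam a b).remainder t z‖
      ≤ ‖(leadingMode σ lam a b).remainder t z‖ := by rw [norm_mul, norm_carrier, one_mul]
  set X := jbr z ^ 4 * h z
  have hX : 0 ≤ X := by positivity
  have e1 : modeConst lam K ^ 2 * (1 + |Real.log t|) ^ 2 * X
      ≤ modeConst lam K ^ 3 * (1 + |Real.log t|) ^ 2 * X := by
    gcongr
    norm_num
  have e2 : modeConst lam K ^ 2 * X ≤ modeConst lam K ^ 2 * (1 + |Real.log t|) ^ 2 * X := by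
    gcongr
    exact le_mul_of_one_le_right (by positivity) hL
  refine (norm_add₃_le.trans (add_le_add_three
    (h1.trans (norm_leadingMode_remainder_le H ha hb hσ t z))
    (norm_harmonicMode_transport_le H ha hb hσ t z)
    (h3.trans (norm_harmonicMode_remainder_le H ha hb hσ t z)))).trans ?_
  linarith

theorem norm_cubic_leading_sub_cubic_profileZ_le {t : ℝ} (ht : 1 ≤ t) (z : ℝ) :
    ‖cubic lam ((t ^ (-(1 / 2) : ℝ) : ℝ) * (((leadingMode 1 lam a b).wave t).f z
        + ((leadingMode (-1) lam b a).wave t).f z)) - cubic lam (profileZ lam a b t z)‖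
      ≤ t ^ (-(1 / 2) : ℝ) / t ^ 2 * (modeConst lam K ^ 4 * k z) := by
  have ht0 := zero_lt_one.trans_le ht
  have hρ2 := rpow_neg_half_sq ht0
  have hρ : 0 ≤ t ^ (-(1 / 2) : ℝ) := by positivity
  have hK := H.K_nonneg
  have hk := H.nonneg z
  have hlam := mul_nonneg (abs_nonneg lam) (sq_nonneg K)
  have hG := abs_mul_sq_add_le_modeConst lam K
  have hx : ‖((leadingMode 1 lam a b).wave t).f z + ((leadingMode (-1) lam b a).wave t).f z‖
      ≤ 2 * K := (norm_add_le_of_le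
    (((Mode.norm_wave _ t z).trans_le (ha.b₀ z)).trans ((one_mul _).trans_le (H.le_K z)))
    (((Mode.norm_wave _ t z).trans_le (hb.b₀ z)).trans ((one_mul _).trans_le (H.le_K z)))).trans_eq
    (two_mul K).symm
  have hy : ‖((harmonicMode 1 lam a b).wave t).f z + ((harmonicMode (-1) lam b a).wave t).f z‖
      ≤ 4 * |lam| * K ^ 2 * k z := (norm_add_le_of_le
    (norm_harmonicMode_wave_le H ha hb abs_one t z)
    (norm_harmonicMode_wave_le H hb ha (by norm_num) t z)).trans_eq (by ring)
  rw [profileZ_eq lam a b ht0]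
  have hYR : 4 * |lam| * K ^ 2 * k z ≤ 2 * K * (2 * (|lam| * K ^ 2)) :=
    (mul_le_mul_of_nonneg_left (H.le_K z) (by positivity)).trans_eq (by ring)
  refine (norm_cubic_sub_cubic_add_div_le lam hρ ht hx hy hYR).trans ?_
  calc 3 * |lam| * (t ^ (-(1 / 2) : ℝ) * (2 * K * (1 + 2 * (|lam| * K ^ 2)))) ^ 2
        * (t ^ (-(1 / 2) : ℝ) / t * (4 * |lam| * K ^ 2 * k z))
      = (t ^ (-(1 / 2) : ℝ)) ^ 2 * (t ^ (-(1 / 2) : ℝ) / t) * (3 * (|lam| * K ^ 2) ^ 2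
          * (4 * (1 + 2 * (|lam| * K ^ 2))) ^ 2 * k z) := by ring
    _ = t ^ (-(1 / 2) : ℝ) / t ^ 2 * (3 * (|lam| * K ^ 2) ^ 2
          * (4 * (1 + 2 * (|lam| * K ^ 2))) ^ 2 * k z) := by rw [hρ2]; field_simp
    _ ≤ t ^ (-(1 / 2) : ℝ) / t ^ 2 * (modeConst lam K ^ 2 * modeConst lam K ^ 2 * k z) := by
        gcongr
        · nlinarith
        · linarith
    _ = _ := by ring

theorem norm_sourceZ_sub_cubic_le {t : ℝ} (ht : 1 ≤ t) (z : ℝ) :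
    ‖sourceZ lam a b t z - cubic lam (profileZ lam a b t z)‖ ≤ t ^ (-(1 / 2) : ℝ) / t ^ 2 *
      (65 * (modeConst lam K ^ 4 * (1 + |Real.log t|) ^ 2 * (jbr z ^ 4 * h z))) := by
  have hG := one_le_modeConst lam K
  have hk := H.nonneg z
  have hL : 1 ≤ (1 + |Real.log t|) ^ 2 := one_le_pow₀ (by linarith [abs_nonneg (Real.log t)])
  have hkh : k z ≤ (1 + |Real.log t|) ^ 2 * (jbr z ^ 4 * h z) := (H.le_h z).trans
    ((le_mul_of_one_le_left (H.h_nonneg z) (one_le_pow₀ (one_le_jbr z))).trans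
      (le_mul_of_one_le_left (by have := H.h_nonneg z; positivity) hL))
  have hplus := norm_halfSource_sub_cubicHalf_le (lam := lam) H ha hb abs_one ht z
  have hminus := norm_halfSource_sub_cubicHalf_le (lam := lam) (σ := -1) H hb ha (by norm_num) ht z
  have hcubic := norm_cubic_leading_sub_cubic_profileZ_le (lam := lam) H ha hb ht z
  rw [neg_neg] at hminus
  rw [cubic_ofReal_mul, cubic_add] at hcubic
  set ρ := t ^ (-(1 / 2) : ℝ)
  set x := ((leadingMode 1 lam a b).wave t).f z
  set y := ((leadingMode (-1) lam b a).wave t).f z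
  have hsplit : sourceZ lam a b t z - cubic lam (profileZ lam a b t z)
      = (halfSource 1 lam a b t z - (ρ : ℂ) ^ 3 * cubicHalf lam x y)
        + (halfSource (-1) lam b a t z - (ρ : ℂ) ^ 3 * cubicHalf lam y x)
        + ((ρ : ℂ) ^ 3 * (cubicHalf lam x y + cubicHalf lam y x)
          - cubic lam (profileZ lam a b t z)) := by
    rw [sourceZ]; ring
  rw [hsplit]
  refine (norm_add₃_le.trans (add_le_add_three hplus hminus hcubic)).trans ?_
  have h3 : modeConst lam K ^ 3 ≤ modeConst lam K ^ 4 := pow_le_pow_right₀ hG (by norm_num)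
  rw [← mul_add, ← mul_add]
  refine mul_le_mul_of_nonneg_left ?_ (by positivity)
  have h34 := mul_le_mul_of_nonneg_right h3 (hk.trans hkh)
  have hk4 := mul_le_mul_of_nonneg_left hkh (by positivity : 0 ≤ modeConst lam K ^ 4)
  linarith

end ResidualBound

section SobolevControl

theorem setIntegral_Ioc_le_eLpNorm_two {W : ℝ → ℝ} (hW : MemLp W 2 volume) (z : ℝ) :
    ∫ x in Set.Ioc z (z + 1), W x ≤ (eLpNorm W 2 volume).toReal := by
  have : IsProbabilityMeasure (volume.restrict (Set.Ioc z (z + 1))) := ⟨by simp⟩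
  have hm := hW.aestronglyMeasurable.restrict (s := Set.Ioc z (z + 1))
  have h1 : ∫ x in Set.Ioc z (z + 1), W x ≤
      (eLpNorm W 1 (volume.restrict (Set.Ioc z (z + 1)))).toReal := by
    refine (Real.le_norm_self _).trans ((norm_integral_le_integral_norm _).trans ?_)
    rw [eLpNorm_one_eq_lintegral_enorm, integral_norm_eq_lintegral_enorm hm]
  refine h1.trans (ENNReal.toReal_mono hW.2.ne ?_)
  exact (eLpNorm_le_eLpNorm_of_exponent_le (by norm_num) hm).trans
    (eLpNorm_restrict_le _ _ _ _)

namespace LocAC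

variable {E : Type*} [NormedAddCommGroup E] [NormedSpace ℝ E] [CompleteSpace E] {f f' : ℝ → E}

theorem norm_le_intervalIntegral (hf : LocAC f) (hd : ∀ᵐ x, HasDerivAt f (f' x) x)
    (hi : LocallyIntegrable f' volume) (z : ℝ) :
    ‖f z‖ ≤ ∫ x in z..(z + 1), (‖f x‖ + ‖f' x‖) := by
  have hI : ∀ a b, IntervalIntegrable f' volume a b := fun a b =>
    (hi.integrableOn_isCompact isCompact_uIcc).intervalIntegrable
  have hfI : IntervalIntegrable f volume z (z + 1) := hf.continuous.intervalIntegrable _ _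
  have hz : z ≤ z + 1 := by linarith
  set c := ∫ x in z..(z + 1), ‖f' x‖
  have hdist : ∀ y ∈ Set.Icc z (z + 1), ‖f z‖ ≤ ‖f y‖ + c := by
    intro y hy
    have h1 : ‖f y - f z‖ ≤ c := by
      rw [← hf.integral_eq_sub hd hi]
      refine (intervalIntegral.norm_integral_le_integral_norm hy.1).trans ?_
      exact intervalIntegral.integral_mono_interval le_rfl hy.1 hy.2
        (Eventually.of_forall fun x => norm_nonneg _) (hI _ _).norm
    linarith [norm_sub_norm_le (f z) (f y), norm_sub_rev (f z) (f y)]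
  calc ‖f z‖ = ∫ _ in z..(z + 1), ‖f z‖ := by simp
    _ ≤ ∫ y in z..(z + 1), (‖f y‖ + c) :=
        intervalIntegral.integral_mono_on hz (by simp) (hfI.norm.add (by simp)) hdist
    _ = ∫ y in z..(z + 1), (‖f y‖ + ‖f' y‖) := by
        rw [intervalIntegral.integral_add hfI.norm (by simp),
          intervalIntegral.integral_add hfI.norm (hI _ _).norm]
        simp [c]

/-- The one-dimensional Sobolev embedding `H¹ ⊆ L^∞`. -/
theorem norm_le_eLpNorm_two {W : ℝ → ℝ} (hf : LocAC f) (hd : ∀ᵐ x, HasDerivAt f (f' x) x)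
    (hm : AEStronglyMeasurable f' volume) (hW : MemLp W 2 volume)
    (hle : ∀ x, ‖f x‖ + ‖f' x‖ ≤ W x) (z : ℝ) : ‖f z‖ ≤ (eLpNorm W 2 volume).toReal := by
  have hi : LocallyIntegrable f' volume :=
    (hW.mono hm (Eventually.of_forall fun x =>
      ((le_add_of_nonneg_left (norm_nonneg _)).trans (hle x)).trans
        (Real.le_norm_self _))).locallyIntegrable (by norm_num)
  have hz : z ≤ z + 1 := by linarith
  refine (hf.norm_le_intervalIntegral hd hi z).trans ?_
  refine (intervalIntegral.integral_mono_on hz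
    ((hf.continuous.intervalIntegrable _ _).norm.add
      (hi.integrableOn_isCompact isCompact_uIcc).intervalIntegrable.norm)
    ((hW.locallyIntegrable (by norm_num)).integrableOn_isCompact isCompact_uIcc).intervalIntegrable
    fun x _ => hle x).trans ?_
  rw [intervalIntegral.integral_of_le hz]
  exact setIntegral_Ioc_le_eLpNorm_two hW z

theorem jbr_sq_mul_norm_le {W : ℝ → ℝ} (hf : LocAC f) (hd : ∀ᵐ x, HasDerivAt f (f' x) x)
    (hm : AEStronglyMeasurable f' volume) (hW : MemLp W 2 volume)
    (hle : ∀ x, jbr x ^ 2 * (‖f x‖ + ‖f' x‖) ≤ W x) (z : ℝ) :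
    jbr z ^ 2 * ‖f z‖ ≤ 2 * (eLpNorm W 2 volume).toReal := by
  have hw : ∀ x, HasDerivAt (fun x => jbr x ^ 2) (2 * x) x := fun x => by
    refine ((hasDerivAt_jbr x).fun_pow 2).congr_deriv ?_
    have := jbr_ne_zero x
    norm_num
    field_simp
  have hj := fun x => Real.norm_of_nonneg (sq_nonneg (jbr x))
  have hsob := norm_le_eLpNorm_two (W := (2 : ℝ) • W)
    ((LocAC.of_hasDerivAt hw (by fun_prop)).smul hf)
    (hd.mono fun x hx => (hw x).fun_smul hx)
    (by have := continuous_jbr; have := hf.continuous; fun_prop) (hW.const_smul 2) (fun x => ?_) z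
  · rwa [norm_smul, hj, eLpNorm_const_smul, ENNReal.toReal_mul, toReal_enorm,
      Real.norm_ofNat] at hsob
  have hx : |2 * x| ≤ jbr x ^ 2 := by
    rw [jbr_sq, abs_mul, Nat.abs_ofNat]
    linarith [two_mul_le_add_sq |x| 1, sq_abs x]
  have h0 : ‖jbr x ^ 2 • f x‖ = jbr x ^ 2 * ‖f x‖ := by rw [norm_smul, hj]
  have h1 : ‖jbr x ^ 2 • f' x + (2 * x) • f x‖ ≤ jbr x ^ 2 * ‖f' x‖ + jbr x ^ 2 * ‖f x‖ := by
    refine (norm_add_le _ _).trans ?_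
    rw [norm_smul, norm_smul, hj, Real.norm_eq_abs]
    gcongr
  have h2 : 0 ≤ jbr x ^ 2 * ‖f' x‖ := by positivity
  rw [h0, Pi.smul_apply, smul_eq_mul]
  linarith [hle x]

end LocAC

namespace Jet

/-- The pointwise size of a jet up to first order. -/
def size₁ (J : Jet) (z : ℝ) : ℝ := ‖J.f z‖ + ‖J.f₁ z‖

/-- The pointwise size of a jet up to second order. -/
def size₂ (J : Jet) (z : ℝ) : ℝ := ‖J.f z‖ + ‖J.f₁ z‖ + ‖J.f₂ z‖

/-- The pointwise size of a jet with the weight of `H^{2,5/2}`. -/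
def weightedSize (J : Jet) (z : ℝ) : ℝ := jbr z ^ (5 / 2 : ℝ) * J.size₂ z

variable (J : Jet)

theorem size₁_nonneg (z : ℝ) : 0 ≤ J.size₁ z := by unfold size₁; positivity

theorem size₂_nonneg (z : ℝ) : 0 ≤ J.size₂ z := by unfold size₂; positivity

theorem size₁_le_size₂ (z : ℝ) : J.size₁ z ≤ J.size₂ z :=
  le_add_of_nonneg_right (norm_nonneg _)

theorem measurable_size₂ : Measurable J.size₂ := by
  have h0 := J.continuous.measurable
  have h1 := J.continuous₁.measurable
  have h2 := J.measurable
  unfold size₂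
  fun_prop

theorem measurable_weightedSize : Measurable J.weightedSize :=
  (continuous_jbr.measurable.pow_const _).mul J.measurable_size₂

theorem jbr_sq_mul_le_weightedSize {x z : ℝ} (hx : 0 ≤ x) (h : x ≤ J.size₂ z) :
    jbr z ^ 2 * x ≤ J.weightedSize z := by
  refine mul_le_mul ?_ h hx (Real.rpow_nonneg (jbr_pos z).le _)
  rw [← Real.rpow_natCast]
  exact Real.rpow_le_rpow_of_exponent_le (one_le_jbr z) (by norm_num)

variable {J}

theorem jbr_sq_mul_size₁_le (hJ : MemLp J.weightedSize 2 volume) (z : ℝ) :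
    jbr z ^ 2 * J.size₁ z ≤ 4 * (eLpNorm J.weightedSize 2 volume).toReal := by
  have h0 := J.locAC₀.jbr_sq_mul_norm_le (Eventually.of_forall J.hasDerivAt)
    J.continuous₁.aestronglyMeasurable hJ
    (fun x => J.jbr_sq_mul_le_weightedSize (J.size₁_nonneg x) (J.size₁_le_size₂ x)) z
  have h1 := J.locAC.jbr_sq_mul_norm_le J.ae_hasDerivAt J.measurable.aestronglyMeasurable hJ
    (fun x => J.jbr_sq_mul_le_weightedSize (by positivity)
      (by unfold size₂; linarith [norm_nonneg (J.f x)])) z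
  rw [size₁, mul_add]
  linarith

theorem integrable_jbr_mul_size₂ (hJ : MemLp J.weightedSize 2 volume) :
    Integrable (fun z => jbr z * J.size₂ z) volume := by
  refine (hJ.integrable_sq.add integrable_inv_jbr_cube).mono'
    (continuous_jbr.measurable.mul J.measurable_size₂).aestronglyMeasurable
    (Eventually.of_forall fun z => ?_)
  have hj := jbr_pos z
  have hh := J.size₂_nonneg z
  have hw : J.weightedSize z ^ 2 = jbr z ^ 5 * J.size₂ z ^ 2 := by
    rw [weightedSize, mul_pow, ← Real.rpow_natCast, ← Real.rpow_mul hj.le]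
    norm_num
  have hsq : jbr z ^ 5 * J.size₂ z ^ 2 + (jbr z ^ 3)⁻¹ - jbr z * J.size₂ z
      = (jbr z ^ 3)⁻¹ * ((jbr z ^ 4 * J.size₂ z - 1 / 2) ^ 2 + 3 / 4) := by
    field_simp
    ring
  have hnonneg : 0 ≤ (jbr z ^ 3)⁻¹ * ((jbr z ^ 4 * J.size₂ z - 1 / 2) ^ 2 + 3 / 4) := by
    positivity
  rw [Real.norm_of_nonneg (by positivity), Pi.add_apply, hw]
  linarith

theorem controls_add {a b : Jet} {M N : ℝ} (hM : 0 ≤ M) (hN : 0 ≤ N)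
    (ha : eLpNorm a.weightedSize 2 volume ≤ ENNReal.ofReal M)
    (hb : eLpNorm b.weightedSize 2 volume ≤ ENNReal.ofReal N) :
    Controls (4 * (M + N)) (a.size₁ + b.size₁) (a.size₂ + b.size₂) where
  nonneg z := add_nonneg (a.size₁_nonneg z) (b.size₁_nonneg z)
  le_h z := add_le_add (a.size₁_le_size₂ z) (b.size₁_le_size₂ z)
  decay z := by
    have qa := jbr_sq_mul_size₁_le ⟨a.measurable_weightedSize.aestronglyMeasurable,
      ha.trans_lt ENNReal.ofReal_lt_top⟩ z
    have qb := jbr_sq_mul_size₁_le ⟨b.measurable_weightedSize.aestronglyMeasurable,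
      hb.trans_lt ENNReal.ofReal_lt_top⟩ z
    rw [Pi.add_apply, mul_add]
    linarith [ENNReal.toReal_le_of_le_ofReal hM ha, ENNReal.toReal_le_of_le_ofReal hN hb]

theorem jetBound_add_left (a b : Jet) :
    JetBound (a.size₁ + b.size₁) (a.size₂ + b.size₂) 1 a := by
  refine ⟨fun z => ?_, fun z => ?_, fun z => ?_⟩ <;>
    rw [one_mul, Pi.add_apply] <;>
    refine le_add_of_le_of_nonneg ?_ (by first | exact b.size₁_nonneg z | exact b.size₂_nonneg z)
  · exact le_add_of_nonneg_right (norm_nonneg _)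
  · exact le_add_of_nonneg_left (norm_nonneg _)
  · exact le_add_of_nonneg_left (by positivity)

theorem jetBound_add_right (a b : Jet) :
    JetBound (a.size₁ + b.size₁) (a.size₂ + b.size₂) 1 b := by
  simpa only [add_comm] using jetBound_add_left b a

end Jet

theorem wSobolevNorm_nonneg (k : ℕ) (s : ℝ) (A : ℝ → ℂ) : 0 ≤ wSobolevNorm k s A :=
  Finset.sum_nonneg fun _ _ => ENNReal.toReal_nonneg

theorem MemWSobolev.exists_jet_eLpNorm_weightedSize_le {A : ℝ → ℂ}
    (hA : MemWSobolev 2 (5 / 2) A) : ∃ J : Jet, J.f =ᵐ[volume] A ∧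
      eLpNorm J.weightedSize 2 volume ≤ ENNReal.ofReal (wSobolevNorm 2 (5 / 2) A) := by
  obtain ⟨J, e, e0, e1, e2⟩ := hA.exists_jet
  refine ⟨J, e, ?_⟩
  have m0 := (hA.2 0 (by norm_num)).2
  have m1 := (hA.2 1 (by norm_num)).2
  have m2 := (hA.2 2 (by norm_num)).2
  have hsum : J.weightedSize =ᵐ[volume]
      ((fun z => ‖(jbr z ^ (5 / 2 : ℝ)) • weakDeriv 0 A z‖)
        + fun z => ‖(jbr z ^ (5 / 2 : ℝ)) • weakDeriv 1 A z‖)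
        + fun z => ‖(jbr z ^ (5 / 2 : ℝ)) • weakDeriv 2 A z‖ := by
    filter_upwards [e0, e1, e2] with z h0 h1 h2
    simp only [Jet.weightedSize, Jet.size₂, Pi.add_apply, norm_smul,
      Real.norm_of_nonneg (Real.rpow_nonneg (jbr_pos z).le _), h0, h1, h2]
    ring
  rw [eLpNorm_congr_ae hsum]
  refine (eLpNorm_add_le (m0.norm.1.add m1.norm.1) m2.norm.1 (by norm_num)).trans
    ((add_le_add_left (eLpNorm_add_le m0.norm.1 m1.norm.1 (by norm_num)) _).trans ?_)
  rw [eLpNorm_norm, eLpNorm_norm, eLpNorm_norm, wSobolevNorm]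
  simp only [Finset.sum_range_succ, Finset.sum_range_zero, zero_add]
  rw [ENNReal.ofReal_add (by positivity) (by positivity),
    ENNReal.ofReal_add (by positivity) (by positivity),
    ENNReal.ofReal_toReal m0.2.ne, ENNReal.ofReal_toReal m1.2.ne, ENNReal.ofReal_toReal m2.2.ne]

end SobolevControl

section ProfileEstimates

variable {lam : ℝ} {a b : Jet}

theorem norm_halfProfile_le {σ : ℝ} {t : ℝ} (ht : 1 ≤ t) (z : ℝ) : ‖halfProfile σ lam a b t z‖ ≤
    t ^ (-(1 / 2) : ℝ) * (‖a.f z‖ + |lam| / 8 * (‖a.f z‖ ^ 2 * ‖b.f z‖)) := by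
  have ht0 := zero_lt_one.trans_le ht
  have hw : ∀ {σ : ℝ} {a b : Jet}, ‖((leadingMode σ lam a b).wave t).f z‖ = ‖a.f z‖ :=
    Mode.norm_wave _ t z
  have h3 : t ^ (-(3 / 2) : ℝ) ≤ t ^ (-(1 / 2) : ℝ) :=
    Real.rpow_le_rpow_of_exponent_le ht (by norm_num)
  rw [halfProfile_eq _ _ _ _ ht0, harmonicMode_wave_eq_leadingMode_wave, mul_add]
  refine norm_add_le_of_le ?_ ?_
  · rw [norm_mul, hw, Complex.norm_of_nonneg (by positivity)]
  · rw [norm_mul, norm_mul, norm_mul, norm_pow, hw, RCLike.norm_conj, hw, norm_neg, norm_div,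
      Complex.norm_ofNat, Complex.norm_of_nonneg (by positivity), Complex.norm_real,
      Real.norm_eq_abs]
    gcongr

theorem norm_profileZ_le {x y t z : ℝ} (ht : 1 ≤ t) (ha : ‖a.f z‖ ≤ x) (hb : ‖b.f z‖ ≤ y) :
    ‖profileZ lam a b t z‖ ≤
      (1 + |lam|) * t ^ (-(1 / 2) : ℝ) * (x + y) * jbr (x + y) ^ 2 := by
  have hx := (norm_nonneg _).trans ha
  have hy := (norm_nonneg _).trans hb
  calc ‖profileZ lam a b t z‖
      ≤ t ^ (-(1 / 2) : ℝ) * (‖a.f z‖ + |lam| / 8 * (‖a.f z‖ ^ 2 * ‖b.f z‖))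
        + t ^ (-(1 / 2) : ℝ) * (‖b.f z‖ + |lam| / 8 * (‖b.f z‖ ^ 2 * ‖a.f z‖)) :=
        norm_add_le_of_le (norm_halfProfile_le ht z) (norm_halfProfile_le ht z)
    _ ≤ t ^ (-(1 / 2) : ℝ) * (x + |lam| / 8 * (x ^ 2 * y))
        + t ^ (-(1 / 2) : ℝ) * (y + |lam| / 8 * (y ^ 2 * x)) := by gcongr
    _ = t ^ (-(1 / 2) : ℝ) * (x + y) * (1 + |lam| * (x * y / 8)) := by ring
    _ ≤ t ^ (-(1 / 2) : ℝ) * (x + y) * ((1 + |lam|) * (1 + (x + y) ^ 2)) := by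
        gcongr
        have hxy : x * y / 8 ≤ (x + y) ^ 2 := by nlinarith
        have hlam := abs_nonneg lam
        linarith [mul_le_mul_of_nonneg_left hxy hlam, sq_nonneg (x + y)]
    _ = _ := by rw [jbr_sq]; ring

theorem linftyNorm_nonneg (A : ℝ → ℂ) : 0 ≤ linftyNorm A := ENNReal.toReal_nonneg

theorem ae_norm_le_linftyNorm {A : ℝ → ℂ} (hA : MemLp A ∞ volume) :
    ∀ᵐ z, ‖A z‖ ≤ linftyNorm A := by
  filter_upwards [ae_le_eLpNormEssSup (f := A) (μ := volume)] with z hz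
  rw [← eLpNorm_exponent_top] at hz
  simpa [linftyNorm] using ENNReal.toReal_mono hA.2.ne hz

theorem eLpNorm_profile_top_le (ha : MemLp a.f ∞ volume) (hb : MemLp b.f ∞ volume) {t : ℝ}
    (ht : 1 ≤ t) : eLpNorm (profile lam a.f b.f t) ∞ volume ≤
      ENNReal.ofReal ((1 + |lam|) * t ^ (-(1 / 2) : ℝ) * (linftyNorm a.f + linftyNorm b.f) *
        jbr (linftyNorm a.f + linftyNorm b.f) ^ 2) := by
  rw [eLpNorm_exponent_top]
  refine eLpNormEssSup_le_of_ae_bound ?_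
  filter_upwards [ae_mu_of_ae t ((ae_norm_le_linftyNorm ha).and (ae_norm_le_linftyNorm hb))]
    with x hx
  rw [profile_eq_coneLift_profileZ]
  by_cases hxt : |x| < t
  · rw [coneLift, if_pos hxt]
    exact norm_profileZ_le ht (hx hxt).1 (hx hxt).2
  · rw [coneLift_of_not_lt _ hxt, norm_zero]
    have := linftyNorm_nonneg a.f
    have := linftyNorm_nonneg b.f
    positivity

theorem measurable_profile (lam : ℝ) (a b : Jet) (t : ℝ) :
    Measurable (profile lam a.f b.f t) := by
  rw [profile_eq_coneLift_profileZ]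
  have hcurve := fun m : Mode => (m.curve t).continuous.measurable.div_const (t : ℂ)
  exact measurable_coneLift t
    (((hcurve _).add (hcurve _)).add ((hcurve _).add (hcurve _)))

theorem measurable_sourceZ (lam : ℝ) (a b : Jet) (t : ℝ) : Measurable (sourceZ lam a b t) :=
  ((Mode.measurable_source _ t).add (Mode.measurable_source _ t)).add
    ((Mode.measurable_source _ t).add (Mode.measurable_source _ t))

theorem measurable_residual (lam : ℝ) (a b : Jet) (t : ℝ) : Measurable fun x =>
    coneLift t (sourceZ lam a b t) x - cubic lam (profile lam a.f b.f t x) := by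
  have hs := measurable_coneLift t (measurable_sourceZ lam a b t)
  have hp := measurable_profile lam a b t
  unfold cubic
  fun_prop

theorem isBoxPlusOne_profile {T : ℝ} (lam : ℝ) (ha : MemLp a.weightedSize 2 volume)
    (hb : MemLp b.weightedSize 2 volume) (hT : 0 ≤ T) :
    IsBoxPlusOne T (profile lam a.f b.f) fun t => coneLift t (sourceZ lam a b t) := by
  have H := Jet.controls_add ENNReal.toReal_nonneg ENNReal.toReal_nonneg
    (ENNReal.ofReal_toReal ha.2.ne).ge (ENNReal.ofReal_toReal hb.2.ne).ge
  have hh : Integrable (fun z => jbr z * (a.size₂ + b.size₂) z) volume := by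
    simp only [Pi.add_apply, mul_add]
    exact (Jet.integrable_jbr_mul_size₂ ha).add (Jet.integrable_jbr_mul_size₂ hb)
  have hJa := Jet.jetBound_add_left a b
  have hJb := Jet.jetBound_add_right a b
  have h1 : |(1 : ℝ)| = 1 := abs_one
  have h2 : |(-1 : ℝ)| = 1 := by rw [abs_neg, abs_one]
  have hsum :=
    (((leadingMode_controlled (lam := lam) H hJa hJb h1).isBoxPlusOne hh hT).add
      ((harmonicMode_controlled (lam := lam) H hJa hJb h1).isBoxPlusOne hh hT)).add
    (((leadingMode_controlled (lam := lam) H hJb hJa h2).isBoxPlusOne hh hT).add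
      ((harmonicMode_controlled (lam := lam) H hJb hJa h2).isBoxPlusOne hh hT))
  have coneLift_add₂ : ∀ (t : ℝ) (g₁ g₂ g₃ g₄ : ℝ → ℂ),
      coneLift t (fun z => (g₁ z + g₂ z) + (g₃ z + g₄ z)) = fun x =>
        (coneLift t g₁ x + coneLift t g₂ x) + (coneLift t g₃ x + coneLift t g₄ x) :=
    fun t g₁ g₂ g₃ g₄ => by
      rw [coneLift_add t (fun z => g₁ z + g₂ z), coneLift_add t g₁, coneLift_add t g₃]
  convert hsum using 1
  · funext t
    exact (profile_eq_coneLift_profileZ lam a b t).trans (coneLift_add₂ t _ _ _ _)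
  · exact funext fun t => coneLift_add₂ t _ _ _ _

theorem sqrt_mul_inv_jbr_cube_mul {t : ℝ} (ht : 0 < t) (z : ℝ) :
    Real.sqrt (t * (jbr z ^ 3)⁻¹) * (t ^ (-(1 / 2) : ℝ) / t ^ 2) * jbr z ^ 4
      = t ^ (-2 : ℝ) * jbr z ^ (5 / 2 : ℝ) := by
  have hj := jbr_pos z
  have hsplit : jbr z ^ 4 = Real.sqrt (jbr z ^ 3) * jbr z ^ (5 / 2 : ℝ) := by
    rw [Real.sqrt_eq_rpow, ← Real.rpow_natCast (jbr z) 3, ← Real.rpow_mul hj.le,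
      ← Real.rpow_add hj, ← Real.rpow_natCast (jbr z) 4]
    norm_num
  have h3 := (Real.sqrt_pos.2 (pow_pos hj 3)).ne'
  have h2 := (Real.sqrt_pos.2 ht).ne'
  rw [Real.sqrt_mul ht.le, Real.sqrt_inv, hsplit, Real.rpow_neg ht.le, Real.rpow_neg ht.le,
    ← Real.sqrt_eq_rpow, Real.rpow_two]
  field_simp

theorem eLpNorm_residual_le {M N : ℝ} (hM : 0 ≤ M) (hN : 0 ≤ N)
    (ha : eLpNorm a.weightedSize 2 volume ≤ ENNReal.ofReal M)
    (hb : eLpNorm b.weightedSize 2 volume ≤ ENNReal.ofReal N) {t : ℝ} (ht : 1 ≤ t) :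
    eLpNorm (fun x => coneLift t (sourceZ lam a b t) x - cubic lam (profile lam a.f b.f t x)) 2
      volume ≤ ENNReal.ofReal (65 * (modeConst lam (4 * (M + N)) ^ 4 * (1 + |Real.log t|) ^ 2)
        * t ^ (-2 : ℝ) * (M + N)) := by
  have ht0 := zero_lt_one.trans_le ht
  set Q := 65 * (modeConst lam (4 * (M + N)) ^ 4 * (1 + |Real.log t|) ^ 2) * t ^ (-2 : ℝ)
  have hQ : 0 ≤ Q := by positivity
  rw [eLpNorm_two_eq_of_eq_zero_outside_cone ht0 fun x hx => by
    rw [profile_eq_coneLift_profileZ, coneLift_of_not_lt _ hx, coneLift_of_not_lt _ hx, cubic,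
      mul_zero, sub_zero]]
  have hpoint : ∀ z, ‖Real.sqrt (t * (jbr z ^ 3)⁻¹) • (coneLift t (sourceZ lam a b t) (t * vel z)
      - cubic lam (profile lam a.f b.f t (t * vel z)))‖
        ≤ ‖(Q • (a.weightedSize + b.weightedSize)) z‖ := by
    intro z
    rw [profile_eq_coneLift_profileZ, coneLift_mul_vel ht0, coneLift_mul_vel ht0, norm_smul,
      Real.norm_of_nonneg (Real.sqrt_nonneg _)]
    refine (mul_le_mul_of_nonneg_left (norm_sourceZ_sub_cubic_le
      (Jet.controls_add hM hN ha hb) (Jet.jetBound_add_left a b) (Jet.jetBound_add_right a b) ht z)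
      (Real.sqrt_nonneg _)).trans (le_trans (le_of_eq ?_) (Real.le_norm_self _))
    simp only [Pi.smul_apply, Pi.add_apply, smul_eq_mul, Jet.weightedSize, Q]
    linear_combination (65 * (modeConst lam (4 * (M + N)) ^ 4 * (1 + |Real.log t|) ^ 2)
      * (a.size₂ z + b.size₂ z)) * sqrt_mul_inv_jbr_cube_mul ht0 z
  refine (eLpNorm_mono hpoint).trans ?_
  rw [eLpNorm_const_smul, Real.enorm_eq_ofReal hQ, ENNReal.ofReal_mul hQ, ENNReal.ofReal_add hM hN]
  gcongr
  exact (eLpNorm_add_le a.measurable_weightedSize.aestronglyMeasurable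
    b.measurable_weightedSize.aestronglyMeasurable (by norm_num)).trans (add_le_add ha hb)

theorem Jet.memLp_top (ha : MemLp a.weightedSize 2 volume) : MemLp a.f ∞ volume := by
  refine memLp_top_of_bound a.continuous.aestronglyMeasurable
    (4 * (eLpNorm a.weightedSize 2 volume).toReal) (Eventually.of_forall fun z => ?_)
  calc ‖a.f z‖ ≤ a.size₁ z := le_add_of_nonneg_right (norm_nonneg _)
    _ ≤ jbr z ^ 2 * a.size₁ z :=
        le_mul_of_one_le_left (a.size₁_nonneg z) (one_le_pow₀ (one_le_jbr z))
    _ ≤ _ := Jet.jbr_sq_mul_size₁_le ha z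

/-- The constant of the two estimates on the profile. -/
def profileConst (lam : ℝ) : ℝ := 1 + |lam| + 260 * (2016 * (|lam| + 1)) ^ 4

theorem profileConst_pos (lam : ℝ) : 0 < profileConst lam := by
  unfold profileConst
  positivity

theorem residual_bound_le {M t : ℝ} (hM : 0 ≤ M) (ht : 3 ≤ t) :
    65 * (modeConst lam (4 * M) ^ 4 * (1 + |Real.log t|) ^ 2) * t ^ (-2 : ℝ) * M ≤
      profileConst lam * t ^ (-2 : ℝ) * Real.log t ^ 2 * M * jbr M ^ 8 := by
  have hlog : 1 ≤ Real.log t :=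
    (Real.le_log_iff_exp_le (by linarith)).2 (by linarith [Real.exp_one_lt_d9])
  have hlogle : 1 + |Real.log t| ≤ 2 * Real.log t := by
    rw [abs_of_nonneg (by linarith)]
    linarith
  have hmode : modeConst lam (4 * M) ≤ 2016 * (|lam| + 1) * jbr M ^ 2 := by
    rw [modeConst, jbr_sq]
    nlinarith [abs_nonneg lam]
  have hmode0 : 0 ≤ modeConst lam (4 * M) := by
    unfold modeConst
    positivity
  have hj := jbr_pos M
  calc 65 * (modeConst lam (4 * M) ^ 4 * (1 + |Real.log t|) ^ 2) * t ^ (-2 : ℝ) * M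
      ≤ 65 * ((2016 * (|lam| + 1) * jbr M ^ 2) ^ 4 * (2 * Real.log t) ^ 2) * t ^ (-2 : ℝ) * M := by
        gcongr
    _ = 260 * (2016 * (|lam| + 1)) ^ 4 * t ^ (-2 : ℝ) * Real.log t ^ 2 * M * jbr M ^ 8 := by ring
    _ ≤ _ := by
        gcongr
        exact le_add_of_nonneg_left (by positivity)

variable {A B : ℝ → ℂ}

theorem exists_jets (hA : MemWSobolev 2 (5 / 2) A) (hB : MemWSobolev 2 (5 / 2) B) :
    ∃ a b : Jet, a.f =ᵐ[volume] A ∧ b.f =ᵐ[volume] B ∧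
      (eLpNorm a.weightedSize 2 volume ≤ ENNReal.ofReal (wSobolevNorm 2 (5 / 2) A) ∧
        eLpNorm b.weightedSize 2 volume ≤ ENNReal.ofReal (wSobolevNorm 2 (5 / 2) B)) ∧
      MemLp a.weightedSize 2 volume ∧ MemLp b.weightedSize 2 volume := by
  obtain ⟨a, ha, haW⟩ := hA.exists_jet_eLpNorm_weightedSize_le
  obtain ⟨b, hb, hbW⟩ := hB.exists_jet_eLpNorm_weightedSize_le
  exact ⟨a, b, ha, hb, ⟨haW, hbW⟩,
    ⟨a.measurable_weightedSize.aestronglyMeasurable, haW.trans_lt ENNReal.ofReal_lt_top⟩,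
    ⟨b.measurable_weightedSize.aestronglyMeasurable, hbW.trans_lt ENNReal.ofReal_lt_top⟩⟩

theorem memLp_profile_top (lam : ℝ) (hA : MemWSobolev 2 (5 / 2) A)
    (hB : MemWSobolev 2 (5 / 2) B) {t : ℝ} (ht : 1 ≤ t) :
    MemLp (profile lam A B t) ∞ volume ∧ eLpNorm (profile lam A B t) ∞ volume ≤
      ENNReal.ofReal (profileConst lam * t ^ (-(1 / 2) : ℝ) * (linftyNorm A + linftyNorm B) *
        jbr (linftyNorm A + linftyNorm B) ^ 2) := by
  obtain ⟨a, b, ha, hb, -, haL, hbL⟩ := exists_jets hA hB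
  have hcongr := profile_congr_ae lam ha hb t
  have hbound := eLpNorm_profile_top_le (lam := lam) (Jet.memLp_top haL) (Jet.memLp_top hbL) ht
  rw [eLpNorm_congr_ae hcongr, show linftyNorm a.f = linftyNorm A by
    rw [linftyNorm, eLpNorm_congr_ae ha, linftyNorm], show linftyNorm b.f = linftyNorm B by
    rw [linftyNorm, eLpNorm_congr_ae hb, linftyNorm]] at hbound
  refine ⟨⟨(measurable_profile lam a b t).aestronglyMeasurable.congr hcongr,
    hbound.trans_lt ENNReal.ofReal_lt_top⟩, hbound.trans (ENNReal.ofReal_le_ofReal ?_)⟩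
  have hm := add_nonneg (linftyNorm_nonneg A) (linftyNorm_nonneg B)
  gcongr
  exact le_add_of_nonneg_right (by positivity)

theorem exists_source_residual_le (lam : ℝ) (hA : MemWSobolev 2 (5 / 2) A)
    (hB : MemWSobolev 2 (5 / 2) B) :
    ∃ G : ℝ → ℝ → ℂ, IsBoxPlusOne 1 (profile lam A B) G ∧ ∀ t : ℝ, 3 ≤ t →
      MemLp (fun x => G t x - cubic lam (profile lam A B t x)) 2 volume ∧
      eLpNorm (fun x => G t x - cubic lam (profile lam A B t x)) 2 volume ≤
        ENNReal.ofReal (profileConst lam * t ^ (-2 : ℝ) * Real.log t ^ 2 *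
          (wSobolevNorm 2 (5 / 2) A + wSobolevNorm 2 (5 / 2) B) *
          jbr (wSobolevNorm 2 (5 / 2) A + wSobolevNorm 2 (5 / 2) B) ^ 8) := by
  obtain ⟨a, b, ha, hb, ⟨haW, hbW⟩, haL, hbL⟩ := exists_jets hA hB
  have hcongr := profile_congr_ae lam ha hb
  refine ⟨fun t => coneLift t (sourceZ lam a b t),
    (isBoxPlusOne_profile lam haL hbL zero_le_one).congr fun t _ => hcongr t, fun t ht => ?_⟩
  have hM := wSobolevNorm_nonneg 2 (5 / 2) A
  have hN := wSobolevNorm_nonneg 2 (5 / 2) B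
  have hres : (fun x => coneLift t (sourceZ lam a b t) x - cubic lam (profile lam a.f b.f t x))
      =ᵐ[volume] fun x => coneLift t (sourceZ lam a b t) x - cubic lam (profile lam A B t x) :=
    (hcongr t).mono fun x hx => by simp only [hx]
  have hbound := (eLpNorm_residual_le (lam := lam) hM hN haW hbW (by linarith : 1 ≤ t)).trans
    (ENNReal.ofReal_le_ofReal (residual_bound_le (add_nonneg hM hN) ht))
  rw [eLpNorm_congr_ae hres] at hbound
  exact ⟨⟨(measurable_residual lam a b t).aestronglyMeasurable.congr hres,
    hbound.trans_lt ENNReal.ofReal_lt_top⟩, hbound⟩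

theorem eventually_rpow_mul_log_sq_mul_le {δ Q ε : ℝ} (hδ : δ < 1) (hQ : 0 ≤ Q) (hε : 0 < ε) :
    ∀ᶠ t : ℝ in atTop, t ^ (-2 : ℝ) * Real.log t ^ 2 * Q ≤ ε * t ^ (-1 - δ) := by
  have h := (isLittleO_log_rpow_atTop (r := (1 - δ) / 2) (by linarith)).pow two_pos
  filter_upwards [h.def (c := ε / (Q + 1)) (by positivity), eventually_gt_atTop 0] with t ht ht0
  rw [← Real.rpow_mul_natCast ht0.le, Real.norm_of_nonneg (sq_nonneg _),
    Real.norm_of_nonneg (Real.rpow_nonneg ht0.le _), Nat.cast_ofNat,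
    div_mul_cancel₀ _ two_ne_zero] at ht
  calc t ^ (-2 : ℝ) * Real.log t ^ 2 * Q
      ≤ t ^ (-2 : ℝ) * (ε / (Q + 1) * t ^ (1 - δ)) * Q := by gcongr
    _ = ε * (Q / (Q + 1)) * (t ^ (-2 : ℝ) * t ^ (1 - δ)) := by ring
    _ ≤ ε * 1 * (t ^ (-2 : ℝ) * t ^ (1 - δ)) := by
        gcongr
        exact (div_le_one (by positivity)).2 (by linarith)
    _ = _ := by
        rw [← Real.rpow_add ht0]
        ring_nf

theorem exists_source_small (lam : ℝ) (hA : MemWSobolev 2 (5 / 2) A)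
    (hB : MemWSobolev 2 (5 / 2) B) {ε δ : ℝ} (hε : 0 < ε) (hδ : δ < 1)
    (hη : linftyNorm A + linftyNorm B ≤ min 1 (ε / (2 * profileConst lam))) :
    ∃ T : ℝ, 1 ≤ T ∧ ∃ G : ℝ → ℝ → ℂ, IsBoxPlusOne 1 (profile lam A B) G ∧ ∀ t : ℝ, T ≤ t →
      eLpNorm (profile lam A B t) ∞ volume ≤ ENNReal.ofReal (ε * t ^ (-(1 / 2) : ℝ)) ∧
      eLpNorm (fun x => G t x - cubic lam (profile lam A B t x)) 2 volume ≤
        ENNReal.ofReal (ε * t ^ (-1 - δ)) := by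
  obtain ⟨G, hG, hres⟩ := exists_source_residual_le lam hA hB
  have hsup := fun t ht => (memLp_profile_top lam hA hB (t := t) ht).2
  have hC := profileConst_pos lam
  have hm := add_nonneg (linftyNorm_nonneg A) (linftyNorm_nonneg B)
  have hM := add_nonneg (wSobolevNorm_nonneg 2 (5 / 2) A) (wSobolevNorm_nonneg 2 (5 / 2) B)
  generalize linftyNorm A + linftyNorm B = m at *
  generalize wSobolevNorm 2 (5 / 2) A + wSobolevNorm 2 (5 / 2) B = M at *
  have hj := jbr_pos M
  obtain ⟨T, hT⟩ := eventually_atTop.1 (eventually_rpow_mul_log_sq_mul_le hδ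
    (show 0 ≤ profileConst lam * M * jbr M ^ 8 by positivity) hε)
  refine ⟨max T 3, le_max_of_le_right (by norm_num), G, hG, fun t ht => ⟨?_, ?_⟩⟩ <;>
    obtain ⟨htT, ht3⟩ := max_le_iff.1 ht
  · have hmε : m * (2 * profileConst lam) ≤ ε :=
      (le_div_iff₀ (by positivity)).1 (hη.trans (min_le_right _ _))
    have hmj : m * jbr m ^ 2 ≤ 2 * m := by
      rw [jbr_sq]
      nlinarith [hη.trans (min_le_left _ _)]
    refine (hsup t (by linarith)).trans (ENNReal.ofReal_le_ofReal ?_)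
    calc profileConst lam * t ^ (-(1 / 2) : ℝ) * m * jbr m ^ 2
        = profileConst lam * t ^ (-(1 / 2) : ℝ) * (m * jbr m ^ 2) := by ring
      _ ≤ profileConst lam * t ^ (-(1 / 2) : ℝ) * (2 * m) := by gcongr
      _ = m * (2 * profileConst lam) * t ^ (-(1 / 2) : ℝ) := by ring
      _ ≤ ε * t ^ (-(1 / 2) : ℝ) := by gcongr
  · exact (hres t ht3).2.trans (ENNReal.ofReal_le_ofReal (by linarith [hT t htT]))

end ProfileEstimates

section ImaginaryPart

theorem carrier_sq (κ t z : ℝ) : (carrier κ t).f z ^ 2 = (carrier (2 * κ) t).f z := by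
  simp only [carrier, Jet.cexp_f, Jet.smul_f, ← Complex.exp_nat_mul]
  push_cast
  ring_nf

theorem conj_carrier (κ t z : ℝ) :
    (starRingEnd ℂ) ((carrier κ t).f z) = (carrier (-κ) t).f z := by
  simp only [carrier, Jet.cexp_f, Jet.smul_f, Jet.invJbr_f, ← Complex.exp_conj, map_mul,
    Complex.conj_I, Complex.conj_ofReal]
  push_cast
  ring_nf

theorem norm_integral_carrier_mul_le {κ t C : ℝ} {F F' : ℝ → ℂ}
    (hF : ∀ z, HasDerivAt F (F' z) z) (hF' : Continuous F')
    (hC : ∀ z, ‖F z‖ ≤ C * (jbr z ^ 2)⁻¹) (hC' : ∀ z, ‖F' z‖ ≤ C * (jbr z ^ 2)⁻¹) :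
    |κ| * |t| * ‖∫ z, (carrier κ t).f z * (Jet.invJbr.f₁ z * F z)‖
      ≤ C * ∫ z, (jbr z ^ 2)⁻¹ := by
  have hFc : Continuous F := continuous_iff_continuousAt.2 fun z => (hF z).continuousAt
  have hosc : ∀ {g : ℝ → ℂ}, Continuous g → (∀ z, ‖g z‖ ≤ C * (jbr z ^ 2)⁻¹) →
      Integrable g volume := fun hg hgC =>
    (integrable_inv_jbr_sq.const_mul C).mono' hg.aestronglyMeasurable (Eventually.of_forall hgC)
  have hcarrier : ∀ {g : ℝ → ℂ}, Integrable g volume →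
      Integrable (fun z => (carrier κ t).f z * g z) volume := fun hg =>
    hg.bdd_mul (carrier κ t).continuous.aestronglyMeasurable
      (Eventually.of_forall fun z => (norm_carrier κ t z).le)
  have hphase : Integrable (fun z => (carrier κ t).f z * (Jet.invJbr.f₁ z * F z)) volume :=
    hcarrier ((hosc hFc hC).bdd_mul Jet.invJbr.continuous₁.aestronglyMeasurable
      (Eventually.of_forall norm_invJbr_f₁_le))
  have hzero := integral_eq_zero_of_hasDerivAt_of_integrable
    (f := fun z => (carrier κ t).f z * F z)
    (f' := fun z => Complex.I * κ * t * ((carrier κ t).f z * (Jet.invJbr.f₁ z * F z))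
      + (carrier κ t).f z * F' z)
    (fun z => (((carrier κ t).hasDerivAt z).fun_mul (hF z)).congr_deriv (by
      rw [show (carrier κ t).f₁ z = (carrier κ t).f z * (Complex.I * κ * t * Jet.invJbr.f₁ z)
        from rfl]
      ring))
    ((hphase.const_mul _).add (hcarrier (hosc hF' hC'))) (hcarrier (hosc hFc hC))
  rw [integral_add (hphase.const_mul _) (hcarrier (hosc hF' hC')), integral_const_mul] at hzero
  calc |κ| * |t| * ‖∫ z, (carrier κ t).f z * (Jet.invJbr.f₁ z * F z)‖
      = ‖∫ z, (carrier κ t).f z * F' z‖ := by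
        rw [← norm_neg (∫ z, (carrier κ t).f z * F' z), ← eq_neg_of_add_eq_zero_left hzero]
        simp
    _ ≤ ∫ z, C * (jbr z ^ 2)⁻¹ :=
        norm_integral_le_of_norm_le (integrable_inv_jbr_sq.const_mul C)
          (Eventually.of_forall fun z => by
            rw [norm_mul, norm_carrier, one_mul]
            exact hC' z)
    _ = C * ∫ z, (jbr z ^ 2)⁻¹ := integral_const_mul ..

theorem ofReal_integral_rpow_half_le_eLpNorm_two {E : Type*} [NormedAddCommGroup E]
    {q : ℝ → ℝ} {f : ℝ → E} (hq : Integrable q volume) (h : ∀ z, q z ≤ ‖f z‖ ^ 2) :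
    ENNReal.ofReal (∫ z, q z) ^ (1 / 2 : ℝ) ≤ eLpNorm f 2 volume := by
  rw [eLpNorm_two_eq_lintegral]
  refine ENNReal.rpow_le_rpow ?_ (by norm_num)
  calc ENNReal.ofReal (∫ z, q z) ≤ ENNReal.ofReal (∫ z, max (q z) 0) :=
        ENNReal.ofReal_le_ofReal (integral_mono hq hq.pos_part fun z => le_max_left _ _)
    _ = ∫⁻ z, ENNReal.ofReal (max (q z) 0) :=
        ofReal_integral_eq_lintegral_ofReal hq.pos_part
          (Eventually.of_forall fun z => le_max_right _ _)
    _ ≤ ∫⁻ z, ‖f z‖ₑ ^ 2 := lintegral_mono fun z => by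
        rw [← ofReal_norm, ← ENNReal.ofReal_pow (norm_nonneg _)]
        exact ENNReal.ofReal_le_ofReal (max_le (h z) (sq_nonneg _))

/-- The squared derivative of the phase `⟨z⟩⁻¹`: a weight vanishing at the stationary point of the
carriers. -/
def phaseWeight (z : ℝ) : ℝ := (z / jbr z ^ 3) ^ 2

theorem ofReal_phaseWeight (z : ℝ) : (phaseWeight z : ℂ) = Jet.invJbr.f₁ z * Jet.invJbr.f₁ z := by
  rw [phaseWeight, Jet.invJbr_f₁]
  push_cast
  ring

theorem phaseWeight_nonneg (z : ℝ) : 0 ≤ phaseWeight z := sq_nonneg _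

theorem continuous_phaseWeight : Continuous phaseWeight :=
  (continuous_id.div (continuous_jbr.pow 3) fun z => pow_ne_zero 3 (jbr_ne_zero z)).pow 2

theorem phaseWeight_le (z : ℝ) : phaseWeight z ≤ (jbr z ^ 3)⁻¹ := by
  have hj := jbr_pos z
  have hz : z ^ 2 ≤ jbr z ^ 3 := (by linarith [jbr_sq z] : z ^ 2 ≤ jbr z ^ 2).trans
    (pow_le_pow_right₀ (one_le_jbr z) (by norm_num))
  rw [phaseWeight, div_pow, inv_eq_one_div, div_le_div_iff₀ (by positivity) (by positivity)]
  nlinarith [pow_pos hj 3]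

theorem integrable_phaseWeight_smul {E : Type*} [NormedAddCommGroup E] [NormedSpace ℝ E]
    {f : ℝ → E} (hf : Continuous f) {C : ℝ} (hC : ∀ z, ‖f z‖ ≤ C) :
    Integrable (fun z => phaseWeight z • f z) volume := by
  refine (integrable_inv_jbr_cube.mul_const C).mono'
    (continuous_phaseWeight.smul hf).aestronglyMeasurable (Eventually.of_forall fun z => ?_)
  rw [norm_smul, Real.norm_of_nonneg (phaseWeight_nonneg z)]
  exact mul_le_mul (phaseWeight_le z) (hC z) (norm_nonneg _) (inv_jbr_cube_pos z).le

theorem integrable_phaseWeight : Integrable phaseWeight volume := by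
  simpa only [smul_eq_mul, mul_one] using
    integrable_phaseWeight_smul (continuous_const (y := (1 : ℝ))) fun _ => le_rfl

theorem integral_phaseWeight_mul_pos {g : ℝ → ℝ} (hg : ∀ z, 0 ≤ g z)
    (hi : Integrable (fun z => phaseWeight z * g z) volume) (hpos : 0 < volume {z | g z ≠ 0}) :
    0 < ∫ z, phaseWeight z * g z := by
  refine (integral_pos_iff_support_of_nonneg (fun z => mul_nonneg (phaseWeight_nonneg z) (hg z))
    hi).2 (hpos.trans_le (measure_mono_ae ?_))
  filter_upwards [Measure.ae_ne volume (0 : ℝ)] with z hz hgz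
  exact mul_ne_zero (pow_ne_zero 2 (div_ne_zero hz (pow_ne_zero 3 (jbr_ne_zero z)))) hgz

theorem im_sq_eq (w : ℂ) : w.im ^ 2 = (‖w‖ ^ 2 - (w ^ 2).re) / 2 := by
  rw [Complex.sq_norm, Complex.normSq_apply, sq w, Complex.mul_re]
  ring

theorem half_sq_sub_sq_le_add_sq (x y : ℝ) : x ^ 2 / 2 - y ^ 2 ≤ (x + y) ^ 2 := by
  nlinarith [sq_nonneg (x + 2 * y)]

/-- Since `Im (α + β) = Im (α - β̄)`, the two leading waves of the profile have the same imaginary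
part as the carrier of frequency `-1` with this slowly varying amplitude. -/
def beat (lam : ℝ) (a b : Jet) (t : ℝ) : Jet :=
  ((leadingMode 1 lam a b).slow t).add (((leadingMode (-1) lam b a).slow t).conj.smul (-1))

variable {lam K t : ℝ} {a b : Jet} {k h : ℝ → ℝ}

theorem im_add_leadingMode_wave (t z : ℝ) :
    (((leadingMode 1 lam a b).wave t).f z + ((leadingMode (-1) lam b a).wave t).f z).im
      = ((carrier (-1) t).f z * (beat lam a b t).f z).im := by
  have hconj : ((leadingMode (-1) lam b a).wave t).f z = (starRingEnd ℂ) ((carrier (-1) t).f z *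
      (starRingEnd ℂ) (((leadingMode (-1) lam b a).slow t).f z)) := by
    rw [map_mul, conj_carrier, Complex.conj_conj, mul_comm]
    rfl
  have hadd : ((leadingMode 1 lam a b).wave t).f z =
      (carrier (-1) t).f z * ((leadingMode 1 lam a b).slow t).f z := mul_comm _ _
  rw [Complex.add_im, hconj, hadd, Complex.conj_im, ← Complex.neg_im, ← Complex.add_im, beat]
  simp only [Jet.add_f, Jet.smul_f, Jet.conj_f]
  ring_nf

theorem abs_norm_sub_norm_le_norm_beat (t z : ℝ) :
    |‖a.f z‖ - ‖b.f z‖| ≤ ‖(beat lam a b t).f z‖ := by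
  have h := abs_norm_sub_norm_le (((leadingMode 1 lam a b).slow t).f z)
    ((starRingEnd ℂ) (((leadingMode (-1) lam b a).slow t).f z))
  rw [RCLike.norm_conj, Mode.norm_slow, Mode.norm_slow, sub_eq_add_neg _ ((starRingEnd ℂ) _),
    ← neg_one_mul ((starRingEnd ℂ) _)] at h
  exact h

section Controlled

variable (H : Controls K k h) (ha : JetBound k h 1 a) (hb : JetBound k h 1 b)

include ha hb in
theorem norm_beat_le (t z : ℝ) : ‖(beat lam a b t).f z‖ ≤ 2 * k z := by
  have h1 := ((leadingMode 1 lam a b).norm_slow t z).trans_le (ha.b₀ z)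
  have h2 := ((leadingMode (-1) lam b a).norm_slow t z).trans_le (hb.b₀ z)
  rw [two_mul]
  refine norm_add_le_of_le (by linarith) ?_
  rw [Jet.smul_f, Jet.conj_f, neg_one_mul, norm_neg, RCLike.norm_conj]
  linarith

include H ha hb in
theorem norm_beat_f₁_le (t z : ℝ) :
    ‖(beat lam a b t).f₁ z‖ ≤ 2 * (modeConst lam K * (1 + |Real.log t|) * k z) := by
  have hslow : ∀ {σ : ℝ} {a b : Jet}, |σ| = 1 → JetBound k h 1 a → JetBound k h 1 b →
      ‖((leadingMode σ lam a b).slow t).f₁ z‖ ≤ modeConst lam K * (1 + |Real.log t|) * k z :=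
    fun hσ ha hb => ((leadingMode_controlled H ha hb hσ).norm_slow_f₁_le t z).trans (by
      rw [one_mul]
      exact mul_le_mul_of_nonneg_right (leadingMode_growth_le K t) (H.nonneg z))
  rw [two_mul]
  refine norm_add_le_of_le (hslow abs_one ha hb) ?_
  rw [Jet.smul_f₁, Jet.conj_f₁, neg_one_mul, norm_neg, RCLike.norm_conj]
  exact hslow (by rw [abs_neg, abs_one]) hb ha

include H ha hb in
theorem norm_integral_beat_le (t : ℝ) :
    2 * |t| * ‖∫ z, phaseWeight z • ((carrier (-2) t).f z * (beat lam a b t).f z ^ 2)‖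
      ≤ 24 * (modeConst lam K * (1 + |Real.log t|)) * K ^ 2 * ∫ z, (jbr z ^ 2)⁻¹ := by
  have hQ : 1 ≤ modeConst lam K * (1 + |Real.log t|) := one_le_mul_of_one_le_of_one_le
    (one_le_modeConst lam K) (le_add_of_nonneg_right (abs_nonneg _))
  have hG := norm_beat_le (lam := lam) ha hb t
  have hG₁ := norm_beat_f₁_le (lam := lam) H ha hb t
  set Q := modeConst lam K * (1 + |Real.log t|)
  set G := beat lam a b t
  have hkk : ∀ z, 0 ≤ k z * k z := fun z => mul_nonneg (H.nonneg z) (H.nonneg z)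
  have hQkk : ∀ z, k z * k z ≤ Q * (k z * k z) := fun z => le_mul_of_one_le_left (hkk z) hQ
  have hbound : ∀ z, 24 * Q * (k z * k z) ≤ 24 * Q * K ^ 2 * (jbr z ^ 2)⁻¹ := fun z => by
    rw [mul_assoc _ (K ^ 2)]
    exact mul_le_mul_of_nonneg_left (H.k_mul_k_le_inv_jbr_sq z) (by linarith)
  have hphase := norm_integral_carrier_mul_le (κ := -2) (t := t)
    (F := fun z => Jet.invJbr.f₁ z * (G.mul G).f z)
    (F' := fun z => Jet.invJbr.f₂ z * (G.mul G).f z + Jet.invJbr.f₁ z * (G.mul G).f₁ z)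
    (fun z => ((hasDerivAt_neg_div_jbr_cube z).ofReal_comp).fun_mul ((G.mul G).hasDerivAt z))
    (((Complex.continuous_ofReal.comp continuous_second_deriv_inv_jbr).mul
      (G.mul G).continuous).add (Jet.invJbr.continuous₁.mul (G.mul G).continuous₁))
    (fun z => (norm_mul_le_of_le (norm_invJbr_f₁_le z)
      (norm_mul_le_of_le (hG z) (hG z))).trans (le_trans (by linarith [hkk z, hQkk z]) (hbound z)))
    (fun z => (norm_add_le_of_le (norm_mul_le_of_le (norm_invJbr_f₂_le z)
      (norm_mul_le_of_le (hG z) (hG z))) (norm_mul_le_of_le (norm_invJbr_f₁_le z)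
      (norm_add_le_of_le (norm_mul_le_of_le (hG₁ z) (hG z))
        (norm_mul_le_of_le (hG z) (hG₁ z))))).trans
      (le_trans (by linarith [hkk z, hQkk z]) (hbound z)))
  rw [abs_neg, Nat.abs_ofNat] at hphase
  convert hphase using 4
  funext z
  simp only [Complex.real_smul, ofReal_phaseWeight, Jet.mul_f]
  ring

end Controlled

end ImaginaryPart

section ImaginaryPartLowerBound

variable {lam K : ℝ} {a b : Jet} {k h : ℝ → ℝ}

theorem profile_of_not_lt (lam : ℝ) (A B : ℝ → ℂ) {t x : ℝ} (hx : ¬ |x| < t) :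
    profile lam A B t x = 0 := by
  simp only [profile, uap, vap, if_neg hx, add_zero]

theorem mul_im_sq {t : ℝ} (ht : 0 < t) (w v : ℂ) :
    t * ((t ^ (-(1 / 2) : ℝ) : ℝ) * w + (t ^ (-(1 / 2) : ℝ) / t : ℝ) * v).im ^ 2
      = (w.im + v.im / t) ^ 2 := by
  rw [Complex.add_im, Complex.im_ofReal_mul, Complex.im_ofReal_mul]
  calc _ = t * (t ^ (-(1 / 2) : ℝ)) ^ 2 * (w.im + v.im / t) ^ 2 := by ring
    _ = _ := by rw [rpow_neg_half_sq ht, mul_inv_cancel₀ ht.ne', one_mul]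

section Controlled

variable (H : Controls K k h) (ha : JetBound k h 1 a) (hb : JetBound k h 1 b)
include H ha hb

theorem tendsto_integral_beat :
    Tendsto (fun t => ∫ z, phaseWeight z • ((carrier (-2) t).f z * (beat lam a b t).f z ^ 2))
      atTop (nhds 0) := by
  have hlog : Tendsto (fun t : ℝ => t⁻¹ + Real.log t / t) atTop (nhds 0) := by
    simpa using tendsto_inv_atTop_zero.add Real.isLittleO_log_id_atTop.tendsto_div_nhds_zero
  have hbound := hlog.const_mul (12 * modeConst lam K * K ^ 2 * ∫ z, (jbr z ^ 2)⁻¹)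
  rw [mul_zero] at hbound
  refine squeeze_zero_norm' ?_ hbound
  filter_upwards [eventually_ge_atTop 1] with t ht
  have ht0 := zero_lt_one.trans_le ht
  have hphase := norm_integral_beat_le (lam := lam) H ha hb t
  rw [abs_of_pos ht0, abs_of_nonneg (Real.log_nonneg ht)] at hphase
  rw [← one_div, ← add_div, ← mul_div_assoc, le_div_iff₀ ht0]
  linarith

theorem integrable_phaseWeight_mul_norm_sub_sq :
    Integrable (fun z => phaseWeight z * (‖a.f z‖ - ‖b.f z‖) ^ 2) volume := by
  refine integrable_phaseWeight_smul (C := K ^ 2)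
    ((a.continuous.norm.sub b.continuous.norm).pow 2) fun z => ?_
  rw [Real.norm_of_nonneg (sq_nonneg _)]
  have hka := (ha.b₀ z).trans_eq (one_mul _)
  have hkb := (hb.b₀ z).trans_eq (one_mul _)
  have hk := H.le_K z
  exact sq_le_sq' (by linarith [norm_nonneg (a.f z)]) (by linarith [norm_nonneg (b.f z)])

theorem integrable_phaseWeight_smul_beat (t : ℝ) : Integrable (fun z =>
    phaseWeight z • ((carrier (-2) t).f z * (beat lam a b t).f z ^ 2)) volume := by
  refine integrable_phaseWeight_smul (C := (2 * K) ^ 2)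
    ((carrier (-2) t).continuous.mul ((beat lam a b t).continuous.pow 2)) fun z => ?_
  rw [norm_mul, norm_carrier, one_mul, norm_pow]
  exact pow_le_pow_left₀ (norm_nonneg _) ((norm_beat_le ha hb t z).trans
    (mul_le_mul_of_nonneg_left (H.le_K z) zero_le_two)) 2

theorem im_add_harmonicMode_wave_div_sq_le (t z : ℝ) :
    ((((harmonicMode 1 lam a b).wave t).f z + ((harmonicMode (-1) lam b a).wave t).f z).im / t) ^ 2
      ≤ (4 * |lam| * K ^ 3 / t) ^ 2 := by
  have hharm : ∀ {σ : ℝ} {a b : Jet}, |σ| = 1 → JetBound k h 1 a → JetBound k h 1 b →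
      ‖((harmonicMode σ lam a b).wave t).f z‖ ≤ 2 * |lam| * K ^ 2 * K := fun hσ ha hb =>
    (norm_harmonicMode_wave_le H ha hb hσ t z).trans
      (mul_le_mul_of_nonneg_left (H.le_K z) (by positivity))
  have hsum := norm_add_le_of_le (hharm abs_one ha hb) (hharm (by rw [abs_neg, abs_one]) hb ha)
  rw [div_pow, div_pow]
  refine div_le_div_of_nonneg_right (sq_le_sq.2 (le_trans ?_ (le_abs_self _))) (sq_nonneg t)
  exact (Complex.abs_im_le_norm _).trans (hsum.trans (by linarith))

theorem le_mul_im_profileZ_sq {t : ℝ} (ht : 0 < t) (z : ℝ) :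
    (‖a.f z‖ - ‖b.f z‖) ^ 2 / 4 - ((carrier (-2) t).f z * (beat lam a b t).f z ^ 2).re / 4
      - (4 * |lam| * K ^ 3 / t) ^ 2 ≤ t * (profileZ lam a b t z).im ^ 2 := by
  have hbeat := sq_le_sq.2 ((abs_norm_sub_norm_le_norm_beat (lam := lam) t z).trans
    (le_abs_self _) : |‖a.f z‖ - ‖b.f z‖| ≤ |‖(beat lam a b t).f z‖|)
  have him := im_sq_eq ((carrier (-1) t).f z * (beat lam a b t).f z)
  rw [norm_mul, norm_carrier, one_mul, mul_pow, carrier_sq, mul_neg_one] at him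
  rw [profileZ_eq lam a b ht, mul_im_sq ht]
  refine le_trans ?_ (half_sq_sub_sq_le_add_sq _ _)
  rw [im_add_leadingMode_wave, him]
  linarith [im_add_harmonicMode_wave_div_sq_le (lam := lam) H ha hb t z]

theorem ofReal_rpow_half_le_eLpNorm_im_profile {t : ℝ} (ht : 0 < t) :
    ENNReal.ofReal ((∫ z, phaseWeight z * (‖a.f z‖ - ‖b.f z‖) ^ 2) / 4
        - (∫ z, phaseWeight z • ((carrier (-2) t).f z * (beat lam a b t).f z ^ 2)).re / 4
        - (∫ z, phaseWeight z) * (4 * |lam| * K ^ 3 / t) ^ 2) ^ (1 / 2 : ℝ)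
      ≤ eLpNorm (fun x => (profile lam a.f b.f t x).im) 2 volume := by
  have hN := (integrable_phaseWeight_mul_norm_sub_sq H ha hb).div_const 4
  have hI := (integrable_phaseWeight_smul_beat (lam := lam) H ha hb t).re.div_const 4
  have hD := integrable_phaseWeight.mul_const ((4 * |lam| * K ^ 3 / t) ^ 2)
  have hre := integral_re (integrable_phaseWeight_smul_beat (lam := lam) H ha hb t)
  simp only [RCLike.re_to_complex] at hI hre
  rw [← hre, ← integral_div, ← integral_div, ← integral_mul_const, ← integral_sub hN hI,
    ← integral_sub (hN.sub' hI) hD, eLpNorm_two_eq_of_eq_zero_outside_cone ht fun x hx => by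
      rw [profile_of_not_lt lam _ _ hx, Complex.zero_im]]
  refine ofReal_integral_rpow_half_le_eLpNorm_two ((hN.sub' hI).sub' hD) fun z => ?_
  rw [profile_eq_coneLift_profileZ, coneLift_mul_vel ht, norm_smul, mul_pow, Real.norm_eq_abs,
    sq_abs, Real.sq_sqrt (mul_inv_jbr_cube_pos ht z).le, Real.norm_eq_abs, sq_abs,
    Complex.real_smul, Complex.re_ofReal_mul]
  calc _ = phaseWeight z * ((‖a.f z‖ - ‖b.f z‖) ^ 2 / 4
        - ((carrier (-2) t).f z * (beat lam a b t).f z ^ 2).re / 4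
        - (4 * |lam| * K ^ 3 / t) ^ 2) := by ring
    _ ≤ (jbr z ^ 3)⁻¹ * (t * (profileZ lam a b t z).im ^ 2) :=
        (mul_le_mul_of_nonneg_left (le_mul_im_profileZ_sq H ha hb ht z)
          (phaseWeight_nonneg z)).trans (mul_le_mul_of_nonneg_right (phaseWeight_le z)
            (mul_nonneg ht.le (sq_nonneg _)))
    _ = _ := by ring

theorem liminf_im_profile_jet_pos (hne : 0 < volume {z | ‖a.f z‖ ≠ ‖b.f z‖}) :
    0 < liminf (fun t : ℝ => eLpNorm (fun x => (profile lam a.f b.f t x).im) 2 volume)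
      atTop := by
  set N := ∫ z, phaseWeight z * (‖a.f z‖ - ‖b.f z‖) ^ 2
  have hN : 0 < N := by
    refine integral_phaseWeight_mul_pos (fun z => sq_nonneg _)
      (integrable_phaseWeight_mul_norm_sub_sq H ha hb) ?_
    simpa only [ne_eq, sq_eq_zero_iff, sub_eq_zero] using hne
  have hI := (Complex.continuous_re.tendsto 0).comp
    (tendsto_integral_beat (lam := lam) H ha hb)
  have hD := (((tendsto_const_nhds (x := 4 * |lam| * K ^ 3)).div_atTop tendsto_id).pow 2).const_mul
    (∫ z, phaseWeight z)
  have hlim := ((hI.div_const 4).const_sub (N / 4)).sub hD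
  simp only [Complex.zero_re, zero_div, sub_zero, zero_pow two_ne_zero, mul_zero] at hlim
  refine (ENNReal.rpow_pos (ENNReal.ofReal_pos.2 (by positivity : 0 < N / 8))
    ENNReal.ofReal_ne_top : 0 < ENNReal.ofReal (N / 8) ^ (1 / 2 : ℝ)).trans_le
    (le_liminf_of_le (by isBoundedDefault) ?_)
  filter_upwards [hlim.eventually_const_le (by linarith : N / 8 < N / 4), eventually_gt_atTop 0]
    with t hle ht
  exact (ENNReal.rpow_le_rpow (ENNReal.ofReal_le_ofReal hle) (by norm_num)).trans
    (ofReal_rpow_half_le_eLpNorm_im_profile H ha hb ht)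

end Controlled

variable {A B : ℝ → ℂ}

theorem memLp_profile_two (lam : ℝ) (hA : MemWSobolev 2 (5 / 2) A)
    (hB : MemWSobolev 2 (5 / 2) B) {t : ℝ} (ht : 1 ≤ t) :
    MemLp (profile lam A B t) 2 volume := by
  refine (memLp_profile_top lam hA hB ht).1.mono_exponent_of_measure_support_ne_top
    (s := Metric.ball 0 t) (fun x hx => profile_of_not_lt lam A B fun h => hx ?_)
    measure_ball_lt_top.ne le_top
  rwa [mem_ball_zero_iff]

theorem liminf_im_profile_pos (lam : ℝ) (hA : MemWSobolev 2 (5 / 2) A)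
    (hB : MemWSobolev 2 (5 / 2) B) (hne : 0 < volume {ξ | ‖A ξ‖ ≠ ‖B ξ‖}) :
    0 < liminf (fun t : ℝ => eLpNorm (fun x => (profile lam A B t x).im) 2 volume) atTop := by
  obtain ⟨a, b, ha, hb, -, haL, hbL⟩ := exists_jets hA hB
  have H := Jet.controls_add ENNReal.toReal_nonneg ENNReal.toReal_nonneg
    (ENNReal.ofReal_toReal haL.2.ne).ge (ENNReal.ofReal_toReal hbL.2.ne).ge
  have hne' : 0 < volume {z | ‖a.f z‖ ≠ ‖b.f z‖} := by
    refine hne.trans_le (measure_mono_ae ?_)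
    filter_upwards [ha, hb] with z hza hzb hz
    change ‖a.f z‖ ≠ ‖b.f z‖
    rwa [hza, hzb]
  have hpos := liminf_im_profile_jet_pos (lam := lam) H (Jet.jetBound_add_left a b)
    (Jet.jetBound_add_right a b) hne'
  have hcongr : ∀ t, eLpNorm (fun x => (profile lam a.f b.f t x).im) 2 volume =
      eLpNorm (fun x => (profile lam A B t x).im) 2 volume := fun t =>
    eLpNorm_congr_ae ((profile_congr_ae lam ha hb t).mono fun x hx => by simp only [hx])
  simpa only [hcongr] using hpos

end ImaginaryPartLowerBound

end KG

end

theorem propositionP (lam : ℝ) :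
    (∃ C : ℝ, 0 < C ∧ ∀ A B : ℝ → ℂ,
      KG.MemWSobolev 2 (5 / 2) A → KG.MemWSobolev 2 (5 / 2) B →
        (∀ t : ℝ, 3 ≤ t →
          MemLp (KG.profile lam A B t) ∞ volume ∧
          eLpNorm (KG.profile lam A B t) ∞ volume ≤
            ENNReal.ofReal (C * t ^ (-(1 / 2) : ℝ) *
              (KG.linftyNorm A + KG.linftyNorm B) *
              KG.jbr (KG.linftyNorm A + KG.linftyNorm B) ^ 2)) ∧
        ∃ G : ℝ → ℝ → ℂ, KG.IsBoxPlusOne 1 (KG.profile lam A B) G ∧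
          ∀ t : ℝ, 3 ≤ t →
            MemLp (fun x => G t x - KG.cubic lam (KG.profile lam A B t x)) 2 volume ∧
            eLpNorm (fun x => G t x - KG.cubic lam (KG.profile lam A B t x)) 2 volume ≤
              ENNReal.ofReal (C * t ^ (-2 : ℝ) * Real.log t ^ 2 *
                (KG.wSobolevNorm 2 (5 / 2) A + KG.wSobolevNorm 2 (5 / 2) B) *
                KG.jbr (KG.wSobolevNorm 2 (5 / 2) A + KG.wSobolevNorm 2 (5 / 2) B) ^ 8)) ∧
    (∀ ε : ℝ, 0 < ε → ∃ η : ℝ, 0 < η ∧ ∀ A B : ℝ → ℂ,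
      KG.MemWSobolev 2 (5 / 2) A → KG.MemWSobolev 2 (5 / 2) B →
      KG.linftyNorm A + KG.linftyNorm B ≤ η →
        ∀ δ : ℝ, δ < 1 → ∃ T : ℝ, 1 ≤ T ∧
          ∃ G : ℝ → ℝ → ℂ, KG.IsBoxPlusOne 1 (KG.profile lam A B) G ∧
            ∀ t : ℝ, T ≤ t →
              eLpNorm (KG.profile lam A B t) ∞ volume ≤
                ENNReal.ofReal (ε * t ^ (-(1 / 2) : ℝ)) ∧
              eLpNorm (fun x => G t x - KG.cubic lam (KG.profile lam A B t x)) 2 volume ≤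
                ENNReal.ofReal (ε * t ^ (-1 - δ))) ∧
    (∀ A B : ℝ → ℂ,
      KG.MemWSobolev 2 (5 / 2) A → KG.MemWSobolev 2 (5 / 2) B →
      0 < volume {ξ : ℝ | ‖A ξ‖ ≠ ‖B ξ‖} →
        (∀ t : ℝ, 3 ≤ t → MemLp (KG.profile lam A B t) 2 volume) ∧
        0 < liminf (fun t : ℝ => eLpNorm (fun x => (KG.profile lam A B t x).im) 2 volume)
          atTop) := by
  refine ⟨⟨KG.profileConst lam, KG.profileConst_pos lam, fun A B hA hB =>
      ⟨fun t ht => KG.memLp_profile_top lam hA hB (by linarith),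
        KG.exists_source_residual_le lam hA hB⟩⟩,
    fun ε hε => ⟨min 1 (ε / (2 * KG.profileConst lam)), ?_, fun A B hA hB hη δ hδ =>
      KG.exists_source_small lam hA hB hε hδ hη⟩,
    fun A B hA hB hne => ⟨fun t ht => KG.memLp_profile_two lam hA hB (by linarith),
      KG.liminf_im_profile_pos lam hA hB hne⟩⟩
  have := KG.profileConst_pos lam
  positivity
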